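/- For an integer $N\ge 2$ let $\sigma_N$ be the uniform probability measure on Kac's sphere $\mathbb S^{N-1}(\sqrt N)\subset\mathbb R^N$. A symmetric probability density is a measurable $F\ge 0$ on $\mathbb S^{N-1}(\sqrt N)$ with $\int F\,d\sigma_N=1$ that is invariant under permutations of the coordinates. For $i\neq j$ and $\theta\in[0,2\pi]$ let $R_{i,j,\theta}$ be the map of the sphere that replaces $(v_i,v_j)$ by $(v_i\cos\theta+v_j\sin\theta,\,-v_i\sin\theta+v_j\cos\theta)$ and leaves the other coordinates fixed. For $x,y\ge 0$ put $\psi(x,y)=(x-y)\log(x/y)$ and, for $\beta>0$, $\psi_\beta(x,y)=|x-y|\,|\log(x/y)|^{1+\beta}$, both being $0$ if $x=y$ and $+\infty$ if exactly one of $x,y$ is $0$. Define $$\mathcal H_N(F)=\int F\log F\,d\sigma_N,$$ $$\mathcal D_{N,\gamma}(F)=\frac{1}{4\pi}\frac{N}{\binom N2}\sum_{i<j}\int\int_0^{2\pi}\bigl(1+v_i^2+v_j^2\bigr)^{\gamma}\,\psi\bigl(F(V),F(R_{i,j,\theta}V)\bigr)\,d\theta\,d\sigma_N(V)\in[0,\infty].$$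 **Theorem.** There is an absolute constant $c>0$ with the following property. Let $\beta>0$, $k>1+1/\beta$, $0\le\gamma\le1$, $\mathcal C_\beta>0$ and $M\ge0$ be real numbers. Put $$p=\frac{(1-\gamma)(1+\beta)}{k\beta-(1+\beta)},\qquad B=\frac{\mathcal C_\beta}{2}\Bigl(2\cdot 3^{k}(1+2M)\Bigr)^{\frac{\beta}{1+\beta}},\qquad C=\Bigl(\frac{c}{1+p}\Bigr)^{1+p}\Bigl(\frac{p}{B}\Bigr)^{p},$$ with $0^0=1$ (so $C=c$ if $\gamma=1$). Then $C>0$. Let $\{F_N\}_{N\ge2}$ be any family of symmetric probability densities on $\mathbb S^{N-1}(\sqrt N)$ that is log-power of order $\beta$ with log-power constant $\mathcal C_\beta$, that is, $$\sup_{N\ge2}\frac1{2\pi}\int_0^{2\pi}\int\psi_\beta\bigl(F_N(V),F_N(R_{1,2,\theta}V)\bigr)\,d\sigma_N(V)\,d\theta\le\mathcal C_\beta^{1+\beta},$$ and whose first marginals satisfy $$\sup_{N\ge2}\int|v_1|^{2k}F_N\,d\sigma_N\le M.$$ Then for every $N\ge2$ the function $F_N\log F_N$ is $\sigma_N$-integrable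 and $$\frac{\mathcal D_{N,\gamma}(F_N)}{N}\ge C\left(\frac{\mathcal H_N(F_N)}{N}\right)^{1+p}.$$ -/

import Mathlib

open MeasureTheory
open scoped ENNReal

noncomputable section

namespace KacModel

/-- Kac's sphere `S^{N-1}(√N)` in `ℝ^N` with its Euclidean norm. -/
abbrev KacSphere (N : ℕ) : Type :=
  Metric.sphere (0 : EuclideanSpace ℝ (Fin N)) (Real.sqrt N)

/-- The dilation `u ↦ √N u` from the unit sphere onto Kac's sphere. -/
def dilate (N : ℕ) (u : Metric.sphere (0 : EuclideanSpace ℝ (Fin N)) 1) : KacSphere N :=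
  ⟨Real.sqrt N • (u : EuclideanSpace ℝ (Fin N)), by
    have hu : ‖(u : EuclideanSpace ℝ (Fin N))‖ = 1 := mem_sphere_zero_iff_norm.1 u.2
    simp [norm_smul, hu, abs_of_nonneg (Real.sqrt_nonneg _)]⟩

/-- The uniform probability measure `σ_N` on Kac's sphere: the normalised surface measure of the
unit sphere, transported by the dilation. -/
def kacMeasure (N : ℕ) : Measure (KacSphere N) :=
  Measure.map (dilate N)
    (((volume : Measure (EuclideanSpace ℝ (Fin N))).toSphere Set.univ)⁻¹ •
      (volume : Measure (EuclideanSpace ℝ (Fin N))).toSphere)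

theorem mem_kacSphere_iff {N : ℕ} (v : EuclideanSpace ℝ (Fin N)) :
    v ∈ Metric.sphere (0 : EuclideanSpace ℝ (Fin N)) (Real.sqrt N) ↔ ∑ l, v l ^ 2 = N := by
  rw [mem_sphere_zero_iff_norm, EuclideanSpace.norm_eq,
    Real.sqrt_inj (Finset.sum_nonneg fun _ _ => sq_nonneg _) (Nat.cast_nonneg N)]
  simp

/-- Relabelling of the particles by a permutation. -/
def permute {N : ℕ} (π : Equiv.Perm (Fin N)) (V : KacSphere N) : KacSphere N :=
  ⟨WithLp.toLp 2 fun l => V.1 (π l), by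
    rw [mem_kacSphere_iff]
    exact (Equiv.sum_comp π fun l => V.1 l ^ 2).trans ((mem_kacSphere_iff V.1).1 V.2)⟩

/-- The velocities after a collision of the particles `i` and `j` with scattering angle `θ`. -/
def collide {N : ℕ} (i j : Fin N) (θ : ℝ) (v : Fin N → ℝ) (l : Fin N) : ℝ :=
  if l = i then v i * Real.cos θ + v j * Real.sin θ
  else if l = j then -(v i * Real.sin θ) + v j * Real.cos θ
  else v l

theorem sum_sq_collide {N : ℕ} {i j : Fin N} (hij : i ≠ j) (θ : ℝ) (v : Fin N → ℝ) :
    ∑ l, collide i j θ v l ^ 2 = ∑ l, v l ^ 2 := by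
  rw [← Finset.add_sum_erase _ _ (Finset.mem_univ i),
    ← Finset.add_sum_erase _ _ (Finset.mem_erase.2 ⟨hij.symm, Finset.mem_univ j⟩),
    ← Finset.add_sum_erase (Finset.univ) (fun l => v l ^ 2) (Finset.mem_univ i),
    ← Finset.add_sum_erase (Finset.univ.erase i) (fun l => v l ^ 2)
      (Finset.mem_erase.2 ⟨hij.symm, Finset.mem_univ j⟩)]
  have hrest : ∑ l ∈ (Finset.univ.erase i).erase j, collide i j θ v l ^ 2 =
      ∑ l ∈ (Finset.univ.erase i).erase j, v l ^ 2 := by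
    refine Finset.sum_congr rfl fun l hl => ?_
    simp only [Finset.mem_erase] at hl
    simp [collide, hl.1, hl.2.1]
  rw [hrest]
  simp only [collide, if_true, if_neg hij.symm]
  linear_combination (v i ^ 2 + v j ^ 2) * Real.sin_sq_add_cos_sq θ

/-- The collision map `R_{i,j,θ}` of Kac's sphere. -/
def rot {N : ℕ} (i j : Fin N) (hij : i ≠ j) (θ : ℝ) (V : KacSphere N) : KacSphere N :=
  ⟨WithLp.toLp 2 (collide i j θ fun l => V.1 l), by
    rw [mem_kacSphere_iff]
    exact (sum_sq_collide hij θ _).trans ((mem_kacSphere_iff V.1).1 V.2)⟩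

/-- `F` is a symmetric probability density on Kac's sphere with respect to `σ_N`. -/
structure IsSymmDensity {N : ℕ} (F : KacSphere N → ℝ) : Prop where
  measurable : Measurable F
  nonneg : ∀ V, 0 ≤ F V
  lintegral_eq_one : ∫⁻ V, ENNReal.ofReal (F V) ∂(kacMeasure N) = 1
  symm : ∀ (π : Equiv.Perm (Fin N)) (V : KacSphere N), F (permute π V) = F V

/-- `ψ(x,y) = (x - y) log (x / y)` for `x, y ≥ 0`, with its limiting values on the boundary:
`ψ(x,x) = 0`, and `ψ(x,y) = ∞` if exactly one of `x`, `y` vanishes. -/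
def psi (x y : ℝ) : ℝ≥0∞ :=
  if x = y then 0 else if x = 0 ∨ y = 0 then ∞
  else ENNReal.ofReal ((x - y) * Real.log (x / y))

/-- `ψ_β(x,y) = |x - y| |log (x / y)|^{1+β}` for `x, y ≥ 0`, with the same boundary values. -/
def psiPow (β x y : ℝ) : ℝ≥0∞ :=
  if x = y then 0 else if x = 0 ∨ y = 0 then ∞
  else ENNReal.ofReal (|x - y| * |Real.log (x / y)| ^ (1 + β))

/-- Kac's entropy `H_N(F) = ∫ F log F dσ_N`. -/
def entropy {N : ℕ} (F : KacSphere N → ℝ) : ℝ :=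
  ∫ V, F V * Real.log (F V) ∂(kacMeasure N)

/-- The entropy production `D_{N,γ}(F)` of the Kac model with collision intensity
`(1 + v_i² + v_j²)^γ`, with values in `[0,∞]`. -/
def entropyProduction {N : ℕ} (γ : ℝ) (F : KacSphere N → ℝ) : ℝ≥0∞ :=
  ENNReal.ofReal (1 / (4 * Real.pi) * (N / (N.choose 2 : ℝ))) *
    ∑ p : {p : Fin N × Fin N // p.1 < p.2},
      ∫⁻ V, ∫⁻ θ in Set.Icc (0 : ℝ) (2 * Real.pi),
        ENNReal.ofReal ((1 + (V.1 p.1.1 ^ 2 + V.1 p.1.2 ^ 2)) ^ γ) *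
          psi (F V) (F (rot p.1.1 p.1.2 p.2.ne θ V)) ∂volume ∂(kacMeasure N)

/-- The index of the first particle. -/
def first {N : ℕ} (hN : 2 ≤ N) : Fin N := ⟨0, by omega⟩

/-- The index of the second particle. -/
def second {N : ℕ} (hN : 2 ≤ N) : Fin N := ⟨1, by omega⟩

theorem first_ne_second {N : ℕ} (hN : 2 ≤ N) : first hN ≠ second hN := by
  simp [first, second]

/-- The family `F` is log-power of order `β` with log-power constant `Cβ`. -/
def IsLogPowerWith (β Cβ : ℝ) (F : ∀ N : ℕ, KacSphere N → ℝ) : Prop :=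
  ∀ (N : ℕ) (hN : 2 ≤ N),
    ENNReal.ofReal (1 / (2 * Real.pi)) *
      ∫⁻ θ in Set.Icc (0 : ℝ) (2 * Real.pi), ∫⁻ V,
        psiPow β (F N V) (F N (rot (first hN) (second hN) (first_ne_second hN) θ V))
          ∂(kacMeasure N) ∂volume
      ≤ ENNReal.ofReal (Cβ ^ (1 + β))

/-- The moment `M_{2k}(F_{N,1}) = ∫ |v_1|^{2k} F_N dσ_N` of the first marginal. -/
def moment {N : ℕ} (hN : 2 ≤ N) (k : ℝ) (F : KacSphere N → ℝ) : ℝ≥0∞ :=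
  ∫⁻ V, ENNReal.ofReal (|V.1 (first hN)| ^ (2 * k) * F V) ∂(kacMeasure N)

/-- The gain `p = (1 - γ)(1 + β) / (kβ - (1 + β))` in the exponent `1 + p`. -/
def gain (β k γ : ℝ) : ℝ := (1 - γ) * (1 + β) / (k * β - (1 + β))

/-- The constant `(c / (1 + p))^{1+p} (p / B)^p` with
`B = (Cβ / 2) (2 · 3^k (1 + 2 M))^{β/(1+β)}`; for `γ = 1`, that is `p = 0`, it is `c`. -/
def rateConstant (c β k γ Cβ M : ℝ) : ℝ :=
  (c / (1 + gain β k γ)) ^ (1 + gain β k γ) *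
    (gain β k γ / (Cβ / 2 * (2 * 3 ^ k * (1 + 2 * M)) ^ (β / (1 + β)))) ^ gain β k γ

end KacModel

end

open MeasureTheory
open scoped ENNReal

noncomputable section

namespace KacModel

open Set Filter Topology MvPolynomial
open scoped Pointwise

/-! Two estimates are combined. For γ = 1 the entropy production dominates the entropy linearly,
D_1(F) ≥ (e^{-48}/2) H(F), uniformly in N (`entropy_le_entropyProduction`). For γ < 1 the missing
power of the weight is recovered by truncation. Where 1 + v_1² + v_2² ≤ R, the weight is at most
R^{1-γ} times its γ-th power. On the rest, Hölder's inequality, the log-power bound and the moment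
bound make the contribution to D_1/N at most B R^{-s} with s = (kβ - (1+β))/(1+β)
(`lintegral_tail_le_ofReal`). The best R gives the exponent 1 + p, where p = (1-γ)/s.

The case γ = 1 is a heat flow argument. Let L_ij = v_j ∂_i - v_i ∂_j generate the rotations
R_{i,j,θ}, so that Δ = (1/N) Σ_{i<j} L_ij² is the Laplacian of the sphere, and let f_t solve the
heat equation from f. Write H for the entropy, I = Σ_{a,b} ∫ (L_ab f)²/f for the Fisher information,
and S for the sum over pairs i < j of the integrals of (1 + v_i² + v_j²) ψ(f, f∘R_{i,j,θ}) over the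
sphere and over θ. Then H' = -I/(2N), and the core of the proof is S' ≤ 4S - 2πI. Three facts give
it. The Hessian of ψ is the quadratic form (x+y)(ξ/x - η/y)². The weight w satisfies Δw ≤ 4w and
absorbs the loss in (L_ij u)² ≤ (v_i² + v_j²)|∇u|². Finally, L_ij log f has mean zero on every orbit
of the rotations R_{i,j,θ}, so averaging over θ loses no Fisher information
(`IsHeatFlow.exists_hasDerivAt_pairProduction`).

For N ≥ 3 the commutation relations of the L_ab play the role of a Ricci bound: I' ≤ -I/12, hence H
≤ (6/N) I and H(f_12) ≤ H(f)/e. Integrating the inequality for S up to time 12 gives S(f) ≥ 2πN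
e^{-48} H(f). On the circle, N = 2, this curvature degenerates, but expanding ψ gives the bound at
once.

The flow is run only on positive polynomials. Polynomials of bounded degree form a finite
dimensional space preserved by Δ, so the heat equation is a linear ODE and positivity follows from a
minimum principle. A general density is smoothed with the kernel (2 + ⟨V,W⟩/N)^m, which produces a
positive polynomial. By Jensen's inequality D_1 at most doubles when m is large, and Fatou's lemma
passes the bound to the limit and shows that F log F is integrable. -/

variable {N : ℕ}

/-! ### Orthogonal invariance of the uniform measure, and plane rotations -/

/-- The map of Kac's sphere induced by a linear isometry. -/
def isoMap (e : EuclideanSpace ℝ (Fin N) ≃ₗᵢ[ℝ] EuclideanSpace ℝ (Fin N)) (V : KacSphere N) :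
    KacSphere N :=
  ⟨e V.1, by
    have := V.2
    rw [mem_sphere_zero_iff_norm] at this ⊢
    rw [e.norm_map, this]⟩

/-- The map of the unit sphere induced by a linear isometry. -/
def unitIsoMap (e : EuclideanSpace ℝ (Fin N) ≃ₗᵢ[ℝ] EuclideanSpace ℝ (Fin N))
    (V : Metric.sphere (0 : EuclideanSpace ℝ (Fin N)) 1) :
    Metric.sphere (0 : EuclideanSpace ℝ (Fin N)) 1 :=
  ⟨e V.1, by
    have := V.2
    rw [mem_sphere_zero_iff_norm] at this ⊢
    rw [e.norm_map, this]⟩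

theorem continuous_isoMap (e : EuclideanSpace ℝ (Fin N) ≃ₗᵢ[ℝ] EuclideanSpace ℝ (Fin N)) :
    Continuous (isoMap e) :=
  Continuous.subtype_mk (e.continuous.comp continuous_subtype_val) _

theorem continuous_unitIsoMap (e : EuclideanSpace ℝ (Fin N) ≃ₗᵢ[ℝ] EuclideanSpace ℝ (Fin N)) :
    Continuous (unitIsoMap e) :=
  Continuous.subtype_mk (e.continuous.comp continuous_subtype_val) _

theorem continuous_dilate : Continuous (dilate N) :=
  Continuous.subtype_mk (by fun_prop :
    Continuous fun u : Metric.sphere (0 : EuclideanSpace ℝ (Fin N)) 1 => Real.sqrt N • u.1) _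

/-- Up to the dimension factor, the surface measure of a set is the volume of the open cone over it.
The cone over a preimage under `e` is the preimage of the cone, and `e` preserves volume. -/
theorem measurePreserving_unitIsoMap
    (e : EuclideanSpace ℝ (Fin N) ≃ₗᵢ[ℝ] EuclideanSpace ℝ (Fin N)) :
    MeasurePreserving (unitIsoMap e) (volume : Measure (EuclideanSpace ℝ (Fin N))).toSphere
      (volume : Measure (EuclideanSpace ℝ (Fin N))).toSphere := by
  refine ⟨(continuous_unitIsoMap e).measurable, ?_⟩
  ext s hs
  rw [Measure.map_apply (continuous_unitIsoMap e).measurable hs, Measure.toSphere_apply' _ hs,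
    Measure.toSphere_apply' _ ((continuous_unitIsoMap e).measurable hs)]
  congr 1
  have hset : Ioo (0 : ℝ) 1 • (Subtype.val '' (unitIsoMap e ⁻¹' s)) =
      e ⁻¹' (Ioo (0 : ℝ) 1 • (Subtype.val '' s)) := by
    ext x
    simp only [Set.mem_smul, mem_image, mem_preimage]
    constructor
    · rintro ⟨r, hr, _, ⟨u, hu, rfl⟩, rfl⟩
      exact ⟨r, hr, _, ⟨_, hu, rfl⟩, by simp [unitIsoMap]⟩
    · rintro ⟨r, hr, _, ⟨u, hu, rfl⟩, hx⟩
      refine ⟨r, hr, e.symm u.1, ⟨unitIsoMap e.symm u, ?_, rfl⟩, ?_⟩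
      · have : unitIsoMap e (unitIsoMap e.symm u) = u := Subtype.ext (by simp [unitIsoMap])
        rwa [this]
      · rw [← map_smul, hx, e.symm_apply_apply]
  rw [hset]
  exact e.measurePreserving.measure_preimage_equiv (f := e.toMeasurableEquiv) _

theorem measurePreserving_isoMap
    (e : EuclideanSpace ℝ (Fin N) ≃ₗᵢ[ℝ] EuclideanSpace ℝ (Fin N)) :
    MeasurePreserving (isoMap e) (kacMeasure N) (kacMeasure N) := by
  refine ⟨(continuous_isoMap e).measurable, ?_⟩
  have h : isoMap e ∘ dilate N = dilate N ∘ unitIsoMap e := by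
    funext u
    exact Subtype.ext (by simp [isoMap, dilate, unitIsoMap])
  rw [kacMeasure, Measure.map_map (continuous_isoMap e).measurable continuous_dilate.measurable, h,
    ← Measure.map_map continuous_dilate.measurable (continuous_unitIsoMap e).measurable,
    Measure.map_smul, (measurePreserving_unitIsoMap e).map_eq]

theorem isProbabilityMeasure_kacMeasure (hN : N ≠ 0) : IsProbabilityMeasure (kacMeasure N) := by
  have : Nonempty (Fin N) := ⟨⟨0, Nat.pos_of_ne_zero hN⟩⟩
  constructor
  rw [kacMeasure, Measure.map_apply continuous_dilate.measurable MeasurableSet.univ, preimage_univ,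
    Measure.smul_apply, smul_eq_mul]
  refine ENNReal.inv_mul_cancel ?_ (measure_ne_top _ _)
  rw [Ne, Measure.measure_univ_eq_zero]
  exact Measure.toSphere_ne_zero _

/-- For `N = 0` the unit sphere is empty and the measure is zero. Covering this case frees the
integrability of continuous functions from any condition on `N`. -/
instance : IsFiniteMeasure (kacMeasure N) := by
  rcases eq_or_ne N 0 with rfl | hN
  · have : (volume : Measure (EuclideanSpace ℝ (Fin 0))).toSphere = 0 := by
      rw [Measure.toSphere_eq_zero_iff]
      infer_instance
    rw [kacMeasure, this]
    simp only [smul_zero, Measure.map_zero]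
    infer_instance
  · have := isProbabilityMeasure_kacMeasure hN
    infer_instance

/-- Needed for the concentration of the smoothing kernels in `tendsto_smooth`. -/
theorem kacMeasure_pos_of_isOpen {U : Set (KacSphere N)} (hU : IsOpen U) (hne : U.Nonempty)
    (hN : N ≠ 0) : 0 < kacMeasure N U := by
  obtain ⟨V, hV⟩ := hne
  have hs : (0 : ℝ) < Real.sqrt N := Real.sqrt_pos.2 (by positivity)
  rw [kacMeasure, Measure.map_apply continuous_dilate.measurable hU.measurableSet,
    Measure.smul_apply, smul_eq_mul]
  refine ENNReal.mul_pos (ENNReal.inv_ne_zero.2 (measure_ne_top _ _)) ?_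
  refine (hU.preimage continuous_dilate).measure_ne_zero _ ⟨⟨(Real.sqrt N)⁻¹ • V.1, ?_⟩, ?_⟩
  · have := V.2
    rw [mem_sphere_zero_iff_norm] at this ⊢
    rw [norm_smul, this, norm_inv, Real.norm_of_nonneg hs.le, inv_mul_cancel₀ hs.ne']
  · have : dilate N ⟨(Real.sqrt N)⁻¹ • V.1, by
        have := V.2
        rw [mem_sphere_zero_iff_norm] at this ⊢
        rw [norm_smul, this, norm_inv, Real.norm_of_nonneg hs.le, inv_mul_cancel₀ hs.ne']⟩ = V :=
      Subtype.ext (by simp [dilate, smul_smul, hs.ne'])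
    rw [mem_preimage, this]
    exact hV

/-- A norm preserving linear endomorphism is an isometric equivalence. -/
def isoOfNorm (f : EuclideanSpace ℝ (Fin N) →ₗ[ℝ] EuclideanSpace ℝ (Fin N))
    (hf : ∀ x, ‖f x‖ = ‖x‖) : EuclideanSpace ℝ (Fin N) ≃ₗᵢ[ℝ] EuclideanSpace ℝ (Fin N) :=
  (LinearIsometry.mk f hf).toLinearIsometryEquiv rfl

theorem norm_eq_of_sum_sq {x y : EuclideanSpace ℝ (Fin N)} (h : ∑ l, x l ^ 2 = ∑ l, y l ^ 2) :
    ‖x‖ = ‖y‖ := by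
  simp [EuclideanSpace.norm_eq, h]

/-- The rotation in the plane of the coordinates `i` and `j`. -/
def rotIso (i j : Fin N) (hij : i ≠ j) (θ : ℝ) :
    EuclideanSpace ℝ (Fin N) ≃ₗᵢ[ℝ] EuclideanSpace ℝ (Fin N) :=
  isoOfNorm
    { toFun := fun v => WithLp.toLp 2 (collide i j θ fun l => v l)
      map_add' := fun x y => by
        ext l
        simp only [collide, PiLp.add_apply]
        split_ifs <;> ring
      map_smul' := fun r x => by
        ext l
        simp only [collide, PiLp.smul_apply, smul_eq_mul, RingHom.id_apply]
        split_ifs <;> ring }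
    fun x => norm_eq_of_sum_sq (sum_sq_collide hij θ _)

theorem measurePreserving_rot (i j : Fin N) (hij : i ≠ j) (θ : ℝ) :
    MeasurePreserving (rot i j hij θ) (kacMeasure N) (kacMeasure N) :=
  measurePreserving_isoMap (rotIso i j hij θ)

theorem isoMap_piLpCongrLeft (π : Equiv.Perm (Fin N)) :
    isoMap (LinearIsometryEquiv.piLpCongrLeft 2 ℝ ℝ π.symm) = permute π := by
  funext V
  refine Subtype.ext ?_
  ext l
  simp [isoMap, permute, LinearIsometryEquiv.piLpCongrLeft_apply, Equiv.piCongrLeft'_apply]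

theorem measurePreserving_permute (π : Equiv.Perm (Fin N)) :
    MeasurePreserving (permute π) (kacMeasure N) (kacMeasure N) :=
  isoMap_piLpCongrLeft π ▸ measurePreserving_isoMap _

/-- Transitivity comes from the reflection in the hyperplane orthogonal to `V - W`, which exchanges
two vectors of equal norm. -/
theorem exists_isoMap_eq (V W : KacSphere N) :
    ∃ e : EuclideanSpace ℝ (Fin N) ≃ₗᵢ[ℝ] EuclideanSpace ℝ (Fin N), isoMap e V = W :=
  ⟨(Submodule.span ℝ {V.1 - W.1})ᗮ.reflection, Subtype.ext (Submodule.reflection_sub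
    ((mem_sphere_zero_iff_norm.1 V.2).trans (mem_sphere_zero_iff_norm.1 W.2).symm))⟩

theorem rot_add (i j : Fin N) (hij : i ≠ j) (s θ : ℝ) (V : KacSphere N) :
    rot i j hij s (rot i j hij θ V) = rot i j hij (s + θ) V := by
  refine Subtype.ext ?_
  ext l
  simp only [rot, collide, hij.symm, if_true, if_false, Real.sin_add, Real.cos_add]
  split_ifs <;> ring

theorem rot_zero (i j : Fin N) (hij : i ≠ j) (V : KacSphere N) : rot i j hij 0 V = V := by
  refine Subtype.ext ?_
  ext l
  simp only [rot, collide, Real.cos_zero, Real.sin_zero]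
  split_ifs with h1 h2
  · simp [h1]
  · simp [h2]
  · rfl

theorem rot_two_pi (i j : Fin N) (hij : i ≠ j) (V : KacSphere N) :
    rot i j hij (2 * Real.pi) V = V := by
  have h : rot i j hij (2 * Real.pi) V = rot i j hij 0 V := by
    refine Subtype.ext ?_
    ext l
    simp [rot, collide]
  rw [h, rot_zero]

theorem continuous_rot (i j : Fin N) (hij : i ≠ j) :
    Continuous fun q : ℝ × KacSphere N => rot i j hij q.1 q.2 := by
  refine Continuous.subtype_mk ((PiLp.continuous_toLp 2 _).comp (continuous_pi fun l => ?_)) _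
  simp only [collide]
  split_ifs <;> fun_prop

theorem continuous_rot_const (i j : Fin N) (hij : i ≠ j) (θ : ℝ) :
    Continuous (rot i j hij θ : KacSphere N → KacSphere N) :=
  (continuous_rot i j hij).comp (continuous_const.prodMk continuous_id)

theorem integrable_of_continuous {f : KacSphere N → ℝ} (hf : Continuous f) :
    Integrable f (kacMeasure N) := by
  simpa using hf.continuousOn.integrableOn_compact (μ := kacMeasure N) isCompact_univ

theorem integral_comp_isoMap (e : EuclideanSpace ℝ (Fin N) ≃ₗᵢ[ℝ] EuclideanSpace ℝ (Fin N))
    (f : KacSphere N → ℝ) :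
    ∫ V, f (isoMap e V) ∂(kacMeasure N) = ∫ V, f V ∂(kacMeasure N) := by
  refine (measurePreserving_isoMap e).integral_comp ?_ f
  refine MeasurableEquiv.measurableEmbedding (⟨⟨isoMap e, isoMap e.symm, fun V => ?_, fun V => ?_⟩,
    (continuous_isoMap e).measurable, (continuous_isoMap e.symm).measurable⟩ :
      KacSphere N ≃ᵐ KacSphere N)
  · exact Subtype.ext (by simp [isoMap])
  · exact Subtype.ext (by simp [isoMap])

theorem integral_comp_rot (i j : Fin N) (hij : i ≠ j) (θ : ℝ) (f : KacSphere N → ℝ) :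
    ∫ V, f (rot i j hij θ V) ∂(kacMeasure N) = ∫ V, f V ∂(kacMeasure N) :=
  integral_comp_isoMap (rotIso i j hij θ) f

theorem coord_sq_sum (V : KacSphere N) : ∑ l, V.1 l ^ 2 = N := (mem_kacSphere_iff V.1).1 V.2

theorem continuous_coord (l : Fin N) : Continuous fun V : KacSphere N => V.1 l :=
  (EuclideanSpace.proj (𝕜 := ℝ) l).continuous.comp continuous_subtype_val

/-! ### Polynomials on the sphere, angular derivatives and the Laplacian -/

/-- The restriction of a polynomial to Kac's sphere. -/
def ev (p : MvPolynomial (Fin N) ℝ) (V : KacSphere N) : ℝ := MvPolynomial.eval (fun l => V.1 l) p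

/-- Evaluation at a point of the sphere, as a linear form. -/
def evLin (V : KacSphere N) : MvPolynomial (Fin N) ℝ →ₗ[ℝ] ℝ :=
  (MvPolynomial.aeval (R := ℝ) fun l => V.1 l).toLinearMap

theorem evLin_apply (V : KacSphere N) (p : MvPolynomial (Fin N) ℝ) : evLin V p = ev p V := by
  simp [evLin, ev]

@[simp] theorem ev_add (p q : MvPolynomial (Fin N) ℝ) (V : KacSphere N) :
    ev (p + q) V = ev p V + ev q V := by simp [ev]

@[simp] theorem ev_sub (p q : MvPolynomial (Fin N) ℝ) (V : KacSphere N) :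
    ev (p - q) V = ev p V - ev q V := by simp [ev]

@[simp] theorem ev_neg (p : MvPolynomial (Fin N) ℝ) (V : KacSphere N) :
    ev (-p) V = -ev p V := by simp [ev]

@[simp] theorem ev_mul (p q : MvPolynomial (Fin N) ℝ) (V : KacSphere N) :
    ev (p * q) V = ev p V * ev q V := by simp [ev]

@[simp] theorem ev_smul (r : ℝ) (p : MvPolynomial (Fin N) ℝ) (V : KacSphere N) :
    ev (r • p) V = r * ev p V := by simp [ev]

@[simp] theorem ev_C (r : ℝ) (V : KacSphere N) : ev (C r) V = r := by simp [ev]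

@[simp] theorem ev_one (V : KacSphere N) : ev 1 V = 1 := by simp [ev]

@[simp] theorem ev_zero (V : KacSphere N) : ev 0 V = 0 := by simp [ev]

@[simp] theorem ev_X (l : Fin N) (V : KacSphere N) : ev (X l) V = V.1 l := by simp [ev]

@[simp] theorem ev_pow (p : MvPolynomial (Fin N) ℝ) (n : ℕ) (V : KacSphere N) :
    ev (p ^ n) V = ev p V ^ n := by simp [ev]

@[simp] theorem ev_sum {ι : Type*} (s : Finset ι) (f : ι → MvPolynomial (Fin N) ℝ)
    (V : KacSphere N) : ev (∑ a ∈ s, f a) V = ∑ a ∈ s, ev (f a) V := by simp [ev]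

theorem continuous_ev (p : MvPolynomial (Fin N) ℝ) : Continuous (ev p) := by
  induction p using MvPolynomial.induction_on with
  | C r => simpa [funext (ev_C r)] using continuous_const
  | add p q hp hq =>
    rw [funext (ev_add p q)]
    exact hp.add hq
  | mul_X p l hp =>
    have h : ev (p * X l) = fun V => ev p V * V.1 l := by
      funext V
      simp
    rw [h]
    exact hp.mul (continuous_coord l)

/-- The generator `x_j ∂_i - x_i ∂_j` of the rotations in the plane of `i` and `j`. -/
def angular (i j : Fin N) : Derivation ℝ (MvPolynomial (Fin N) ℝ) (MvPolynomial (Fin N) ℝ) :=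
  (X j : MvPolynomial (Fin N) ℝ) • pderiv i - (X i : MvPolynomial (Fin N) ℝ) • pderiv j

theorem angular_apply (i j : Fin N) (p : MvPolynomial (Fin N) ℝ) :
    angular i j p = X j * pderiv i p - X i * pderiv j p := by simp [angular]

theorem angular_X (i j l : Fin N) :
    angular i j (X l) = (if l = i then X j else 0) - (if l = j then X i else 0) := by
  simp only [angular_apply, pderiv_X, Pi.single_apply]
  split_ifs <;> simp

theorem angular_swap (i j : Fin N) (p : MvPolynomial (Fin N) ℝ) :
    angular j i p = -angular i j p := by
  simp [angular_apply]

theorem angular_self (i : Fin N) (p : MvPolynomial (Fin N) ℝ) : angular i i p = 0 := by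
  simp [angular_apply]

/-- The bracket relations of so(N), and the only source of curvature in the proof. A commutator of
derivations is a derivation, so it suffices to compare values on the variables. -/
theorem angular_commutator {i j k : Fin N} (hij : i ≠ j) (hik : i ≠ k) (hkj : k ≠ j)
    (p : MvPolynomial (Fin N) ℝ) :
    angular i k (angular k j p) - angular k j (angular i k p) = -angular i j p := by
  have h : ⁅angular i k, angular k j⁆ = -angular i j := by
    refine MvPolynomial.derivation_ext fun l => ?_
    rw [Derivation.commutator_apply, Derivation.neg_apply, angular_X, angular_X, angular_X,
      map_sub, map_sub]
    by_cases h1 : l = i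
    · subst h1
      simp [hij, hik, angular_X, hkj]
    by_cases h2 : l = j
    · subst h2
      simp [hij.symm, hkj.symm, angular_X, hik.symm]
    by_cases h3 : l = k
    · subst h3
      simp [hkj, h1, angular_X, hij, hij.symm, hik, hkj.symm]
    · simp [h1, h2, h3]
  rw [← Derivation.commutator_apply, h, Derivation.neg_apply]

/-- The Laplace-Beltrami operator of Kac's sphere on polynomials. -/
def lap : MvPolynomial (Fin N) ℝ →ₗ[ℝ] MvPolynomial (Fin N) ℝ :=
  (1 / (2 * N : ℝ)) • ∑ a, ∑ b, (angular a b).toLinearMap ∘ₗ (angular a b).toLinearMap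

theorem lap_apply (p : MvPolynomial (Fin N) ℝ) :
    lap p = (1 / (2 * N : ℝ)) • ∑ a, ∑ b, angular a b (angular a b p) := by
  simp [lap, LinearMap.sum_apply]

theorem ev_lap (p : MvPolynomial (Fin N) ℝ) (V : KacSphere N) :
    ev (lap p) V = 1 / (2 * N : ℝ) * ∑ a, ∑ b, ev (angular a b (angular a b p)) V := by
  simp [lap_apply]

/-- Substitution of the plane rotation into a polynomial. -/
def subst (i j : Fin N) (θ : ℝ) : MvPolynomial (Fin N) ℝ →ₐ[ℝ] MvPolynomial (Fin N) ℝ :=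
  MvPolynomial.aeval fun l =>
    if l = i then C (Real.cos θ) * X i + C (Real.sin θ) * X j
    else if l = j then -(C (Real.sin θ) * X i) + C (Real.cos θ) * X j
    else X l

theorem ev_subst (i j : Fin N) (hij : i ≠ j) (θ : ℝ) (p : MvPolynomial (Fin N) ℝ)
    (V : KacSphere N) : ev (subst i j θ p) V = ev p (rot i j hij θ V) := by
  induction p using MvPolynomial.induction_on with
  | C r => simp [subst]
  | add p q hp hq => simp [hp, hq]
  | mul_X p l hp =>
    rw [map_mul, ev_mul, hp, ev_mul, ev_X]
    congr 1
    simp only [subst, aeval_X, rot, collide]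
    split_ifs <;> simp [mul_comm]

/-- The arbitrary linear form carries the induction: a factor `q` is absorbed by replacing `ℓ` with
`r ↦ ℓ (r * q)`. It also allows differentiation after applying `lap` and evaluating, as in
`ev_lap_angular`. -/
theorem hasDerivAt_linear_subst (i j : Fin N) (hij : i ≠ j) (p : MvPolynomial (Fin N) ℝ) (θ : ℝ)
    (ℓ : MvPolynomial (Fin N) ℝ →ₗ[ℝ] ℝ) :
    HasDerivAt (fun s => ℓ (subst i j s p)) (ℓ (subst i j θ (angular i j p))) θ := by
  induction p using MvPolynomial.induction_on generalizing ℓ with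
  | C r =>
    simpa [subst, angular_apply] using hasDerivAt_const θ _
  | add p q hp hq =>
    simp only [map_add]
    exact (hp ℓ).add (hq ℓ)
  | mul_X p l hp =>
    have hmul : ∀ q : MvPolynomial (Fin N) ℝ,
        HasDerivAt (fun s => ℓ (subst i j s p * q)) (ℓ (subst i j θ (angular i j p) * q)) θ :=
      fun q => hp (ℓ ∘ₗ LinearMap.mulRight ℝ q)
    have e1 : ∀ s, subst i j s (X i) = Real.cos s • X i + Real.sin s • X j := fun s => by
      simp [subst, MvPolynomial.smul_eq_C_mul]
    have e2 : ∀ s, subst i j s (X j) = -(Real.sin s • X i) + Real.cos s • X j := fun s => by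
      simp [subst, MvPolynomial.smul_eq_C_mul, hij.symm]
    simp only [map_mul, Derivation.leibniz, map_add, smul_eq_mul, angular_X]
    rcases eq_or_ne l i with rfl | hi
    · simp only [e1, e2, mul_add, mul_smul_comm, map_add, map_smul, smul_eq_mul, if_true,
        if_neg hij, sub_zero, mul_neg, map_neg]
      refine (((Real.hasDerivAt_cos θ).mul (hmul _)).add
        ((Real.hasDerivAt_sin θ).mul (hmul _))).congr_deriv ?_
      simp only [add_mul, smul_mul_assoc, mul_comm (X _) (subst l j θ _), map_add, map_smul, smul_eq_mul]
      ring
    rcases eq_or_ne l j with rfl | hj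
    · simp only [e1, e2, mul_add, mul_smul_comm, map_add, map_smul, smul_eq_mul, if_true,
        if_neg hij.symm, zero_sub, mul_neg, map_neg]
      refine (((Real.hasDerivAt_sin θ).mul (hmul _)).neg.add
        ((Real.hasDerivAt_cos θ).mul (hmul _))).congr_deriv ?_
      simp only [add_mul, neg_mul, smul_mul_assoc, mul_comm (X _) (subst i l θ _), map_add, map_smul, smul_eq_mul, map_neg]
      ring
    · have e3 : ∀ s, subst i j s (X l) = X l := fun s => by simp [subst, hi, hj]
      simp only [e3, hi, hj, if_false, sub_zero, mul_zero, zero_add, map_zero]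
      rw [mul_comm]
      exact hmul (X l)

theorem hasDerivAt_ev_rot (i j : Fin N) (hij : i ≠ j) (p : MvPolynomial (Fin N) ℝ)
    (V : KacSphere N) (θ : ℝ) :
    HasDerivAt (fun s => ev p (rot i j hij s V)) (ev (angular i j p) (rot i j hij θ V)) θ := by
  have := hasDerivAt_linear_subst i j hij p θ (evLin V)
  simpa only [evLin_apply, ev_subst i j hij] using this

/-- The matrix of the plane rotation. -/
def rotMatrix (i j : Fin N) (θ : ℝ) : Matrix (Fin N) (Fin N) ℝ := fun l a =>
  if l = i then (if a = i then Real.cos θ else 0) + (if a = j then Real.sin θ else 0)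
  else if l = j then -(if a = i then Real.sin θ else 0) + (if a = j then Real.cos θ else 0)
  else if a = l then 1 else 0

theorem rotMatrix_mul_transpose {i j : Fin N} (hij : i ≠ j) (θ : ℝ) :
    rotMatrix i j θ * (rotMatrix i j θ).transpose = 1 := by
  have hsc := Real.sin_sq_add_cos_sq θ
  ext l m
  rw [Matrix.mul_apply]
  simp only [Matrix.transpose_apply, rotMatrix, Matrix.one_apply]
  rcases eq_or_ne l i with rfl | hli
  · rcases eq_or_ne m l with rfl | hml
    · simp [mul_add, add_mul, Finset.sum_add_distrib, hij, hij.symm]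
      linarith
    rcases eq_or_ne m j with rfl | hmj
    · simp [mul_add, add_mul, Finset.sum_add_distrib, hij, hij.symm]
      ring
    · simp [hml, hml.symm, hmj]
  rcases eq_or_ne l j with rfl | hlj
  · rcases eq_or_ne m l with rfl | hml
    · simp [mul_add, add_mul, Finset.sum_add_distrib, hij, hij.symm]
      linarith
    rcases eq_or_ne m i with rfl | hmi
    · simp [mul_add, add_mul, Finset.sum_add_distrib, hij, hij.symm]
      ring
    · simp [hij.symm, hml, hml.symm, hmi]
  · rcases eq_or_ne m i with rfl | hmi
    · simp [hli, hlj]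
    rcases eq_or_ne m j with rfl | hmj
    · simp [hli, hlj, hij.symm]
    · simp [hli, hlj, hmi, hmj, eq_comm]

theorem sum_rotMatrix_row {i j : Fin N} (hij : i ≠ j) (θ : ℝ) (c d : Fin N) :
    ∑ a, rotMatrix i j θ c a * rotMatrix i j θ d a = if c = d then 1 else 0 := by
  simpa [Matrix.mul_apply, Matrix.one_apply] using
    congrFun (congrFun (rotMatrix_mul_transpose hij θ) c) d

theorem sum_rotMatrix_col {i j : Fin N} (hij : i ≠ j) (θ : ℝ) (a b : Fin N) :
    ∑ c, rotMatrix i j θ c a * rotMatrix i j θ c b = if a = b then 1 else 0 := by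
  have h : (rotMatrix i j θ).transpose * rotMatrix i j θ = 1 :=
    mul_eq_one_comm.1 (rotMatrix_mul_transpose hij θ)
  simpa [Matrix.mul_apply, Matrix.one_apply] using congrFun (congrFun h a) b

theorem subst_X (i j : Fin N) (θ : ℝ) (l : Fin N) :
    subst i j θ (X l) = ∑ a, rotMatrix i j θ l a • (X a : MvPolynomial (Fin N) ℝ) := by
  simp only [subst, aeval_X, rotMatrix]
  split_ifs
  · simp [add_smul, Finset.sum_add_distrib, MvPolynomial.smul_eq_C_mul, ite_smul]
  · simp [add_smul, Finset.sum_add_distrib, MvPolynomial.smul_eq_C_mul, ite_smul]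
  · simp [ite_smul]

/-- The adjoint action of the rotation on so(N): conjugated generators are combinations of
generators, with products of matrix entries as coefficients. -/
theorem angular_subst {i j : Fin N} (hij : i ≠ j) (θ : ℝ) (a b : Fin N)
    (p : MvPolynomial (Fin N) ℝ) :
    angular a b (subst i j θ p) = ∑ c, ∑ d,
      (rotMatrix i j θ c a * rotMatrix i j θ d b) • subst i j θ (angular c d p) := by
  have hX : ∀ b, ∑ d, rotMatrix i j θ d b • subst i j θ (X d) = (X b : MvPolynomial (Fin N) ℝ) := by
    intro b
    simp only [subst_X, Finset.smul_sum, smul_smul]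
    rw [Finset.sum_comm]
    simp only [← Finset.sum_smul, sum_rotMatrix_col hij]
    simp [ite_smul]
  induction p using MvPolynomial.induction_on with
  | C r => simp [subst]
  | add p q hp hq => simp [hp, hq, smul_add, Finset.sum_add_distrib]
  | mul_X p l hp =>
    have h1 : angular a b (subst i j θ (X l)) = ∑ c, ∑ d,
        (rotMatrix i j θ c a * rotMatrix i j θ d b) • subst i j θ (angular c d (X l)) := by
      have e1 : angular a b (subst i j θ (X l)) =
          rotMatrix i j θ l a • X b - rotMatrix i j θ l b • X a := by
        rw [subst_X, map_sum]
        simp only [Derivation.map_smul, angular_X, smul_sub, Finset.sum_sub_distrib, smul_ite,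
          smul_zero, Finset.sum_ite_eq', Finset.mem_univ, if_true]
      have e2 : ∀ c d, subst i j θ (angular c d (X l)) =
          (if l = c then subst i j θ (X d) else 0) - (if l = d then subst i j θ (X c) else 0) := by
        intro c d
        rw [angular_X, map_sub]
        split_ifs <;> simp
      simp only [e1, e2, smul_sub, Finset.sum_sub_distrib, smul_ite, smul_zero]
      congr 1
      · rw [Finset.sum_comm]
        simp only [Finset.sum_ite_eq, Finset.mem_univ, if_true, mul_smul, ← Finset.smul_sum, hX]
      · simp only [Finset.sum_ite_eq, Finset.mem_univ, if_true, mul_smul, smul_comm _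
          (rotMatrix i j θ l b), ← Finset.smul_sum, hX]
    rw [map_mul, Derivation.leibniz, hp, h1]
    simp only [Derivation.leibniz, map_add, smul_eq_mul, map_mul, smul_add, Finset.sum_add_distrib,
      Finset.mul_sum, mul_smul_comm]

/-- Invariance of the Casimir element: applying `angular_subst` twice leaves sums of products of
entries of two rows of the matrix, which collapse by orthogonality. Thus a rotated solution of the
heat equation is again a solution. -/
theorem lap_subst {i j : Fin N} (hij : i ≠ j) (θ : ℝ) (p : MvPolynomial (Fin N) ℝ) :
    lap (subst i j θ p) = subst i j θ (lap p) := by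
  rw [lap_apply, lap_apply, map_smul]
  congr 1
  set R := rotMatrix i j θ with hR
  have h1 : ∀ a b, angular a b (angular a b (subst i j θ p)) = ∑ c, ∑ d, ∑ e, ∑ f,
      ((R c a * R e a) * (R d b * R f b)) • subst i j θ (angular e f (angular c d p)) := by
    intro a b
    rw [angular_subst hij]
    simp only [map_sum, Derivation.map_smul, angular_subst hij, Finset.smul_sum, smul_smul, ← hR]
    refine Finset.sum_congr rfl fun c _ => Finset.sum_congr rfl fun d _ =>
      Finset.sum_congr rfl fun e _ => Finset.sum_congr rfl fun f _ => ?_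
    congr 1
    ring
  calc ∑ a, ∑ b, angular a b (angular a b (subst i j θ p))
      = ∑ c, ∑ d, ∑ e, ∑ f, ∑ a, ∑ b,
        ((R c a * R e a) * (R d b * R f b)) • subst i j θ (angular e f (angular c d p)) := by
        simp only [h1]
        have hb : ∀ a, ∑ b, ∑ c, ∑ d, ∑ e, ∑ f,
            ((R c a * R e a) * (R d b * R f b)) • subst i j θ (angular e f (angular c d p)) =
            ∑ c, ∑ d, ∑ e, ∑ f, ∑ b,
            ((R c a * R e a) * (R d b * R f b)) • subst i j θ (angular e f (angular c d p)) := by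
          intro a
          rw [Finset.sum_comm]
          refine Finset.sum_congr rfl fun c _ => ?_
          rw [Finset.sum_comm]
          refine Finset.sum_congr rfl fun d _ => ?_
          rw [Finset.sum_comm]
          refine Finset.sum_congr rfl fun e _ => ?_
          rw [Finset.sum_comm]
        simp only [hb]
        rw [Finset.sum_comm]
        refine Finset.sum_congr rfl fun c _ => ?_
        rw [Finset.sum_comm]
        refine Finset.sum_congr rfl fun d _ => ?_
        rw [Finset.sum_comm]
        refine Finset.sum_congr rfl fun e _ => ?_
        rw [Finset.sum_comm]
    _ = ∑ c, ∑ d, ∑ e, ∑ f,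
        ((if c = e then 1 else 0) * (if d = f then (1 : ℝ) else 0)) •
          subst i j θ (angular e f (angular c d p)) := by
        refine Finset.sum_congr rfl fun c _ => Finset.sum_congr rfl fun d _ =>
          Finset.sum_congr rfl fun e _ => Finset.sum_congr rfl fun f _ => ?_
        rw [← sum_rotMatrix_row hij θ c e, ← sum_rotMatrix_row hij θ d f, Finset.sum_mul_sum,
          Finset.sum_smul]
        simp only [Finset.sum_smul, hR]
    _ = subst i j θ (∑ a, ∑ b, angular a b (angular a b p)) := by
        simp [ite_smul, map_sum]

/-- Rotations in one plane commute, so both sides are the derivative of the same function of the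
angle. -/
theorem ev_angular_subst {i j : Fin N} (hij : i ≠ j) (θ : ℝ) (p : MvPolynomial (Fin N) ℝ)
    (V : KacSphere N) :
    ev (angular i j (subst i j θ p)) V = ev (angular i j p) (rot i j hij θ V) := by
  have h1 := hasDerivAt_ev_rot i j hij (subst i j θ p) V 0
  have h2 := hasDerivAt_ev_rot i j hij p V (θ + 0)
  simp only [ev_subst i j hij, rot_zero, rot_add] at h1
  rw [add_zero] at h2
  have h3 := HasDerivAt.scomp_of_eq (0 : ℝ) h2 ((hasDerivAt_id (0 : ℝ)).const_add θ) (by simp)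
  rw [one_smul] at h3
  exact h1.unique h3

/-- The infinitesimal form of `lap_subst`, obtained by differentiating it at angle zero. -/
theorem ev_lap_angular {i j : Fin N} (p : MvPolynomial (Fin N) ℝ) (V : KacSphere N) :
    ev (lap (angular i j p)) V = ev (angular i j (lap p)) V := by
  rcases eq_or_ne i j with rfl | hij
  · simp [angular_self]
  have h1 := hasDerivAt_linear_subst i j hij p 0 (evLin V ∘ₗ lap)
  have h2 := hasDerivAt_ev_rot i j hij (lap p) V 0
  simp only [LinearMap.comp_apply, evLin_apply, lap_subst hij, ev_subst i j hij] at h1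
  have h3 := h1.unique h2
  simpa only [rot_zero] using h3

/-! ### Differentiation under the integral and integration by parts -/

theorem hasDerivAt_integral_of_continuousOn {α : Type*} [TopologicalSpace α] [MeasurableSpace α]
    [OpensMeasurableSpace α] [SecondCountableTopology α] {μ : Measure α} [IsFiniteMeasure μ]
    {K : Set α} (hK : IsCompact K) (hμ : ∀ᵐ x ∂μ, x ∈ K) {U : Set ℝ} (hU : IsOpen U)
    {f f' : ℝ → α → ℝ} (hf : ∀ t ∈ U, Continuous (f t))
    (hf' : ContinuousOn (fun q : ℝ × α => f' q.1 q.2) (U ×ˢ univ))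
    (h : ∀ t ∈ U, ∀ x, HasDerivAt (fun s => f s x) (f' t x) t) {t : ℝ} (ht : t ∈ U) :
    HasDerivAt (fun s => ∫ x, f s x ∂μ) (∫ x, f' t x ∂μ) t := by
  -- The bound of `f'` on a closed ball of times times `K` is the dominating constant. The set `U`
  -- will be the times of positivity, where logarithms are smooth; `K` is needed because the angle
  -- ranges over the noncompact line.
  obtain ⟨ε, hε, hsub⟩ := Metric.nhds_basis_closedBall.mem_iff.1 (hU.mem_nhds ht)
  obtain ⟨C, hC⟩ := ((isCompact_closedBall t ε).prod hK).exists_bound_of_continuousOn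
    (hf'.mono (prod_mono hsub (subset_univ K)))
  obtain ⟨D, hD⟩ := hK.exists_bound_of_continuousOn (hf t ht).continuousOn
  have hf't : Continuous (f' t) := continuousOn_univ.1
    (hf'.comp (Continuous.prodMk_right t).continuousOn fun x _ => ⟨ht, mem_univ x⟩)
  exact (hasDerivAt_integral_of_dominated_loc_of_deriv_le (bound := fun _ => C)
    (s := Metric.closedBall t ε) (Metric.closedBall_mem_nhds t hε)
    (by filter_upwards [hU.mem_nhds ht] with s hs using (hf s hs).aestronglyMeasurable)
    (Integrable.of_bound (hf t ht).aestronglyMeasurable D (hμ.mono fun x hx => hD x hx))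
    hf't.aestronglyMeasurable
    (hμ.mono fun x hx s hs => hC (s, x) ⟨hs, hx⟩) (integrable_const C)
    (Eventually.of_forall fun x s hs => h s (hsub hs) x)).2

theorem hasDerivAt_integral_sphere {U : Set ℝ} (hU : IsOpen U) {f f' : ℝ → KacSphere N → ℝ}
    (hf : ∀ t ∈ U, Continuous (f t))
    (hf' : ContinuousOn (fun q : ℝ × KacSphere N => f' q.1 q.2) (U ×ˢ univ))
    (h : ∀ t ∈ U, ∀ x, HasDerivAt (fun s => f s x) (f' t x) t) {t : ℝ} (ht : t ∈ U) :
    HasDerivAt (fun s => ∫ x, f s x ∂(kacMeasure N)) (∫ x, f' t x ∂(kacMeasure N)) t :=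
  hasDerivAt_integral_of_continuousOn isCompact_univ (by simp) hU hf hf' h ht

/-- `f'` is the derivative of `f` along the rotations in the plane of `i` and `j`. -/
def RotDeriv (i j : Fin N) (hij : i ≠ j) (f f' : KacSphere N → ℝ) : Prop :=
  ∀ V, HasDerivAt (fun s => f (rot i j hij s V)) (f' V) 0

/-- The group law of the rotations transports the derivative from angle zero to any angle. -/
theorem RotDeriv.hasDerivAt {i j : Fin N} {hij : i ≠ j} {f f' : KacSphere N → ℝ}
    (h : RotDeriv i j hij f f') (V : KacSphere N) (θ : ℝ) :
    HasDerivAt (fun s => f (rot i j hij s V)) (f' (rot i j hij θ V)) θ := by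
  have h1 := HasDerivAt.scomp_of_eq θ (h (rot i j hij θ V))
    ((hasDerivAt_id θ).sub_const θ) (by simp)
  rw [one_smul] at h1
  refine h1.congr_of_eventuallyEq (Eventually.of_forall fun s => ?_)
  simp [rot_add]

theorem rotDeriv_ev (i j : Fin N) (hij : i ≠ j) (p : MvPolynomial (Fin N) ℝ) :
    RotDeriv i j hij (ev p) (ev (angular i j p)) := fun V => by
  simpa only [rot_zero] using hasDerivAt_ev_rot i j hij p V 0

theorem RotDeriv.mul {i j : Fin N} {hij : i ≠ j} {f f' g g' : KacSphere N → ℝ}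
    (hf : RotDeriv i j hij f f') (hg : RotDeriv i j hij g g') :
    RotDeriv i j hij (fun V => f V * g V) (fun V => f' V * g V + f V * g' V) := fun V => by
  simpa only [rot_zero] using (hf V).fun_mul (hg V)

theorem RotDeriv.add {i j : Fin N} {hij : i ≠ j} {f f' g g' : KacSphere N → ℝ}
    (hf : RotDeriv i j hij f f') (hg : RotDeriv i j hij g g') :
    RotDeriv i j hij (fun V => f V + g V) (fun V => f' V + g' V) := fun V => by
  simpa only [rot_zero] using (hf V).fun_add (hg V)

theorem RotDeriv.sub {i j : Fin N} {hij : i ≠ j} {f f' g g' : KacSphere N → ℝ}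
    (hf : RotDeriv i j hij f f') (hg : RotDeriv i j hij g g') :
    RotDeriv i j hij (fun V => f V - g V) (fun V => f' V - g' V) := fun V => by
  simpa only [rot_zero] using (hf V).fun_sub (hg V)

theorem RotDeriv.div {i j : Fin N} {hij : i ≠ j} {f f' g g' : KacSphere N → ℝ}
    (hf : RotDeriv i j hij f f') (hg : RotDeriv i j hij g g') (h0 : ∀ V, g V ≠ 0) :
    RotDeriv i j hij (fun V => f V / g V) (fun V => (f' V * g V - f V * g' V) / g V ^ 2) :=
  fun V => by
    simpa only [rot_zero] using (hf V).fun_div (hg V) (h0 _)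

theorem RotDeriv.log {i j : Fin N} {hij : i ≠ j} {f f' : KacSphere N → ℝ}
    (hf : RotDeriv i j hij f f') (h0 : ∀ V, f V ≠ 0) :
    RotDeriv i j hij (fun V => Real.log (f V)) (fun V => f' V / f V) := fun V => by
  simpa only [rot_zero] using (hf V).log (h0 _)

theorem RotDeriv.congr {i j : Fin N} {hij : i ≠ j} {f f' g' : KacSphere N → ℝ}
    (hf : RotDeriv i j hij f f') (h : ∀ V, f' V = g' V) : RotDeriv i j hij f g' :=
  fun V => h V ▸ hf V

/-- The integral of a rotated function does not depend on the angle; differentiate at zero. Every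
integration by parts below is an instance. -/
theorem RotDeriv.integral_eq_zero {i j : Fin N} {hij : i ≠ j} {f f' : KacSphere N → ℝ}
    (h : RotDeriv i j hij f f') (hf : Continuous f) (hf' : Continuous f') :
    ∫ V, f' V ∂(kacMeasure N) = 0 := by
  have h1 := hasDerivAt_integral_sphere isOpen_univ (f := fun s V => f (rot i j hij s V))
    (f' := fun s V => f' (rot i j hij s V)) (fun s _ => hf.comp (continuous_rot_const i j hij s))
    (hf'.comp (continuous_rot i j hij)).continuousOn (fun s _ V => h.hasDerivAt V s) (mem_univ 0)
  simp only [integral_comp_rot] at h1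
  exact h1.unique (hasDerivAt_const _ _)

/-- Integration by parts, twice, against a polynomial. -/
theorem integral_mul_rotDeriv_rotDeriv {i j : Fin N} {hij : i ≠ j} {f f' f'' : KacSphere N → ℝ}
    (h : RotDeriv i j hij f f') (h' : RotDeriv i j hij f' f'') (hf : Continuous f)
    (hf' : Continuous f') (hf'' : Continuous f'') (w : MvPolynomial (Fin N) ℝ) :
    ∫ V, ev w V * f'' V ∂(kacMeasure N) =
      ∫ V, ev (angular i j (angular i j w)) V * f V ∂(kacMeasure N) := by
  have hw := rotDeriv_ev i j hij w
  have hw' := rotDeriv_ev i j hij (angular i j w)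
  -- The derivative of `w f' - w' f` is `w f'' - w'' f`, which therefore integrates to zero.
  have h1 := ((hw.mul h').sub (hw'.mul h)).integral_eq_zero
    (((continuous_ev _).mul hf').sub ((continuous_ev _).mul hf))
    ((((continuous_ev _).mul hf').add ((continuous_ev _).mul hf'')).sub
      (((continuous_ev _).mul hf).add ((continuous_ev _).mul hf')))
  have i1 : Integrable (fun V => ev w V * f'' V) (kacMeasure N) :=
    integrable_of_continuous ((continuous_ev _).mul hf'')
  have i2 : Integrable (fun V => ev (angular i j (angular i j w)) V * f V) (kacMeasure N) :=
    integrable_of_continuous ((continuous_ev _).mul hf)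
  rw [← sub_eq_zero, ← integral_sub i1 i2, ← h1]
  refine integral_congr_ae (Eventually.of_forall fun V => ?_)
  simp only
  ring

/-! ### Curvature and the tangential gradient -/

/-- The curvature of the rotation group bounds iterated derivatives from below. -/
theorem curvature_le {M : Fin N → Fin N → Fin N → Fin N → ℝ} {g : Fin N → Fin N → ℝ}
    (hg : ∀ i, g i i = 0) (h1 : ∀ a b c d, M b a c d = -M a b c d)
    (h2 : ∀ a b c d, M a b d c = -M a b c d)
    (h : ∀ i j k, i ≠ j → i ≠ k → k ≠ j → M i k k j - M k j i k = -g i j) :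
    ((N : ℝ) - 2) / 4 * ∑ i, ∑ j, g i j ^ 2 ≤ ∑ a, ∑ b, ∑ c, ∑ d, M a b c d ^ 2 := by
  classical
  -- Each of the `N - 2` indices `k` outside `{i, j}` writes `g i j` as a difference of two iterated
  -- derivatives, and `(a - b)² ≤ 2 (a² + b²)`.
  have key : ∀ i j, ((N : ℝ) - 2) / 2 * g i j ^ 2 ≤
      ∑ k, (M i k k j ^ 2 + M j k k i ^ 2) := by
    intro i j
    rcases eq_or_ne i j with rfl | hij
    · rw [hg, zero_pow two_ne_zero, mul_zero]
      exact Finset.sum_nonneg fun k _ => by positivity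
    have hcard : (((Finset.univ.erase i).erase j).card : ℝ) = (N : ℝ) - 2 := by
      rw [Finset.card_erase_of_mem (Finset.mem_erase.2 ⟨hij.symm, Finset.mem_univ j⟩),
        Finset.card_erase_of_mem (Finset.mem_univ i), Finset.card_univ, Fintype.card_fin]
      have hN : 2 ≤ N := by
        have := Fintype.one_lt_card_iff_nontrivial.2 (⟨i, j, hij⟩ : Nontrivial (Fin N))
        rw [Fintype.card_fin] at this
        exact this
      rw [Nat.sub_sub, Nat.cast_sub hN]
      norm_num
    calc ((N : ℝ) - 2) / 2 * g i j ^ 2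
        = ∑ k ∈ (Finset.univ.erase i).erase j, g i j ^ 2 / 2 := by
          rw [Finset.sum_const, nsmul_eq_mul, hcard]
          ring
      _ ≤ ∑ k ∈ (Finset.univ.erase i).erase j, (M i k k j ^ 2 + M j k k i ^ 2) := by
          refine Finset.sum_le_sum fun k hk => ?_
          simp only [Finset.mem_erase, Finset.mem_univ, and_true] at hk
          have e1 := h i j k hij hk.2.symm hk.1
          have e2 : M j k k i = M k j i k := by rw [h1, h2, neg_neg]
          rw [e2]
          have e3 : g i j = M k j i k - M i k k j := by linarith
          rw [e3]
          nlinarith [sq_nonneg (M k j i k + M i k k j)]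
      _ ≤ ∑ k, (M i k k j ^ 2 + M j k k i ^ 2) :=
          Finset.sum_le_sum_of_subset_of_nonneg (Finset.subset_univ _) fun k _ _ => by positivity
  have hsum : ((N : ℝ) - 2) / 2 * ∑ i, ∑ j, g i j ^ 2 ≤ 2 * ∑ i, ∑ k, ∑ j, M i k k j ^ 2 := by
    calc ((N : ℝ) - 2) / 2 * ∑ i, ∑ j, g i j ^ 2
        = ∑ i, ∑ j, ((N : ℝ) - 2) / 2 * g i j ^ 2 := by simp only [Finset.mul_sum]
      _ ≤ ∑ i, ∑ j, ∑ k, (M i k k j ^ 2 + M j k k i ^ 2) :=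
          Finset.sum_le_sum fun i _ => Finset.sum_le_sum fun j _ => key i j
      _ = ∑ i, ∑ j, ∑ k, M i k k j ^ 2 + ∑ i, ∑ j, ∑ k, M j k k i ^ 2 := by
          simp only [Finset.sum_add_distrib]
      _ = 2 * ∑ i, ∑ k, ∑ j, M i k k j ^ 2 := by
          rw [Finset.sum_comm (f := fun i j => ∑ k, M j k k i ^ 2), ← two_mul]
          congr 1
          exact Finset.sum_congr rfl fun i _ => Finset.sum_comm
  -- Only the entries whose two middle indices agree are used.
  have hle : ∑ i, ∑ k, ∑ j, M i k k j ^ 2 ≤ ∑ a, ∑ b, ∑ c, ∑ d, M a b c d ^ 2 := by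
    refine Finset.sum_le_sum fun a _ => Finset.sum_le_sum fun b _ => ?_
    exact Finset.single_le_sum (f := fun c => ∑ d, M a b c d ^ 2)
      (fun c _ => Finset.sum_nonneg fun d _ => sq_nonneg _) (Finset.mem_univ b)
  linarith

/-- The tangential gradient dominates the derivative in each plane of rotation. -/
theorem sq_angular_le {x y : Fin N → ℝ} {r : ℝ} (hr : 0 < r) (hx : ∑ l, x l ^ 2 = r)
    {i j : Fin N} (hij : i ≠ j) :
    (x j * y i - x i * y j) ^ 2 ≤
      (x i ^ 2 + x j ^ 2) * (1 / (2 * r) * ∑ a, ∑ b, (x b * y a - x a * y b) ^ 2) := by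
  set s := ∑ l, x l * y l with hs
  -- Removing the radial part of `y` changes none of the terms `x b * y a - x a * y b`. For the
  -- tangential part `z`, Lagrange's identity makes the sum of their squares equal to `2 r |z|²`.
  set z : Fin N → ℝ := fun l => y l - s / r * x l with hz
  have hxz : ∑ l, x l * z l = 0 := by
    simp only [hz, mul_sub, Finset.sum_sub_distrib]
    have : ∑ l, x l * (s / r * x l) = s / r * ∑ l, x l ^ 2 := by
      rw [Finset.mul_sum]
      exact Finset.sum_congr rfl fun l _ => by ring
    rw [this, hx, ← hs]
    field_simp
    ring
  have hw : ∀ a b, x b * y a - x a * y b = x b * z a - x a * z b := fun a b => by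
    simp only [hz]
    ring
  have hsum : ∑ a, ∑ b, (x b * y a - x a * y b) ^ 2 = 2 * r * ∑ l, z l ^ 2 := by
    calc ∑ a, ∑ b, (x b * y a - x a * y b) ^ 2
        = ∑ a, ∑ b, (z a ^ 2 * x b ^ 2 + x a ^ 2 * z b ^ 2 -
            2 * ((x a * z a) * (x b * z b))) := by
          refine Finset.sum_congr rfl fun a _ => Finset.sum_congr rfl fun b _ => ?_
          rw [hw]
          ring
      _ = (∑ a, z a ^ 2) * ∑ b, x b ^ 2 + (∑ a, x a ^ 2) * ∑ b, z b ^ 2 -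
            2 * ((∑ a, x a * z a) * ∑ b, x b * z b) := by
          simp only [Finset.sum_add_distrib, Finset.sum_sub_distrib, ← Finset.mul_sum,
            Finset.sum_mul_sum]
      _ = 2 * r * ∑ l, z l ^ 2 := by
          rw [hx, hxz]
          ring
  have hzz : z i ^ 2 + z j ^ 2 ≤ ∑ l, z l ^ 2 := by
    rw [← Finset.add_sum_erase _ _ (Finset.mem_univ i),
      ← Finset.add_sum_erase _ _ (Finset.mem_erase.2 ⟨hij.symm, Finset.mem_univ j⟩), ← add_assoc]
    exact le_add_of_nonneg_right (Finset.sum_nonneg fun l _ => sq_nonneg _)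
  rw [hsum, hw, show 1 / (2 * r) * (2 * r * ∑ l, z l ^ 2) = ∑ l, z l ^ 2 by field_simp]
  calc (x j * z i - x i * z j) ^ 2 ≤ (x i ^ 2 + x j ^ 2) * (z i ^ 2 + z j ^ 2) := by
        nlinarith [sq_nonneg (x i * z i + x j * z j)]
    _ ≤ _ := mul_le_mul_of_nonneg_left hzz (by positivity)

/-! ### The heat flow on polynomials and the minimum principle -/

theorem totalDegree_X_mul_pderiv_le (i j : Fin N) (p : MvPolynomial (Fin N) ℝ) {m : ℕ}
    (hp : p.totalDegree ≤ m) : (X j * pderiv i p).totalDegree ≤ m := by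
  rw [p.as_sum, map_sum, Finset.mul_sum]
  refine (totalDegree_finsetSum_le fun s hs => ?_)
  rw [pderiv_monomial]
  rcases eq_or_ne (s i) 0 with h0 | h0
  · simp [h0]
  refine (totalDegree_mul _ _).trans ?_
  rw [totalDegree_X]
  have h1 := totalDegree_monomial_le (s - Finsupp.single i 1) (coeff s p * (s i : ℝ))
  have h2 := (le_totalDegree hs).trans hp
  have h3 : (s - Finsupp.single i 1) + Finsupp.single i 1 = s :=
    tsub_add_cancel_of_le (Finsupp.single_le_iff.2 (Nat.one_le_iff_ne_zero.2 h0))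
  have h4 : (s - Finsupp.single i 1).degree + 1 = s.degree := by
    conv_rhs => rw [← h3]
    rw [map_add, Finsupp.degree_single]
  change _ ≤ (s - Finsupp.single i 1).degree at h1
  change s.degree ≤ m at h2
  omega

/-- Multiplying by a variable restores the degree lost in differentiating. Hence `lap` acts on a
finite dimensional space and the heat equation becomes a linear ODE. -/
theorem angular_mem_restrictTotalDegree (i j : Fin N) {m : ℕ} {p : MvPolynomial (Fin N) ℝ}
    (hp : p ∈ restrictTotalDegree (Fin N) ℝ m) :
    angular i j p ∈ restrictTotalDegree (Fin N) ℝ m := by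
  rw [angular_apply]
  rw [mem_restrictTotalDegree] at hp
  exact Submodule.sub_mem _ ((mem_restrictTotalDegree _ _ _).2 (totalDegree_X_mul_pderiv_le i j p hp))
    ((mem_restrictTotalDegree _ _ _).2 (totalDegree_X_mul_pderiv_le j i p hp))

theorem lap_mem_restrictTotalDegree {m : ℕ} {p : MvPolynomial (Fin N) ℝ}
    (hp : p ∈ restrictTotalDegree (Fin N) ℝ m) :
    lap p ∈ restrictTotalDegree (Fin N) ℝ m := by
  rw [lap_apply]
  exact Submodule.smul_mem _ _ (Submodule.sum_mem _ fun a _ => Submodule.sum_mem _ fun b _ =>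
    angular_mem_restrictTotalDegree a b (angular_mem_restrictTotalDegree a b hp))

/-- A solution of the heat equation on Kac's sphere with values in a finite dimensional space of
polynomials. -/
def IsHeatFlow (c : ℝ → MvPolynomial (Fin N) ℝ) : Prop :=
  ∃ (n : ℕ) (b : Fin n → MvPolynomial (Fin N) ℝ) (a a' : Fin n → ℝ → ℝ),
    (∀ i t, HasDerivAt (a i) (a' i t) t) ∧ (∀ t, c t = ∑ i, a i t • b i) ∧
      ∀ t, lap (c t) = ∑ i, a' i t • b i

theorem exists_isHeatFlow (p : MvPolynomial (Fin N) ℝ) :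
    ∃ c : ℝ → MvPolynomial (Fin N) ℝ, IsHeatFlow c ∧ c 0 = p := by
  set E := restrictTotalDegree (Fin N) ℝ p.totalDegree with hE
  have hp : p ∈ E := (mem_restrictTotalDegree _ _ _).2 le_rfl
  set A : E →ₗ[ℝ] E := lap.restrict fun q hq => lap_mem_restrictTotalDegree hq with hA
  set b := Module.finBasis ℝ E with hb
  set T : (Fin (Module.finrank ℝ E) → ℝ) →L[ℝ] (Fin (Module.finrank ℝ E) → ℝ) :=
    LinearMap.toContinuousLinearMap (b.equivFun.toLinearMap ∘ₗ A ∘ₗ b.equivFun.symm.toLinearMap)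
    with hT
  -- In coordinates the flow is the exponential of the matrix of `lap` on polynomials of degree at
  -- most that of `p`.
  set a : ℝ → Fin (Module.finrank ℝ E) → ℝ :=
    fun t => NormedSpace.exp (t • T) (b.equivFun ⟨p, hp⟩) with ha
  have hda : ∀ t, HasDerivAt a (T (a t)) t := fun t => by
    have := (hasDerivAt_exp_smul_const' (𝕂 := ℝ) T t).clm_apply
      (hasDerivAt_const t (b.equivFun ⟨p, hp⟩))
    rw [map_zero, add_zero] at this
    exact this
  refine ⟨fun t => (b.equivFun.symm (a t) : E), ⟨_, fun i => b i, fun i t => a t i,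
    fun i t => T (a t) i, fun i t => hasDerivAt_pi.1 (hda t) i, fun t => ?_, fun t => ?_⟩, ?_⟩
  · simp [Module.Basis.equivFun_symm_apply]
  · have h1 : (lap (b.equivFun.symm (a t) : E).1) = (A (b.equivFun.symm (a t))).1 := rfl
    have h2 : A (b.equivFun.symm (a t)) = b.equivFun.symm (T (a t)) := by simp [hT]
    rw [h1, h2]
    simp [Module.Basis.equivFun_symm_apply]
  · simp [ha]

theorem IsHeatFlow.hasDerivAt {c : ℝ → MvPolynomial (Fin N) ℝ} (hc : IsHeatFlow c)
    (ℓ : MvPolynomial (Fin N) ℝ →ₗ[ℝ] ℝ) (t : ℝ) :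
    HasDerivAt (fun s => ℓ (c s)) (ℓ (lap (c t))) t := by
  obtain ⟨n, b, a, a', ha, h1, h2⟩ := hc
  rw [h2 t]
  simp only [h1, map_sum, map_smul, smul_eq_mul]
  exact HasDerivAt.fun_sum fun i _ => (ha i t).mul_const _

theorem IsHeatFlow.hasDerivAt_ev {c : ℝ → MvPolynomial (Fin N) ℝ} (hc : IsHeatFlow c)
    (T : MvPolynomial (Fin N) ℝ →ₗ[ℝ] MvPolynomial (Fin N) ℝ) (V : KacSphere N) (t : ℝ) :
    HasDerivAt (fun s => ev (T (c s)) V) (ev (T (lap (c t))) V) t := by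
  simpa only [LinearMap.comp_apply, evLin_apply] using hc.hasDerivAt (evLin V ∘ₗ T) t

theorem IsHeatFlow.continuous_ev {c : ℝ → MvPolynomial (Fin N) ℝ} (hc : IsHeatFlow c)
    (T : MvPolynomial (Fin N) ℝ →ₗ[ℝ] MvPolynomial (Fin N) ℝ) :
    Continuous fun q : ℝ × KacSphere N => ev (T (c q.1)) q.2 := by
  obtain ⟨n, b, a, a', ha, h1, -⟩ := hc
  simp only [h1, map_sum, map_smul, ev_sum, ev_smul]
  refine continuous_finsetSum _ fun i _ => Continuous.mul ?_ ?_
  · exact (continuous_iff_continuousAt.2 fun t => (ha i t).continuousAt).comp continuous_fst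
  · exact (KacModel.continuous_ev _).comp continuous_snd

/-- Otherwise `f'`, which vanishes at `x`, would be negative just to the right, and the mean value
theorem would give a smaller value of `f`. -/
theorem nonneg_of_deriv_deriv_isMin {f f' : ℝ → ℝ} {f'' x : ℝ} (h : ∀ s, HasDerivAt f (f' s) s)
    (h' : HasDerivAt f' f'' x) (hmin : ∀ s, f x ≤ f s) : 0 ≤ f'' := by
  by_contra! hneg
  have hf : deriv f = f' := funext fun s => (h s).deriv
  have h0 : deriv f x = 0 := IsLocalMin.deriv_eq_zero (Eventually.of_forall hmin)
  have h1 : ∀ᶠ s in 𝓝[>] x, f' s < 0 := by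
    have h2 := (hasDerivAt_iff_tendsto_slope.1 h').eventually (gt_mem_nhds hneg)
    have h3 : 𝓝[>] x ≤ 𝓝[≠] x := nhdsWithin_mono _ fun y hy => ne_of_gt hy
    filter_upwards [h3 h2, self_mem_nhdsWithin] with s hs hxs
    rw [hf] at h0
    rw [slope_def_field, h0, sub_zero] at hs
    have : 0 < s - x := sub_pos.2 hxs
    exact (div_neg_iff.1 hs).resolve_left (fun h => absurd h.2 (by linarith)) |>.1
  obtain ⟨y, hxy, hy⟩ := mem_nhdsGT_iff_exists_Ioo_subset.1 h1
  have hxy : x < y := hxy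
  set z := (x + y) / 2 with hz
  obtain ⟨u, hu, hu'⟩ := exists_hasDerivAt_eq_slope f f' (show x < z by simp only [hz]; linarith)
    (fun s _ => (h s).continuousAt.continuousWithinAt) fun s _ => h s
  have h4 : f' u < 0 := hy ⟨hu.1, hu.2.trans (by simp only [hz]; linarith)⟩
  rw [hu'] at h4
  have : 0 < z - x := by simp only [hz]; linarith
  have h5 := (div_neg_iff.1 h4).resolve_left (fun h => absurd h.2 (by linarith)) |>.1
  linarith [hmin z]

/-- The parabolic minimum principle on Kac's sphere. -/
theorem le_of_lap_le_deriv {Q : ℝ → MvPolynomial (Fin N) ℝ} {d : ℝ → KacSphere N → ℝ} {m : ℝ}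
    (hQ : Continuous fun q : ℝ × KacSphere N => ev (Q q.1) q.2)
    (hd : ∀ t V, HasDerivAt (fun s => ev (Q s) V) (d t V) t)
    (hle : ∀ t V, ev (lap (Q t)) V ≤ d t V) (h0 : ∀ V, m ≤ ev (Q 0) V) {t : ℝ} (ht : 0 ≤ t)
    (V : KacSphere N) : m ≤ ev (Q t) V := by
  refine le_of_forall_pos_le_add fun ε hε => ?_
  -- The term `δ t` makes the inequality strict. At a minimum of `Q + δ t` at a positive time the
  -- Laplacian is nonnegative while the time derivative `d + δ` is nonpositive, contradicting `lap Q
  -- ≤ d`. So the minimum is at time zero, and the correction costs at most `ε`.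
  set δ := ε / (t + 1) with hδ
  have hδpos : 0 < δ := by positivity
  have hcont : Continuous fun q : ℝ × KacSphere N => ev (Q q.1) q.2 + δ * q.1 :=
    hQ.add (continuous_const.mul continuous_fst)
  have hK : IsCompact (Icc (0 : ℝ) t ×ˢ (univ : Set (KacSphere N))) :=
    isCompact_Icc.prod isCompact_univ
  obtain ⟨q, hq, hmin⟩ := hK.exists_isMinOn
    ⟨(0, V), mk_mem_prod (left_mem_Icc.2 ht) (mem_univ _)⟩ hcont.continuousOn
  obtain ⟨t₁, V₁⟩ := q
  have h1 : t₁ ∈ Icc 0 t := hq.1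
  have hmin' : ∀ s W, s ∈ Icc 0 t → ev (Q t₁) V₁ + δ * t₁ ≤ ev (Q s) W + δ * s :=
    fun s W hs => isMinOn_iff.1 hmin (s, W) (mk_mem_prod hs (mem_univ W))
  have hzero : t₁ = 0 := by
    by_contra hne
    have hpos : 0 < t₁ := lt_of_le_of_ne h1.1 (Ne.symm hne)
    have hlap : 0 ≤ ev (lap (Q t₁)) V₁ := by
      rw [ev_lap]
      refine mul_nonneg (by positivity) (Finset.sum_nonneg fun a _ => Finset.sum_nonneg fun b _ => ?_)
      rcases eq_or_ne a b with rfl | hab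
      · simp [angular_self]
      refine nonneg_of_deriv_deriv_isMin (x := 0) (hasDerivAt_ev_rot a b hab (Q t₁) V₁)
        (by simpa only [rot_zero] using hasDerivAt_ev_rot a b hab (angular a b (Q t₁)) V₁ 0)
        fun s => ?_
      have := hmin' t₁ (rot a b hab s V₁) h1
      rw [rot_zero]
      linarith
    have hder : d t₁ V₁ + δ ≤ 0 := by
      have hd1 : HasDerivAt (fun s => ev (Q s) V₁ + δ * s) (d t₁ V₁ + δ) t₁ := by
        simpa using (hd t₁ V₁).fun_add ((hasDerivAt_id t₁).const_mul δ)
      have h3 : 𝓝[<] t₁ ≤ 𝓝[≠] t₁ := nhdsWithin_mono _ fun y hy => ne_of_lt hy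
      refine le_of_tendsto ((hasDerivAt_iff_tendsto_slope.1 hd1).mono_left h3) ?_
      filter_upwards [Ioo_mem_nhdsLT hpos] with s hs
      rw [slope_def_field]
      refine div_nonpos_of_nonneg_of_nonpos ?_ (by linarith [hs.2])
      have := hmin' s V₁ ⟨hs.1.le, hs.2.le.trans h1.2⟩
      linarith
    linarith [hle t₁ V₁]
  have h2 := hmin' t V ⟨ht, le_rfl⟩
  rw [hzero] at h2
  have h3 : δ * t ≤ ε := by
    rw [hδ, div_mul_eq_mul_div, div_le_iff₀ (by linarith)]
    nlinarith
  linarith [h0 V₁]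

theorem IsHeatFlow.le_ev {c : ℝ → MvPolynomial (Fin N) ℝ} (hc : IsHeatFlow c) {m : ℝ}
    (h0 : ∀ V, m ≤ ev (c 0) V) {t : ℝ} (ht : 0 ≤ t) (V : KacSphere N) : m ≤ ev (c t) V :=
  le_of_lap_le_deriv (by simpa using hc.continuous_ev LinearMap.id)
    (fun t V => by simpa using hc.hasDerivAt_ev LinearMap.id V t) (fun t V => le_rfl) h0 ht V

/-! ### Integrations by parts for entropy, Fisher information and production -/

theorem integral_ev_lap_eq {A B : Fin N → Fin N → KacSphere N → ℝ}
    {α : KacSphere N → ℝ} (hA : ∀ a b, Continuous (A a b)) (hB : ∀ a b, Continuous (B a b))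
    (h : ∀ a b, ∫ V, A a b V ∂(kacMeasure N) = ∫ V, B a b V ∂(kacMeasure N))
    (hα : ∀ V, α V = 1 / (2 * N : ℝ) * ∑ a, ∑ b, A a b V) :
    ∫ V, α V ∂(kacMeasure N) =
      ∫ V, 1 / (2 * N : ℝ) * ∑ a, ∑ b, B a b V ∂(kacMeasure N) := by
  simp only [hα]
  rw [integral_const_mul, integral_const_mul]
  congr 1
  rw [integral_finsetSum _ fun a _ => integrable_finsetSum _ fun b _ =>
      integrable_of_continuous (hA a b),
    integral_finsetSum _ fun a _ => integrable_finsetSum _ fun b _ =>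
      integrable_of_continuous (hB a b)]
  refine Finset.sum_congr rfl fun a _ => ?_
  rw [integral_finsetSum _ fun b _ => integrable_of_continuous (hA a b),
    integral_finsetSum _ fun b _ => integrable_of_continuous (hB a b)]
  exact Finset.sum_congr rfl fun b _ => h a b

/-- The left side is the time derivative of the entropy under the heat flow: this is de Bruijn's
identity. -/
theorem integral_lap_mul_log (hN : 0 < N) {p : MvPolynomial (Fin N) ℝ} (hp : ∀ V, 0 < ev p V) :
    ∫ V, ev (lap p) V * (Real.log (ev p V) + 1) ∂(kacMeasure N) =
      -(1 / (2 * N : ℝ) * ∫ V, ∑ a, ∑ b, ev (angular a b p) V ^ 2 / ev p V ∂(kacMeasure N)) := by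
  have hp' : ∀ V, ev p V ≠ 0 := fun V => (hp V).ne'
  have c0 := continuous_ev p
  have cl : Continuous fun V => Real.log (ev p V) := c0.log hp'
  rw [integral_ev_lap_eq
    (A := fun a b V => ev (angular a b (angular a b p)) V * (Real.log (ev p V) + 1))
    (B := fun a b V => -(ev (angular a b p) V ^ 2 / ev p V))
    (fun a b => (continuous_ev _).mul (cl.add continuous_const))
    (fun a b => (((continuous_ev _).pow 2).div c0 hp').neg) (fun a b => ?_) fun V => ?_]
  · rw [integral_const_mul, ← mul_neg, ← integral_neg]
    simp only [Finset.sum_neg_distrib]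
  · rcases eq_or_ne a b with rfl | hab
    · simp [angular_self]
    have h1 := ((rotDeriv_ev a b hab (angular a b p)).mul
      (((rotDeriv_ev a b hab p).log hp').add (rotDeriv_ev a b hab 1))).integral_eq_zero
      ((continuous_ev _).mul (cl.add (continuous_ev _)))
      (((continuous_ev _).mul (cl.add (continuous_ev _))).add
        ((continuous_ev _).mul (((continuous_ev _).div c0 hp').add (continuous_ev _))))
    have i1 : Integrable (fun V => ev (angular a b (angular a b p)) V * (Real.log (ev p V) + 1))
        (kacMeasure N) :=
      integrable_of_continuous ((continuous_ev _).mul (cl.add continuous_const))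
    have i2 : Integrable (fun V => -(ev (angular a b p) V ^ 2 / ev p V)) (kacMeasure N) :=
      integrable_of_continuous (((continuous_ev _).pow 2).div c0 hp').neg
    rw [← sub_eq_zero, ← integral_sub i1 i2, ← h1]
    refine integral_congr_ae (Eventually.of_forall fun V => ?_)
    simp only [ev_one, Derivation.map_one_eq_zero, ev_zero]
    ring
  · rw [ev_lap, mul_assoc]
    simp only [Finset.sum_mul]

/-- The integrand on the left is the time derivative of `q² / p` when `p` and `q` both follow the
heat flow; the square on the right is that of the angular derivative of `q / p`. It is applied with
`q` an angular derivative of `p`, which also solves the heat equation. -/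
theorem integral_fisher_density (hN : 0 < N) {p q : MvPolynomial (Fin N) ℝ} (hp : ∀ V, 0 < ev p V) :
    ∫ V, (2 * ev q V * ev (lap q) V / ev p V - ev q V ^ 2 * ev (lap p) V / ev p V ^ 2)
        ∂(kacMeasure N) =
      -(1 / (N : ℝ) * ∫ V, ∑ a, ∑ b, ev p V * (ev (angular a b q) V / ev p V -
        ev q V * ev (angular a b p) V / ev p V ^ 2) ^ 2 ∂(kacMeasure N)) := by
  have hp' : ∀ V, ev p V ≠ 0 := fun V => (hp V).ne'
  have hp2 : ∀ V, ev p V ^ 2 ≠ 0 := fun V => pow_ne_zero 2 (hp' V)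
  have c0 := continuous_ev p
  have cq := continuous_ev q
  have cA : ∀ r s : MvPolynomial (Fin N) ℝ, Continuous fun V =>
      2 * ev q V * ev r V / ev p V - ev q V ^ 2 * ev s V / ev p V ^ 2 := fun r s =>
    (((continuous_const.mul cq).mul (continuous_ev r)).div c0 hp').sub
      (((cq.pow 2).mul (continuous_ev s)).div (c0.pow 2) hp2)
  have cB : ∀ a b : Fin N, Continuous fun V => ev p V * (ev (angular a b q) V / ev p V -
        ev q V * ev (angular a b p) V / ev p V ^ 2) ^ 2 := fun a b =>
    c0.mul ((((continuous_ev _).div c0 hp').sub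
      ((cq.mul (continuous_ev _)).div (c0.pow 2) hp2)).pow 2)
  rw [integral_ev_lap_eq
    (A := fun a b V => 2 * ev q V * ev (angular a b (angular a b q)) V / ev p V -
      ev q V ^ 2 * ev (angular a b (angular a b p)) V / ev p V ^ 2)
    (B := fun a b V => -2 * (ev p V * (ev (angular a b q) V / ev p V -
        ev q V * ev (angular a b p) V / ev p V ^ 2) ^ 2))
    (fun a b => cA _ _) (fun a b => continuous_const.mul (cB a b)) (fun a b => ?_) fun V => ?_]
  · simp only [← Finset.mul_sum]
    rw [integral_const_mul, integral_const_mul]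
    have : (N : ℝ) ≠ 0 := by positivity
    field_simp
  · rcases eq_or_ne a b with rfl | hab
    · simp [angular_self]
    -- The function differentiated here is the angular derivative of `q² / p`.
    have r1 : RotDeriv a b hab (fun V => 2 * ev q V * ev (angular a b q) V / ev p V -
        ev q V ^ 2 * ev (angular a b p) V / ev p V ^ 2)
        (fun V => (2 * ev q V * ev (angular a b (angular a b q)) V / ev p V -
          ev q V ^ 2 * ev (angular a b (angular a b p)) V / ev p V ^ 2) +
          2 * (ev p V * (ev (angular a b q) V / ev p V -
            ev q V * ev (angular a b p) V / ev p V ^ 2) ^ 2)) := by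
      have hq1 := rotDeriv_ev a b hab (C 2 * q * angular a b q)
      have hq2 := rotDeriv_ev a b hab (q ^ 2 * angular a b p)
      have hp1 := rotDeriv_ev a b hab p
      have hp3 := rotDeriv_ev a b hab (p ^ 2)
      have := (hq1.div hp1 hp').sub (hq2.div hp3 (by simpa using hp'))
      simp only [ev_mul, ev_pow, ev_C] at this
      refine this.congr fun V => ?_
      have h0 := hp' V
      simp only [Derivation.leibniz, Derivation.leibniz_pow, smul_eq_mul, ev_mul, ev_add, ev_pow,
        ev_C, nsmul_eq_mul, Nat.cast_ofNat, ev_zero, MvPolynomial.derivation_C]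
      have h2 : ev (2 : MvPolynomial (Fin N) ℝ) V = 2 := by
        simp [ev]
      simp only [h2]
      field_simp
      ring
    have h1 := r1.integral_eq_zero (cA _ _) ((cA _ _).add (continuous_const.mul (cB a b)))
    have i1 := integrable_of_continuous (cA (angular a b (angular a b q))
      (angular a b (angular a b p)))
    have i2 : Integrable (fun V => -2 * (ev p V * (ev (angular a b q) V / ev p V -
        ev q V * ev (angular a b p) V / ev p V ^ 2) ^ 2)) (kacMeasure N) :=
      integrable_of_continuous (continuous_const.mul (cB a b))
    rw [← sub_eq_zero, ← integral_sub i1 i2, ← h1]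
    refine integral_congr_ae (Eventually.of_forall fun V => ?_)
    simp only
    ring
  · rw [ev_lap, ev_lap]
    simp only [Finset.sum_sub_distrib, Finset.mul_sum, mul_sub, Finset.sum_div]
    congr 1 <;>
    · refine Finset.sum_congr rfl fun a _ => Finset.sum_congr rfl fun b _ => ?_
      ring

/-- The weight `1 + v_i² + v_j²` as a polynomial. -/
def weight (i j : Fin N) : MvPolynomial (Fin N) ℝ := 1 + (X i ^ 2 + X j ^ 2)

theorem ev_weight (i j : Fin N) (V : KacSphere N) :
    ev (weight i j) V = 1 + (V.1 i ^ 2 + V.1 j ^ 2) := by simp [weight]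

theorem ev_lap_X_sq (hN : 0 < N) (i : Fin N) (V : KacSphere N) :
    ev (lap (X i ^ 2)) V = 2 - 2 * V.1 i ^ 2 := by
  have h : ∀ a b, ev (angular a b (angular a b (X i ^ 2))) V =
      2 * ((if i = a then V.1 b ^ 2 else 0) + (if i = b then V.1 a ^ 2 else 0) -
        2 * (if i = a then if i = b then V.1 a * V.1 b else 0 else 0)) +
      2 * V.1 i * ((if i = a then (if b = a then V.1 b else 0) - V.1 a else 0) -
        (if i = b then V.1 b - (if a = b then V.1 a else 0) else 0)) := by
    intro a b
    rcases eq_or_ne a b with rfl | hab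
    · rw [angular_self]
      by_cases hia : i = a
      · simp [hia]
        ring
      · simp [hia]
    have e1 : ev (angular a b (angular a b (X i ^ 2))) V =
        2 * ev (angular a b (X i)) V ^ 2 + 2 * V.1 i * ev (angular a b (angular a b (X i))) V := by
      simp only [pow_two, Derivation.leibniz, smul_eq_mul, map_add, ev_add, ev_mul, ev_X]
      ring
    rw [e1]
    by_cases hia : i = a
    · subst hia
      simp [angular_X, hab, hab.symm]
    by_cases hib : i = b
    · subst hib
      simp [angular_X, hab, hab.symm]
    · simp [angular_X, hia, hib]
  have hN' : (N : ℝ) ≠ 0 := by positivity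
  rw [ev_lap]
  simp only [h, Finset.sum_add_distrib, Finset.sum_sub_distrib, ← Finset.mul_sum,
    Finset.sum_ite_irrel, Finset.sum_const_zero, Finset.sum_ite_eq, Finset.mem_univ, if_true,
    coord_sq_sum, Finset.sum_ite_eq', Finset.sum_const, Finset.card_univ, Fintype.card_fin,
    nsmul_eq_mul]
  field_simp
  ring

/-- The factor 4 is the growth rate allowed for the production along the flow; over a time 12 it
costs the `exp (-48)` of the final constant. -/
theorem ev_lap_weight_le (hN : 0 < N) (i j : Fin N) (V : KacSphere N) :
    ev (lap (weight i j)) V ≤ 4 * ev (weight i j) V := by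
  have h1 : lap (1 : MvPolynomial (Fin N) ℝ) = 0 := by simp [lap_apply]
  rw [ev_weight, weight, map_add, map_add, h1]
  simp only [ev_add, ev_lap_X_sq hN, ev_zero]
  nlinarith [sq_nonneg (V.1 i), sq_nonneg (V.1 j)]

/-- The integrand of the entropy production. -/
def psiReal (x y : ℝ) : ℝ := (x - y) * (Real.log x - Real.log y)

theorem psiReal_nonneg {x y : ℝ} (hx : 0 < x) (hy : 0 < y) : 0 ≤ psiReal x y := by
  rcases le_total x y with h | h
  · exact mul_nonneg_of_nonpos_of_nonpos (by linarith) (by linarith [Real.log_le_log hx h])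
  · exact mul_nonneg (by linarith) (by linarith [Real.log_le_log hy h])

theorem rotDeriv_psiReal {a b : Fin N} (hab : a ≠ b) {p q : MvPolynomial (Fin N) ℝ}
    (hp : ∀ V, 0 < ev p V) (hq : ∀ V, 0 < ev q V) :
    RotDeriv a b hab (fun V => psiReal (ev p V) (ev q V))
      (fun V => (ev (angular a b p) V - ev (angular a b q) V) *
          (Real.log (ev p V) - Real.log (ev q V)) +
        (ev p V - ev q V) * (ev (angular a b p) V / ev p V - ev (angular a b q) V / ev q V)) :=
  ((rotDeriv_ev a b hab p).sub (rotDeriv_ev a b hab q)).mul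
    (((rotDeriv_ev a b hab p).log fun V => (hp V).ne').sub
      ((rotDeriv_ev a b hab q).log fun V => (hq V).ne'))

/-- The chain rule: the first line carries the gradient of ψ, the last one its Hessian, a perfect
square. -/
theorem rotDeriv_rotDeriv_psiReal {a b : Fin N} (hab : a ≠ b) {p q : MvPolynomial (Fin N) ℝ}
    (hp : ∀ V, 0 < ev p V) (hq : ∀ V, 0 < ev q V) :
    RotDeriv a b hab
      (fun V => (ev (angular a b p) V - ev (angular a b q) V) *
          (Real.log (ev p V) - Real.log (ev q V)) +
        (ev p V - ev q V) * (ev (angular a b p) V / ev p V - ev (angular a b q) V / ev q V))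
      (fun V => ((Real.log (ev p V) - Real.log (ev q V) + 1 - ev q V / ev p V) *
          ev (angular a b (angular a b p)) V +
        (Real.log (ev q V) - Real.log (ev p V) + 1 - ev p V / ev q V) *
          ev (angular a b (angular a b q)) V) +
        (ev p V + ev q V) *
          (ev (angular a b p) V / ev p V - ev (angular a b q) V / ev q V) ^ 2) := by
  have p1 := rotDeriv_ev a b hab p
  have q1 := rotDeriv_ev a b hab q
  have p2 := rotDeriv_ev a b hab (angular a b p)
  have q2 := rotDeriv_ev a b hab (angular a b q)
  have hp' : ∀ V, ev p V ≠ 0 := fun V => (hp V).ne'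
  have hq' : ∀ V, ev q V ≠ 0 := fun V => (hq V).ne'
  refine (((p2.sub q2).mul ((p1.log hp').sub (q1.log hq'))).add
    ((p1.sub q1).mul ((p2.div p1 hp').sub (q2.div q1 hq')))).congr fun V => ?_
  have h1 := hp' V
  have h2 := hq' V
  field_simp
  ring

/-- With `q` the rotated solution, the left side is the time derivative of the weighted ψ integral
at a fixed angle. Moving the Laplacian onto the weight leaves `ψ · lap w` minus the Hessian term
with the full gradient of `log p - log q`. -/
theorem integral_weight_mul_psi_le (hN : 0 < N) {i j : Fin N} (hij : i ≠ j)
    {p q : MvPolynomial (Fin N) ℝ} (hp : ∀ V, 0 < ev p V) (hq : ∀ V, 0 < ev q V) :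
    ∫ V, ev (weight i j) V * ((Real.log (ev p V) - Real.log (ev q V) + 1 - ev q V / ev p V) *
          ev (lap p) V + (Real.log (ev q V) - Real.log (ev p V) + 1 - ev p V / ev q V) *
          ev (lap q) V) ∂(kacMeasure N) ≤
      4 * ∫ V, ev (weight i j) V * psiReal (ev p V) (ev q V) ∂(kacMeasure N) -
      ∫ V, (ev p V + ev q V) *
        (ev (angular i j p) V / ev p V - ev (angular i j q) V / ev q V) ^ 2 ∂(kacMeasure N) := by
  have hp' : ∀ V, ev p V ≠ 0 := fun V => (hp V).ne'
  have hq' : ∀ V, ev q V ≠ 0 := fun V => (hq V).ne'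
  have cp := continuous_ev p
  have cq := continuous_ev q
  have lp : Continuous fun V => Real.log (ev p V) := cp.log hp'
  have lq : Continuous fun V => Real.log (ev q V) := cq.log hq'
  set w := weight i j with hw
  have cw := continuous_ev w
  have cpsi : Continuous fun V => psiReal (ev p V) (ev q V) := (cp.sub cq).mul (lp.sub lq)
  have cA : ∀ r s : MvPolynomial (Fin N) ℝ, Continuous fun V =>
      (Real.log (ev p V) - Real.log (ev q V) + 1 - ev q V / ev p V) * ev r V +
        (Real.log (ev q V) - Real.log (ev p V) + 1 - ev p V / ev q V) * ev s V := fun r s =>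
    ((((lp.sub lq).add continuous_const).sub (cq.div cp hp')).mul (continuous_ev _)).add
      ((((lq.sub lp).add continuous_const).sub (cp.div cq hq')).mul (continuous_ev _))
  have cG : ∀ a b : Fin N, Continuous fun V => (ev p V + ev q V) *
      (ev (angular a b p) V / ev p V - ev (angular a b q) V / ev q V) ^ 2 := fun a b =>
    (cp.add cq).mul ((((continuous_ev _).div cp hp').sub ((continuous_ev _).div cq hq')).pow 2)
  have cD : ∀ a b : Fin N, Continuous fun V => (ev (angular a b p) V - ev (angular a b q) V) *
          (Real.log (ev p V) - Real.log (ev q V)) +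
        (ev p V - ev q V) * (ev (angular a b p) V / ev p V - ev (angular a b q) V / ev q V) :=
    fun a b => (((continuous_ev _).sub (continuous_ev _)).mul (lp.sub lq)).add
      ((cp.sub cq).mul (((continuous_ev _).div cp hp').sub ((continuous_ev _).div cq hq')))
  rw [integral_ev_lap_eq
    (A := fun a b V => ev w V * ((Real.log (ev p V) - Real.log (ev q V) + 1 - ev q V / ev p V) *
        ev (angular a b (angular a b p)) V +
      (Real.log (ev q V) - Real.log (ev p V) + 1 - ev p V / ev q V) *
        ev (angular a b (angular a b q)) V))
    (B := fun a b V => ev (angular a b (angular a b w)) V * psiReal (ev p V) (ev q V) -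
      ev w V * ((ev p V + ev q V) *
        (ev (angular a b p) V / ev p V - ev (angular a b q) V / ev q V) ^ 2))
    (fun a b => cw.mul (cA _ _)) (fun a b => ((continuous_ev _).mul cpsi).sub (cw.mul (cG a b)))
    (fun a b => ?_) fun V => ?_]
  · have i1 : Integrable (fun V => 4 * (ev w V * psiReal (ev p V) (ev q V))) (kacMeasure N) :=
      integrable_of_continuous (continuous_const.mul (cw.mul cpsi))
    have i2 := integrable_of_continuous (cG i j)
    rw [← integral_const_mul, ← integral_sub i1 i2]
    refine integral_mono (integrable_of_continuous (continuous_const.mul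
      (continuous_finsetSum _ fun a _ => continuous_finsetSum _ fun b _ =>
        ((continuous_ev _).mul cpsi).sub (cw.mul (cG a b))))) (i1.sub i2) fun V => ?_
    have hN' : (0 : ℝ) < N := by positivity
    have e1 : 1 / (2 * N : ℝ) * ∑ a, ∑ b, (ev (angular a b (angular a b w)) V *
          psiReal (ev p V) (ev q V) - ev w V * ((ev p V + ev q V) *
          (ev (angular a b p) V / ev p V - ev (angular a b q) V / ev q V) ^ 2)) =
        ev (lap w) V * psiReal (ev p V) (ev q V) - (ev p V + ev q V) * (ev w V *
          (1 / (2 * N : ℝ) * ∑ a, ∑ b,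
            (ev (angular a b p) V / ev p V - ev (angular a b q) V / ev q V) ^ 2)) := by
      rw [ev_lap]
      simp only [Finset.sum_sub_distrib, ← Finset.mul_sum, ← Finset.sum_mul]
      ring
    have e2 : ∀ a b, ev (angular a b p) V / ev p V - ev (angular a b q) V / ev q V =
        V.1 b * (ev (pderiv a p) V / ev p V - ev (pderiv a q) V / ev q V) -
          V.1 a * (ev (pderiv b p) V / ev p V - ev (pderiv b q) V / ev q V) := by
      intro a b
      simp only [angular_apply, ev_sub, ev_mul, ev_X]
      ring
    have e3 := sq_angular_le (x := fun l => V.1 l)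
      (y := fun l => ev (pderiv l p) V / ev p V - ev (pderiv l q) V / ev q V) hN'
      (coord_sq_sum V) hij
    simp only [← e2] at e3
    -- This is where the quadratic weight is needed: it trades the full tangential gradient for the
    -- single derivative in the plane of `i` and `j`, whatever `N` is.
    have e4 : (ev (angular i j p) V / ev p V - ev (angular i j q) V / ev q V) ^ 2 ≤
        ev w V * (1 / (2 * N : ℝ) * ∑ a, ∑ b,
            (ev (angular a b p) V / ev p V - ev (angular a b q) V / ev q V) ^ 2) := by
      refine e3.trans (mul_le_mul_of_nonneg_right ?_ (mul_nonneg (by positivity)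
        (Finset.sum_nonneg fun a _ => Finset.sum_nonneg fun b _ => sq_nonneg _)))
      rw [hw, ev_weight]
      linarith
    have e5 := mul_le_mul_of_nonneg_right (ev_lap_weight_le hN i j V)
      (psiReal_nonneg (hp V) (hq V))
    have e6 := mul_le_mul_of_nonneg_left e4 (add_pos (hp V) (hq V)).le
    simp only
    rw [e1]
    linarith
  · rcases eq_or_ne a b with rfl | hab
    · simp [angular_self]
    have h1 := integral_mul_rotDeriv_rotDeriv (rotDeriv_psiReal hab hp hq)
      (rotDeriv_rotDeriv_psiReal hab hp hq) cpsi (cD a b) ((cA _ _).add (cG a b)) w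
    simp only [mul_add] at h1
    have i1 : Integrable (fun V => ev (angular a b (angular a b w)) V *
        psiReal (ev p V) (ev q V)) (kacMeasure N) :=
      integrable_of_continuous ((continuous_ev _).mul cpsi)
    have i2 : Integrable (fun V => ev w V * ((ev p V + ev q V) *
        (ev (angular a b p) V / ev p V - ev (angular a b q) V / ev q V) ^ 2)) (kacMeasure N) :=
      integrable_of_continuous (cw.mul (cG a b))
    rw [integral_sub i1 i2, ← h1]
    rw [← integral_sub (integrable_of_continuous ?_) i2]
    · refine integral_congr_ae (Eventually.of_forall fun V => ?_)
      simp only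
      ring
    · simp only [← mul_add]
      exact cw.mul ((cA _ _).add (cG a b))
  · rw [ev_lap, ev_lap]
    simp only [Finset.mul_sum, mul_add, Finset.sum_add_distrib]
    congr 1 <;>
    · refine Finset.sum_congr rfl fun a _ => Finset.sum_congr rfl fun b _ => ?_
      ring

/-! ### Decay of Fisher information and entropy along the flow -/

theorem exists_rot_eq_zero (o k : Fin N) (hok : o ≠ k) (V : KacSphere N) :
    ∃ θ : ℝ, |θ| ≤ Real.pi ∧ (rot o k hok θ V).1 k = 0 ∧ 0 ≤ (rot o k hok θ V).1 o := by
  set z : ℂ := ⟨V.1 o, V.1 k⟩ with hz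
  have h1 : ‖z‖ * Real.cos z.arg = V.1 o := Complex.norm_mul_cos_arg z
  have h2 : ‖z‖ * Real.sin z.arg = V.1 k := Complex.norm_mul_sin_arg z
  refine ⟨z.arg, Complex.abs_arg_le_pi z, ?_, ?_⟩
  · simp only [rot, collide, hok.symm, if_false, if_true, ← h1, ← h2]
    ring
  · simp only [rot, collide, if_true, ← h1, ← h2]
    have : ‖z‖ * Real.cos z.arg * Real.cos z.arg + ‖z‖ * Real.sin z.arg * Real.sin z.arg =
        ‖z‖ * (Real.sin z.arg ^ 2 + Real.cos z.arg ^ 2) := by ring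
    rw [this, Real.sin_sq_add_cos_sq, mul_one]
    exact norm_nonneg z

/-- A function that varies little along plane rotations is nearly constant. -/
theorem abs_sub_le_of_rot (hN : 2 ≤ N) (o : Fin N) {f : KacSphere N → ℝ} {ε : ℝ}
    (h : ∀ k (hk : o ≠ k) (θ : ℝ) (V : KacSphere N), |θ| ≤ Real.pi →
      |f V - f (rot o k hk θ V)| ≤ ε) (V W : KacSphere N) : |f V - f W| ≤ 2 * N * ε := by
  -- The coordinates other than `o` are rotated to zero one at a time, each at cost `ε`. Every point
  -- ends at the same pole, where the `o`-th coordinate is `√N`; the sign condition excludes the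
  -- opposite pole.
  have step : ∀ s : Finset (Fin N), o ∉ s → ∀ V : KacSphere N, ∃ W : KacSphere N,
      (∀ l ∈ s, W.1 l = 0) ∧ |f V - f W| ≤ s.card * ε ∧ (s.Nonempty → 0 ≤ W.1 o) := by
    intro s
    induction s using Finset.induction_on with
    | empty => exact fun _ V => ⟨V, by simp, by simp, by simp⟩
    | insert k s hks ih =>
      intro ho V
      rw [Finset.mem_insert, not_or] at ho
      obtain ⟨W, hW, hfW, -⟩ := ih ho.2 V
      obtain ⟨θ, hθ, hk0, ho0⟩ := exists_rot_eq_zero o k ho.1 W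
      refine ⟨rot o k ho.1 θ W, fun l hl => ?_, ?_, fun _ => ho0⟩
      · rcases Finset.mem_insert.1 hl with rfl | hl
        · exact hk0
        · have h1 : l ≠ o := fun e => ho.2 (e ▸ hl)
          have h2 : l ≠ k := fun e => hks (e ▸ hl)
          simpa [rot, collide, h1, h2] using hW l hl
      · rw [Finset.card_insert_of_notMem hks, Nat.cast_succ]
        have := h k ho.1 θ W hθ
        have := abs_sub_le (f V) (f W) (f (rot o k ho.1 θ W))
        linarith
  have hcard : (Finset.univ.erase o).card = N - 1 := by
    rw [Finset.card_erase_of_mem (Finset.mem_univ o), Finset.card_univ, Fintype.card_fin]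
  have hne : (Finset.univ.erase o).Nonempty := by
    rw [← Finset.card_pos, hcard]
    omega
  have pole : ∀ W : KacSphere N, (∀ l ∈ Finset.univ.erase o, W.1 l = 0) → 0 ≤ W.1 o →
      W.1 o = Real.sqrt N := by
    intro W hW h0
    have h1 := coord_sq_sum W
    rw [← Finset.add_sum_erase _ _ (Finset.mem_univ o),
      Finset.sum_eq_zero fun l hl => by rw [hW l hl, zero_pow two_ne_zero], add_zero] at h1
    have h2 := congrArg Real.sqrt h1
    rwa [Real.sqrt_sq h0] at h2
  obtain ⟨V', hV', hfV, hV0⟩ := step _ (Finset.notMem_erase o _) V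
  obtain ⟨W', hW', hfW, hW0⟩ := step _ (Finset.notMem_erase o _) W
  have heq : V' = W' := by
    refine Subtype.ext ?_
    ext l
    rcases eq_or_ne l o with rfl | hl
    · exact (pole V' hV' (hV0 hne)).trans (pole W' hW' (hW0 hne)).symm
    · have hl' : l ∈ Finset.univ.erase o := Finset.mem_erase.2 ⟨hl, Finset.mem_univ l⟩
      exact (hV' l hl').trans (hW' l hl').symm
  subst heq
  have hε : 0 ≤ ε := by
    obtain ⟨k, hk⟩ := hne
    exact (abs_nonneg _).trans (h k (Finset.ne_of_mem_erase hk).symm 0 V (by simpa using Real.pi_pos.le))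
  have hc : ((Finset.univ.erase o).card : ℝ) ≤ N := by
    rw [hcard]
    exact_mod_cast Nat.sub_le N 1
  have h3 := abs_sub_le (f V) (f V') (f W)
  rw [abs_sub_comm (f V') (f W)] at h3
  nlinarith [mul_le_mul_of_nonneg_right hc hε]

/-- The times at which the solution is positive. -/
def posTime (c : ℝ → MvPolynomial (Fin N) ℝ) : Set ℝ := {t | ∀ V, 0 < ev (c t) V}

/-- The complement is the projection of a closed set along a compact factor. -/
theorem isOpen_posTime {c : ℝ → MvPolynomial (Fin N) ℝ} (hc : IsHeatFlow c) :
    IsOpen (posTime c) := by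
  have h1 : Continuous fun q : ℝ × KacSphere N => ev (c q.1) q.2 := by
    simpa using hc.continuous_ev LinearMap.id
  have h2 : posTime c = (Prod.fst '' {q : ℝ × KacSphere N | ev (c q.1) q.2 ≤ 0})ᶜ := by
    ext t
    simp [posTime]
  rw [h2, isOpen_compl_iff]
  exact isClosedMap_fst_of_compactSpace _ (isClosed_le h1 continuous_const)

theorem exists_pos_le_ev [Nonempty (KacSphere N)] {p : MvPolynomial (Fin N) ℝ}
    (hp : ∀ V, 0 < ev p V) : ∃ m, 0 < m ∧ ∀ V, m ≤ ev p V := by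
  obtain ⟨V, -, hV⟩ := isCompact_univ.exists_isMinOn univ_nonempty
    (continuous_ev p).continuousOn
  exact ⟨_, hp V, fun W => hV (mem_univ W)⟩

theorem IsHeatFlow.mem_posTime {c : ℝ → MvPolynomial (Fin N) ℝ} (hc : IsHeatFlow c)
    (h0 : ∀ V, 0 < ev (c 0) V) {t : ℝ} (ht : 0 ≤ t) : t ∈ posTime c := fun V => by
  have : Nonempty (KacSphere N) := ⟨V⟩
  obtain ⟨m, hm, hle⟩ := exists_pos_le_ev h0
  exact hm.trans_le (hc.le_ev hle ht V)

/-- The Fisher information of a polynomial density. -/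
def fisher (p : MvPolynomial (Fin N) ℝ) : ℝ :=
  ∫ V, ∑ a, ∑ b, ev (angular a b p) V ^ 2 / ev p V ∂(kacMeasure N)

theorem fisher_nonneg {p : MvPolynomial (Fin N) ℝ} (hp : ∀ V, 0 < ev p V) : 0 ≤ fisher p :=
  integral_nonneg fun V => Finset.sum_nonneg fun a _ => Finset.sum_nonneg fun b _ =>
    div_nonneg (sq_nonneg _) (hp V).le

theorem sum_sum_comm_sum_sum {ι : Type*} [Fintype ι] (f : ι → ι → ι → ι → ℝ) :
    ∑ a, ∑ b, ∑ d, ∑ e, f a b d e = ∑ d, ∑ e, ∑ a, ∑ b, f a b d e := by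
  have h : ∀ g : ι → ι → ι → ℝ, ∑ b, ∑ d, ∑ e, g b d e = ∑ d, ∑ e, ∑ b, g b d e := fun g =>
    Finset.sum_comm.trans (Finset.sum_congr rfl fun d _ => Finset.sum_comm)
  exact (Finset.sum_congr rfl fun a _ => h (f a)).trans (h fun a d e => ∑ b, f a b d e)

theorem IsHeatFlow.continuousOn_ev {c : ℝ → MvPolynomial (Fin N) ℝ} (hc : IsHeatFlow c)
    (T : MvPolynomial (Fin N) ℝ →ₗ[ℝ] MvPolynomial (Fin N) ℝ)
    (s : Set (ℝ × KacSphere N)) : ContinuousOn (fun q : ℝ × KacSphere N => ev (T (c q.1)) q.2) s :=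
  (hc.continuous_ev T).continuousOn

theorem IsHeatFlow.continuousOn_ev_self {c : ℝ → MvPolynomial (Fin N) ℝ} (hc : IsHeatFlow c)
    (s : Set (ℝ × KacSphere N)) :
    ContinuousOn (fun q : ℝ × KacSphere N => ev (c q.1) q.2) s := by
  simpa using hc.continuousOn_ev LinearMap.id s

theorem IsHeatFlow.hasDerivAt_ev_self {c : ℝ → MvPolynomial (Fin N) ℝ} (hc : IsHeatFlow c)
    (V : KacSphere N) (t : ℝ) :
    HasDerivAt (fun s => ev (c s) V) (ev (lap (c t)) V) t := by
  simpa using hc.hasDerivAt_ev LinearMap.id V t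

theorem IsHeatFlow.hasDerivAt_entropy {c : ℝ → MvPolynomial (Fin N) ℝ} (hc : IsHeatFlow c)
    (hN : 0 < N) {t : ℝ} (ht : t ∈ posTime c) :
    HasDerivAt (fun s => ∫ V, ev (c s) V * Real.log (ev (c s) V) ∂(kacMeasure N))
      (-(1 / (2 * N : ℝ) * fisher (c t))) t := by
  have h := hasDerivAt_integral_sphere (isOpen_posTime hc)
    (f := fun s V => ev (c s) V * Real.log (ev (c s) V))
    (f' := fun s V => ev (lap (c s)) V * (Real.log (ev (c s) V) + 1))
    (fun s hs => (KacModel.continuous_ev _).mul ((KacModel.continuous_ev _).log fun V => (hs V).ne'))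
    ((hc.continuousOn_ev lap _).mul (((hc.continuousOn_ev_self _).log
      fun q hq => (hq.1 q.2).ne').add continuousOn_const))
    (fun s hs V => ?_) ht
  · rwa [integral_lap_mul_log hN ht] at h
  · have h1 := hc.hasDerivAt_ev_self V s
    refine (h1.fun_mul (h1.log (hs V).ne')).congr_deriv ?_
    have := (hs V).ne'
    field_simp

/-- The Bakry–Émery argument. Each angular derivative of the solution solves the heat equation, so
the derivative of the Fisher information is minus a weighted sum of squares of second angular
derivatives of the logarithm, bounded below by curvature. -/
theorem IsHeatFlow.exists_hasDerivAt_fisher {c : ℝ → MvPolynomial (Fin N) ℝ} (hc : IsHeatFlow c)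
    (hN : 3 ≤ N) {t : ℝ} (ht : t ∈ posTime c) :
    ∃ J', HasDerivAt (fun s => fisher (c s)) J' t ∧ J' ≤ -(1 / 12 * fisher (c t)) := by
  have hN0 : 0 < N := by omega
  have hcont : ∀ T : MvPolynomial (Fin N) ℝ →ₗ[ℝ] MvPolynomial (Fin N) ℝ,
      ContinuousOn (fun q : ℝ × KacSphere N => ev (T (c q.1)) q.2) (posTime c ×ˢ univ) :=
    fun T => hc.continuousOn_ev T _
  have h := hasDerivAt_integral_sphere (isOpen_posTime hc)
    (f := fun s V => ∑ a, ∑ b, ev (angular a b (c s)) V ^ 2 / ev (c s) V)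
    (f' := fun s V => ∑ a, ∑ b, (2 * ev (angular a b (c s)) V * ev (angular a b (lap (c s))) V /
      ev (c s) V - ev (angular a b (c s)) V ^ 2 * ev (lap (c s)) V / ev (c s) V ^ 2))
    (fun s hs => continuous_finsetSum _ fun a _ => continuous_finsetSum _ fun b _ =>
      ((KacModel.continuous_ev _).pow 2).div (KacModel.continuous_ev _) fun V => (hs V).ne')
    (continuousOn_finsetSum _ fun a _ => continuousOn_finsetSum _ fun b _ =>
      (((continuousOn_const.mul (hcont (angular a b).toLinearMap)).mul
        (hcont ((angular a b).toLinearMap ∘ₗ lap))).div (hc.continuousOn_ev_self _)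
          fun q hq => (hq.1 q.2).ne').sub
      ((((hcont (angular a b).toLinearMap).pow 2).mul (hcont lap)).div
        ((hc.continuousOn_ev_self _).pow 2) fun q hq => pow_ne_zero 2 (hq.1 q.2).ne'))
    (fun s hs V => HasDerivAt.fun_sum fun a _ => HasDerivAt.fun_sum fun b _ => ?_) ht
  · refine ⟨_, h, ?_⟩
    have hp' : ∀ V, ev (c t) V ≠ 0 := fun V => (ht V).ne'
    have cc := KacModel.continuous_ev (c t)
    have i1 : ∀ a b, Integrable (fun V => 2 * ev (angular a b (c t)) V *
        ev (angular a b (lap (c t))) V / ev (c t) V -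
        ev (angular a b (c t)) V ^ 2 * ev (lap (c t)) V / ev (c t) V ^ 2) (kacMeasure N) :=
      fun a b => integrable_of_continuous
        ((((continuous_const.mul (KacModel.continuous_ev _)).mul (KacModel.continuous_ev _)).div
          cc hp').sub ((((KacModel.continuous_ev _).pow 2).mul (KacModel.continuous_ev _)).div
            (cc.pow 2) fun V => pow_ne_zero 2 (hp' V)))
    have cM : ∀ a b d e : Fin N, Continuous fun V => ev (c t) V *
        (ev (angular d e (angular a b (c t))) V / ev (c t) V -
        ev (angular a b (c t)) V * ev (angular d e (c t)) V / ev (c t) V ^ 2) ^ 2 :=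
      fun a b d e => cc.mul ((((KacModel.continuous_ev _).div cc hp').sub
        (((KacModel.continuous_ev _).mul (KacModel.continuous_ev _)).div (cc.pow 2)
          fun V => pow_ne_zero 2 (hp' V))).pow 2)
    rw [integral_finsetSum _ fun a _ => integrable_finsetSum _ fun b _ => i1 a b]
    have e1 : ∀ a b, ∫ V, (2 * ev (angular a b (c t)) V *
        ev (angular a b (lap (c t))) V / ev (c t) V -
        ev (angular a b (c t)) V ^ 2 * ev (lap (c t)) V / ev (c t) V ^ 2) ∂(kacMeasure N) =
        -(1 / (N : ℝ) * ∫ V, ∑ d, ∑ e, ev (c t) V *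
          (ev (angular d e (angular a b (c t))) V / ev (c t) V -
          ev (angular a b (c t)) V * ev (angular d e (c t)) V / ev (c t) V ^ 2) ^ 2
            ∂(kacMeasure N)) := by
      intro a b
      rw [← integral_fisher_density hN0 ht]
      simp only [ev_lap_angular]
    have e2 : ∀ a, ∫ V, ∑ b, (2 * ev (angular a b (c t)) V *
        ev (angular a b (lap (c t))) V / ev (c t) V -
        ev (angular a b (c t)) V ^ 2 * ev (lap (c t)) V / ev (c t) V ^ 2) ∂(kacMeasure N) =
        ∑ b, -(1 / (N : ℝ) * ∫ V, ∑ d, ∑ e, ev (c t) V *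
          (ev (angular d e (angular a b (c t))) V / ev (c t) V -
          ev (angular a b (c t)) V * ev (angular d e (c t)) V / ev (c t) V ^ 2) ^ 2
            ∂(kacMeasure N)) := fun a => by
      rw [integral_finsetSum _ fun b _ => i1 a b]
      exact Finset.sum_congr rfl fun b _ => e1 a b
    have i3 : ∀ a b, Integrable (fun V => ∑ d, ∑ e, ev (c t) V *
          (ev (angular d e (angular a b (c t))) V / ev (c t) V -
          ev (angular a b (c t)) V * ev (angular d e (c t)) V / ev (c t) V ^ 2) ^ 2)
          (kacMeasure N) := fun a b => integrable_of_continuous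
      (continuous_finsetSum _ fun d _ => continuous_finsetSum _ fun e _ => cM a b d e)
    simp only [e2]
    simp only [Finset.sum_neg_distrib, ← Finset.mul_sum]
    rw [neg_le_neg_iff]
    have e3 : ∑ a, ∑ b, ∫ V, ∑ d, ∑ e, ev (c t) V *
          (ev (angular d e (angular a b (c t))) V / ev (c t) V -
          ev (angular a b (c t)) V * ev (angular d e (c t)) V / ev (c t) V ^ 2) ^ 2
            ∂(kacMeasure N) =
        ∫ V, ∑ a, ∑ b, ∑ d, ∑ e, ev (c t) V *
          (ev (angular d e (angular a b (c t))) V / ev (c t) V -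
          ev (angular a b (c t)) V * ev (angular d e (c t)) V / ev (c t) V ^ 2) ^ 2
            ∂(kacMeasure N) := by
      rw [integral_finsetSum _ fun a _ => integrable_finsetSum _ fun b _ => i3 a b]
      exact Finset.sum_congr rfl fun a _ => (integral_finsetSum _ fun b _ => i3 a b).symm
    simp only [← Finset.mul_sum] at e3 ⊢
    rw [e3, fisher, ← integral_const_mul, ← integral_const_mul]
    refine integral_mono (integrable_of_continuous (continuous_const.mul
      (continuous_finsetSum _ fun a _ => continuous_finsetSum _ fun b _ =>
        ((KacModel.continuous_ev _).pow 2).div cc hp')))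
      (integrable_of_continuous (continuous_const.mul ?_)) fun V => ?_
    · simp only [Finset.mul_sum]
      exact continuous_finsetSum _ fun a _ => continuous_finsetSum _ fun b _ =>
        continuous_finsetSum _ fun d _ => continuous_finsetSum _ fun e _ => cM a b d e
    have hN3 : (3 : ℝ) ≤ N := by exact_mod_cast hN
    -- Here `g` holds the angular derivatives of the logarithm of the solution and `M` their angular
    -- derivatives.
    have hcurv := curvature_le (N := N)
      (M := fun d e a b => ev (angular d e (angular a b (c t))) V / ev (c t) V -
          ev (angular a b (c t)) V * ev (angular d e (c t)) V / ev (c t) V ^ 2)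
      (g := fun a b => ev (angular a b (c t)) V / ev (c t) V)
      (fun i => by simp [angular_self])
      (fun a b d e => by rw [angular_swap, angular_swap a b]; simp only [ev_neg]; ring)
      (fun a b d e => by
        rw [angular_swap d e, map_neg]
        simp only [ev_neg]
        ring)
      (fun i j k hij hik hkj => by
        have := congrArg (fun p => ev p V) (angular_commutator hij hik hkj (c t))
        simp only [ev_sub, ev_neg] at this
        linear_combination (1 / ev (c t) V) * this)
    have e4 : ∑ a, ∑ b, ∑ d, ∑ e,
          (ev (angular d e (angular a b (c t))) V / ev (c t) V -
          ev (angular a b (c t)) V * ev (angular d e (c t)) V / ev (c t) V ^ 2) ^ 2 =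
        ∑ d, ∑ e, ∑ a, ∑ b, (ev (angular d e (angular a b (c t))) V / ev (c t) V -
          ev (angular a b (c t)) V * ev (angular d e (c t)) V / ev (c t) V ^ 2) ^ 2 := by
      rw [sum_sum_comm_sum_sum]
    have e5 : ∑ a, ∑ b, ev (angular a b (c t)) V ^ 2 / ev (c t) V =
        ev (c t) V * ∑ a, ∑ b, (ev (angular a b (c t)) V / ev (c t) V) ^ 2 := by
      simp only [Finset.mul_sum]
      refine Finset.sum_congr rfl fun a _ => Finset.sum_congr rfl fun b _ => ?_
      have := hp' V
      field_simp
    rw [e5, e4]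
    set S₁ := ∑ a, ∑ b, (ev (angular a b (c t)) V / ev (c t) V) ^ 2
    have hS₁ : 0 ≤ S₁ := Finset.sum_nonneg fun a _ => Finset.sum_nonneg fun b _ => sq_nonneg _
    -- The rate 1/12 is the value of `(N - 2) / (4 N)` at `N = 3`, its minimum over `N ≥ 3`.
    have e6 : 1 / 12 * S₁ ≤ 1 / (N : ℝ) * (((N : ℝ) - 2) / 4 * S₁) := by
      rw [← mul_assoc]
      refine mul_le_mul_of_nonneg_right ?_ hS₁
      rw [div_mul_div_comm, div_le_div_iff₀ (by norm_num) (by positivity)]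
      linarith
    have e7 := mul_le_mul_of_nonneg_left (e6.trans (mul_le_mul_of_nonneg_left hcurv
      (by positivity))) (ht V).le
    linarith
  · have h1 := hc.hasDerivAt_ev_self V s
    have h2 := hc.hasDerivAt_ev (angular a b).toLinearMap V s
    refine ((h2.fun_pow 2).fun_div h1 (hs V).ne').congr_deriv ?_
    have := (hs V).ne'
    simp only [Derivation.coeFn_coe, Nat.cast_ofNat]
    field_simp
    ring

theorem integral_ev_lap (hN : 0 < N) (p : MvPolynomial (Fin N) ℝ) :
    ∫ V, ev (lap p) V ∂(kacMeasure N) = 0 := by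
  rw [integral_ev_lap_eq (A := fun a b V => ev (angular a b (angular a b p)) V)
    (B := fun _ _ _ => 0) (fun a b => continuous_ev _) (fun a b => continuous_const)
    (fun a b => ?_) fun V => ev_lap p V]
  · simp
  · rcases eq_or_ne a b with rfl | hab
    · simp [angular_self]
    · simpa using (rotDeriv_ev a b hab (angular a b p)).integral_eq_zero (continuous_ev _)
        (continuous_ev _)

theorem IsHeatFlow.integral_eq {c : ℝ → MvPolynomial (Fin N) ℝ} (hc : IsHeatFlow c) (hN : 0 < N)
    (t : ℝ) : ∫ V, ev (c t) V ∂(kacMeasure N) = ∫ V, ev (c 0) V ∂(kacMeasure N) := by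
  have h : ∀ s, HasDerivAt (fun s => ∫ V, ev (c s) V ∂(kacMeasure N)) 0 s := fun s => by
    have := hasDerivAt_integral_sphere isOpen_univ (f := fun s V => ev (c s) V)
      (f' := fun s V => ev (lap (c s)) V) (fun s _ => KacModel.continuous_ev _)
      (hc.continuousOn_ev lap _) (fun s _ V => hc.hasDerivAt_ev_self V s) (mem_univ s)
    rwa [integral_ev_lap hN] at this
  exact is_const_of_deriv_eq_zero (fun s => (h s).differentiableAt) (fun s => (h s).deriv) t 0

theorem lap_sq (p : MvPolynomial (Fin N) ℝ) (V : KacSphere N) :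
    ev (lap (p ^ 2)) V = 2 * ev p V * ev (lap p) V +
      1 / (N : ℝ) * ∑ a, ∑ b, ev (angular a b p) V ^ 2 := by
  have h : ∀ a b, ev (angular a b (angular a b (p ^ 2))) V =
      2 * ev p V * ev (angular a b (angular a b p)) V + 2 * ev (angular a b p) V ^ 2 := by
    intro a b
    simp only [pow_two, Derivation.leibniz, smul_eq_mul, map_add, ev_add, ev_mul]
    ring
  rw [ev_lap, ev_lap]
  simp only [h, Finset.sum_add_distrib, ← Finset.mul_sum]
  rcases Nat.eq_zero_or_pos N with rfl | hN
  · simp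
  have : (N : ℝ) ≠ 0 := by positivity
  field_simp

/-- The same curvature bound, applied pointwise to the solution instead of its logarithm, makes `exp
(t / 12)` times the squared gradient a subsolution of the heat equation; the minimum principle
applies to its negative. -/
theorem IsHeatFlow.sum_sq_angular_le {c : ℝ → MvPolynomial (Fin N) ℝ} (hc : IsHeatFlow c)
    (hN : 3 ≤ N) {K : ℝ} (h0 : ∀ V, ∑ a, ∑ b, ev (angular a b (c 0)) V ^ 2 ≤ K) {t : ℝ}
    (ht : 0 ≤ t) (V : KacSphere N) :
    ∑ a, ∑ b, ev (angular a b (c t)) V ^ 2 ≤ K * Real.exp (-(1 / 12 * t)) := by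
  have hexp : ∀ t : ℝ, HasDerivAt (fun s => Real.exp (1 / 12 * s))
      (Real.exp (1 / 12 * t) * (1 / 12)) t := fun t => by
    simpa using ((hasDerivAt_id t).const_mul (1 / 12 : ℝ)).exp
  have key := le_of_lap_le_deriv (m := -K) (t := t)
    (Q := fun s => -(Real.exp (1 / 12 * s) • ∑ a, ∑ b, angular a b (c s) ^ 2))
    (d := fun s V => -(Real.exp (1 / 12 * s) * (1 / 12) * ∑ a, ∑ b, ev (angular a b (c s)) V ^ 2 +
      Real.exp (1 / 12 * s) * ∑ a, ∑ b, 2 * ev (angular a b (c s)) V *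
        ev (angular a b (lap (c s))) V)) ?_ ?_ ?_ ?_ ht V
  · simp only [ev_neg, ev_smul, ev_sum, ev_pow, neg_le_neg_iff] at key
    rw [Real.exp_neg, ← div_eq_mul_inv, le_div_iff₀ (Real.exp_pos _)]
    linarith
  · simp only [ev_neg, ev_smul, ev_sum, ev_pow]
    refine ((Real.continuous_exp.comp (continuous_const.mul continuous_fst)).mul
      (continuous_finsetSum _ fun a _ => continuous_finsetSum _ fun b _ => ?_)).neg
    exact (hc.continuous_ev (angular a b).toLinearMap).pow 2
  · intro s V
    simp only [ev_neg, ev_smul, ev_sum, ev_pow]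
    refine ((hexp s).fun_mul (HasDerivAt.fun_sum fun a _ => HasDerivAt.fun_sum fun b _ => ?_)).neg
    refine ((hc.hasDerivAt_ev (angular a b).toLinearMap V s).fun_pow 2).congr_deriv ?_
    simp
  · intro s V
    simp only [map_neg, map_smul, map_sum, ev_neg, ev_smul, ev_sum, lap_sq, ev_lap_angular]
    rw [neg_le_neg_iff, mul_assoc, ← mul_add]
    refine mul_le_mul_of_nonneg_left ?_ (Real.exp_pos _).le
    simp only [Finset.sum_add_distrib, ← Finset.mul_sum]
    have hcurv := curvature_le (N := N)
      (M := fun d e a b => ev (angular d e (angular a b (c s))) V)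
      (g := fun a b => ev (angular a b (c s)) V)
      (fun i => by simp [angular_self])
      (fun a b d e => by rw [angular_swap]; simp only [ev_neg])
      (fun a b d e => by rw [angular_swap d e, map_neg]; simp only [ev_neg])
      (fun i j k hij hik hkj => by
        simpa using congrArg (fun p => ev p V) (angular_commutator hij hik hkj (c s)))
    rw [sum_sum_comm_sum_sum fun a b d e => ev (angular d e (angular a b (c s))) V ^ 2]
    set S₁ := ∑ a, ∑ b, ev (angular a b (c s)) V ^ 2
    have hS₁ : 0 ≤ S₁ := Finset.sum_nonneg fun a _ => Finset.sum_nonneg fun b _ => sq_nonneg _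
    have hN3 : (3 : ℝ) ≤ N := by exact_mod_cast hN
    have e6 : 1 / 12 * S₁ ≤ 1 / (N : ℝ) * (((N : ℝ) - 2) / 4 * S₁) := by
      rw [← mul_assoc]
      refine mul_le_mul_of_nonneg_right ?_ hS₁
      rw [div_mul_div_comm, div_le_div_iff₀ (by norm_num) (by positivity)]
      linarith
    have e7 := mul_le_mul_of_nonneg_left hcurv (show 0 ≤ 1 / (N : ℝ) by positivity)
    linarith
  · intro V
    simp only [mul_zero, Real.exp_zero, one_smul, ev_neg, ev_sum, ev_pow, neg_le_neg_iff]
    exact h0 V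

/-- Kac's entropy of a polynomial density. -/
def polyEntropy (p : MvPolynomial (Fin N) ℝ) : ℝ :=
  ∫ V, ev p V * Real.log (ev p V) ∂(kacMeasure N)

theorem integrable_ev (p : MvPolynomial (Fin N) ℝ) : Integrable (ev p) (kacMeasure N) :=
  integrable_of_continuous (continuous_ev p)

theorem integrable_ev_mul_log {p : MvPolynomial (Fin N) ℝ} (hp : ∀ V, 0 < ev p V) :
    Integrable (fun V => ev p V * Real.log (ev p V)) (kacMeasure N) :=
  integrable_of_continuous ((continuous_ev p).mul ((continuous_ev p).log fun V => (hp V).ne'))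

theorem polyEntropy_nonneg (hN : N ≠ 0) {p : MvPolynomial (Fin N) ℝ} (hp : ∀ V, 0 < ev p V)
    (h1 : ∫ V, ev p V ∂(kacMeasure N) = 1) : 0 ≤ polyEntropy p := by
  have := isProbabilityMeasure_kacMeasure hN
  have h2 : ∫ V, (ev p V - 1) ∂(kacMeasure N) = 0 := by
    rw [integral_sub (integrable_ev p) (integrable_const _), h1]
    simp
  rw [← h2]
  refine integral_mono ((integrable_ev p).sub (integrable_const _)) (integrable_ev_mul_log hp)
    fun V => ?_
  have h3 := Real.one_sub_inv_le_log_of_pos (hp V)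
  have h4 := mul_le_mul_of_nonneg_left h3 (hp V).le
  rw [mul_sub, mul_one, mul_inv_cancel₀ (hp V).ne'] at h4
  exact h4

/-- A density of mean 1 exceeds 1 by at most its oscillation, and `log p ≤ p - 1`. -/
theorem polyEntropy_le_of_abs_sub_le (hN : N ≠ 0) {p : MvPolynomial (Fin N) ℝ}
    (hp : ∀ V, 0 < ev p V) (h1 : ∫ V, ev p V ∂(kacMeasure N) = 1) {ε : ℝ}
    (h : ∀ V W, |ev p V - ev p W| ≤ ε) : polyEntropy p ≤ ε := by
  have := isProbabilityMeasure_kacMeasure hN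
  have h2 : ∀ V, ev p V - 1 ≤ ε := fun V => by
    have h3 : ∫ W, (ev p V - ev p W) ∂(kacMeasure N) = ev p V - 1 := by
      rw [integral_sub (integrable_const _) (integrable_ev p), h1]
      simp
    rw [← h3]
    calc ∫ W, (ev p V - ev p W) ∂(kacMeasure N) ≤ ∫ _, ε ∂(kacMeasure N) :=
          integral_mono ((integrable_const _).sub (integrable_ev p)) (integrable_const _)
            fun W => (le_abs_self _).trans (h V W)
      _ = ε := by simp
  have h4 : ε = ∫ V, ev p V * ε ∂(kacMeasure N) := by rw [integral_mul_const, h1, one_mul]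
  rw [h4]
  refine integral_mono (integrable_ev_mul_log hp) ((integrable_ev p).mul_const _) fun V => ?_
  exact mul_le_mul_of_nonneg_left ((Real.log_le_sub_one_of_pos (hp V)).trans (h2 V)) (hp V).le

/-- Exponential decay of the gradient forces the oscillation, hence the entropy, to zero. The
dependence of this rate on `N` and on the initial datum is harmless, since only the limit is used.
-/
theorem IsHeatFlow.tendsto_polyEntropy {c : ℝ → MvPolynomial (Fin N) ℝ} (hc : IsHeatFlow c)
    (hN : 3 ≤ N) (h0 : ∀ V, 0 < ev (c 0) V) (h1 : ∫ V, ev (c 0) V ∂(kacMeasure N) = 1) :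
    Tendsto (fun t => polyEntropy (c t)) atTop (𝓝 0) := by
  have hcont : Continuous fun V : KacSphere N => ∑ a, ∑ b, ev (angular a b (c 0)) V ^ 2 :=
    continuous_finsetSum _ fun a _ => continuous_finsetSum _ fun b _ =>
      (KacModel.continuous_ev _).pow 2
  obtain ⟨K, hK⟩ := isCompact_univ.exists_bound_of_continuousOn hcont.continuousOn
  have hgrad : ∀ t, 0 ≤ t → ∀ a b V, |ev (angular a b (c t)) V| ≤
      Real.sqrt (K * Real.exp (-(1 / 12 * t))) := by
    intro t ht a b V
    refine Real.abs_le_sqrt (le_trans ?_ (hc.sum_sq_angular_le hN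
      (fun V => (le_abs_self _).trans (hK V (mem_univ V))) ht V))
    refine (Finset.single_le_sum (f := fun b => ev (angular a b (c t)) V ^ 2)
      (fun b _ => sq_nonneg _) (Finset.mem_univ b)).trans ?_
    exact Finset.single_le_sum (f := fun a => ∑ b, ev (angular a b (c t)) V ^ 2)
      (fun a _ => Finset.sum_nonneg fun b _ => sq_nonneg _) (Finset.mem_univ a)
  have hosc : ∀ t, 0 ≤ t → ∀ V W, |ev (c t) V - ev (c t) W| ≤
      2 * N * (Real.sqrt (K * Real.exp (-(1 / 12 * t))) * Real.pi) := by
    intro t ht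
    refine abs_sub_le_of_rot (by omega) ⟨0, by omega⟩ fun k hk θ V hθ => ?_
    have := Convex.norm_image_sub_le_of_norm_hasDerivWithin_le (s := univ) (x := θ) (y := 0)
      (fun s _ => (hasDerivAt_ev_rot _ k hk (c t) V s).hasDerivWithinAt)
      (fun s _ => hgrad t ht _ k _) convex_univ (mem_univ _) (mem_univ _)
    rw [rot_zero, zero_sub, norm_neg, Real.norm_eq_abs, Real.norm_eq_abs] at this
    exact this.trans (mul_le_mul_of_nonneg_left hθ (Real.sqrt_nonneg _))
  have hlim : Tendsto (fun t : ℝ => 2 * N * (Real.sqrt (K * Real.exp (-(1 / 12 * t))) * Real.pi))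
      atTop (𝓝 0) := by
    have h2 : Tendsto (fun t : ℝ => Real.exp (-(1 / 12 * t))) atTop (𝓝 0) :=
      Real.tendsto_exp_neg_atTop_nhds_zero.comp
        (tendsto_id.const_mul_atTop (by norm_num : (0 : ℝ) < 1 / 12))
    have h3 := ((Real.continuous_sqrt.tendsto _).comp (h2.const_mul K)).mul_const Real.pi
    have h4 := h3.const_mul (2 * N : ℝ)
    simpa using h4
  refine squeeze_zero' ?_ ?_ hlim
  · filter_upwards [eventually_ge_atTop 0] with t ht
    exact polyEntropy_nonneg (by omega) (hc.mem_posTime h0 ht)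
      ((hc.integral_eq (by omega) t).trans h1)
  · filter_upwards [eventually_ge_atTop 0] with t ht
    exact polyEntropy_le_of_abs_sub_le (by omega) (hc.mem_posTime h0 ht)
      ((hc.integral_eq (by omega) t).trans h1) (hosc t ht)

/-- The logarithmic Sobolev inequality along the flow. -/
theorem IsHeatFlow.polyEntropy_le_fisher {c : ℝ → MvPolynomial (Fin N) ℝ} (hc : IsHeatFlow c)
    (hN : 3 ≤ N) (h0 : ∀ V, 0 < ev (c 0) V) (h1 : ∫ V, ev (c 0) V ∂(kacMeasure N) = 1) {t : ℝ}
    (ht : 0 ≤ t) : polyEntropy (c t) ≤ 6 / (N : ℝ) * fisher (c t) := by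
  have hpos : ∀ s, 0 ≤ s → s ∈ posTime c := fun s hs => hc.mem_posTime h0 hs
  have hN' : (0 : ℝ) < N := by
    have : 0 < N := by omega
    exact_mod_cast this
  -- The factor `6 / N` balances the two dissipation rates: entropy loses `fisher / (2 N)` and
  -- Fisher information at least a twelfth of itself. So `Φ` is nondecreasing, and it is bounded
  -- above by the entropy, which tends to zero.
  set Φ : ℝ → ℝ := fun s => polyEntropy (c s) - 6 / (N : ℝ) * fisher (c s) with hΦ
  have hd : ∀ s, 0 ≤ s → ∃ d, HasDerivAt Φ d s ∧ 0 ≤ d := fun s hs => by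
    obtain ⟨J', hJ', hle⟩ := hc.exists_hasDerivAt_fisher hN (hpos s hs)
    refine ⟨_, (hc.hasDerivAt_entropy (by omega) (hpos s hs)).sub (hJ'.const_mul _), ?_⟩
    have h2 := mul_le_mul_of_nonneg_left hle (show 0 ≤ 6 / (N : ℝ) by positivity)
    have h3 : 6 / (N : ℝ) * -(1 / 12 * fisher (c s)) = -(1 / (2 * N : ℝ) * fisher (c s)) := by
      field_simp
      ring
    linarith
  have hmono : MonotoneOn Φ (Ici 0) := by
    refine monotoneOn_of_deriv_nonneg (convex_Ici 0) (fun s hs => ?_) (fun s hs => ?_)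
      fun s hs => ?_
    · obtain ⟨d, hd, -⟩ := hd s hs
      exact hd.continuousAt.continuousWithinAt
    · rw [interior_Ici] at hs
      obtain ⟨d, hd, -⟩ := hd s (le_of_lt hs)
      exact hd.differentiableAt.differentiableWithinAt
    · rw [interior_Ici] at hs
      obtain ⟨d, hd, h⟩ := hd s (le_of_lt hs)
      rwa [hd.deriv]
  have hle : Φ t ≤ 0 := by
    refine ge_of_tendsto (hc.tendsto_polyEntropy hN h0 h1) ?_
    filter_upwards [eventually_ge_atTop t] with s hs
    refine (hmono ht (mem_Ici.2 (ht.trans hs)) hs).trans ?_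
    have := mul_nonneg (show 0 ≤ 6 / (N : ℝ) by positivity)
      (fisher_nonneg (hpos s (ht.trans hs)))
    simp only [hΦ]
    linarith
  simp only [hΦ] at hle
  linarith

/-- By the logarithmic Sobolev inequality entropy decays at rate at least 1/12, so time 12 gains one
factor of e. -/
theorem IsHeatFlow.polyEntropy_le {c : ℝ → MvPolynomial (Fin N) ℝ} (hc : IsHeatFlow c)
    (hN : 3 ≤ N) (h0 : ∀ V, 0 < ev (c 0) V) (h1 : ∫ V, ev (c 0) V ∂(kacMeasure N) = 1) :
    polyEntropy (c 12) ≤ Real.exp (-1) * polyEntropy (c 0) := by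
  have hN' : (0 : ℝ) < N := by
    have : 0 < N := by omega
    exact_mod_cast this
  have hexp : ∀ t : ℝ, HasDerivAt (fun s => Real.exp (1 / 12 * s))
      (Real.exp (1 / 12 * t) * (1 / 12)) t := fun t => by
    simpa using ((hasDerivAt_id t).const_mul (1 / 12 : ℝ)).exp
  have hd : ∀ s, 0 ≤ s → ∃ d, HasDerivAt (fun s => Real.exp (1 / 12 * s) * polyEntropy (c s)) d s ∧
      d ≤ 0 := fun s hs => by
    refine ⟨_, (hexp s).fun_mul (hc.hasDerivAt_entropy (by omega) (hc.mem_posTime h0 hs)), ?_⟩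
    have h2 := hc.polyEntropy_le_fisher hN h0 h1 hs
    have h3 : Real.exp (1 / 12 * s) * (1 / 12) * polyEntropy (c s) ≤
        Real.exp (1 / 12 * s) * (1 / 12) * (6 / (N : ℝ) * fisher (c s)) :=
      mul_le_mul_of_nonneg_left h2 (by positivity)
    have h4 : Real.exp (1 / 12 * s) * (1 / 12) * (6 / (N : ℝ) * fisher (c s)) =
        Real.exp (1 / 12 * s) * (1 / (2 * N : ℝ) * fisher (c s)) := by
      field_simp
      ring
    change Real.exp (1 / 12 * s) * (1 / 12) * polyEntropy (c s) + _ ≤ 0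
    linarith
  have hanti : AntitoneOn (fun s => Real.exp (1 / 12 * s) * polyEntropy (c s)) (Ici 0) := by
    refine antitoneOn_of_deriv_nonpos (convex_Ici 0) (fun s hs => ?_) (fun s hs => ?_)
      fun s hs => ?_
    · obtain ⟨d, hd, -⟩ := hd s hs
      exact hd.continuousAt.continuousWithinAt
    · rw [interior_Ici] at hs
      obtain ⟨d, hd, -⟩ := hd s (le_of_lt hs)
      exact hd.differentiableAt.differentiableWithinAt
    · rw [interior_Ici] at hs
      obtain ⟨d, hd, h⟩ := hd s (le_of_lt hs)
      rwa [hd.deriv]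
  have h5 := hanti (mem_Ici.2 le_rfl) (mem_Ici.2 (by norm_num : (0 : ℝ) ≤ 12)) (by norm_num)
  simp only [mul_zero, Real.exp_zero, one_mul] at h5
  rw [show (1 / 12 * 12 : ℝ) = 1 by norm_num] at h5
  rw [Real.exp_neg, inv_mul_eq_div, le_div_iff₀ (Real.exp_pos _)]
  linarith

/-! ### The entropy production of a pair along the flow -/

/-- The product of Lebesgue measure on `[0, 2π]` and the uniform measure on the sphere. -/
abbrev angleMeasure (N : ℕ) : Measure (ℝ × KacSphere N) :=
  (volume.restrict (Icc 0 (2 * Real.pi))).prod (kacMeasure N)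

theorem ae_angleMeasure :
    ∀ᵐ q ∂(angleMeasure N), q ∈ Icc (0 : ℝ) (2 * Real.pi) ×ˢ (univ : Set (KacSphere N)) := by
  have h : ∀ᵐ q ∂(angleMeasure N), q.1 ∈ Icc (0 : ℝ) (2 * Real.pi) :=
    Measure.quasiMeasurePreserving_fst.ae (ae_restrict_mem measurableSet_Icc)
  filter_upwards [h] with q hq using ⟨hq, mem_univ _⟩

theorem integrable_angleMeasure {f : ℝ × KacSphere N → ℝ} (hf : Continuous f) :
    Integrable f (angleMeasure N) := by
  obtain ⟨C, hC⟩ := ((isCompact_Icc (a := (0 : ℝ)) (b := 2 * Real.pi)).prod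
    (isCompact_univ (X := KacSphere N))).exists_bound_of_continuousOn hf.continuousOn
  exact Integrable.of_bound hf.aestronglyMeasurable C (ae_angleMeasure.mono hC)

/-- The part of the entropy production due to the collisions of `i` and `j`. -/
def pairProduction (i j : Fin N) (hij : i ≠ j) (p : MvPolynomial (Fin N) ℝ) : ℝ :=
  ∫ q, ev (weight i j) q.2 * psiReal (ev p q.2) (ev p (rot i j hij q.1 q.2)) ∂(angleMeasure N)

theorem pairProduction_nonneg {i j : Fin N} {hij : i ≠ j} {p : MvPolynomial (Fin N) ℝ}
    (hp : ∀ V, 0 < ev p V) : 0 ≤ pairProduction i j hij p :=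
  integral_nonneg fun q => mul_nonneg (by rw [ev_weight]; positivity)
    (psiReal_nonneg (hp _) (hp _))

/-- The derivative of a periodic function has mean zero, so the cross term drops out of the expanded
square. -/
theorem sq_le_setIntegral_sq_sub {a : ℝ} {g G : ℝ → ℝ} (hg : Continuous g)
    (hG : ∀ θ, HasDerivAt G (g θ) θ) (hper : G (2 * Real.pi) = G 0) :
    2 * Real.pi * a ^ 2 ≤ ∫ θ in Icc (0 : ℝ) (2 * Real.pi), (a - g θ) ^ 2 := by
  have h2pi : (0 : ℝ) ≤ 2 * Real.pi := by positivity
  rw [integral_Icc_eq_integral_Ioc, ← intervalIntegral.integral_of_le h2pi]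
  have h0 : ∫ θ in (0 : ℝ)..2 * Real.pi, g θ = 0 := by
    rw [intervalIntegral.integral_eq_sub_of_hasDerivAt (fun θ _ => hG θ)
      (hg.intervalIntegrable _ _), hper, sub_self]
  have h1 : ∫ θ in (0 : ℝ)..2 * Real.pi, (a ^ 2 - 2 * a * g θ) = 2 * Real.pi * a ^ 2 := by
    have hi : IntervalIntegrable (fun θ => 2 * a * g θ) volume 0 (2 * Real.pi) :=
      (continuous_const.mul hg).intervalIntegrable _ _
    rw [intervalIntegral.integral_sub intervalIntegrable_const hi, intervalIntegral.integral_const_mul, h0]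
    simp
  rw [← h1]
  refine intervalIntegral.integral_mono_on h2pi
    ((continuous_const.sub (continuous_const.mul hg)).intervalIntegrable _ _)
    (((continuous_const.sub hg).pow 2).intervalIntegrable _ _) fun θ _ => ?_
  nlinarith [sq_nonneg (g θ)]

/-- With `V` fixed, `angular i j p / p` along the orbit is the derivative of the periodic function
`log p`, up to the sign `s` of the rotation. Both signs are needed in `le_integral_add_mul_sq_sub`.
-/
theorem integral_sq_div_le {i j : Fin N} (hij : i ≠ j) {p : MvPolynomial (Fin N) ℝ}
    (hp : ∀ V, 0 < ev p V) {s : ℝ} (hs : s = 1 ∨ s = -1) :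
    2 * Real.pi * ∫ V, ev (angular i j p) V ^ 2 / ev p V ∂(kacMeasure N) ≤
      ∫ θ in Icc (0 : ℝ) (2 * Real.pi), ∫ V, ev p V * (ev (angular i j p) V / ev p V -
        ev (angular i j p) (rot i j hij (s * θ) V) / ev p (rot i j hij (s * θ) V)) ^ 2
          ∂(kacMeasure N) := by
  have hp' : ∀ V, ev p V ≠ 0 := fun V => (hp V).ne'
  have cu : Continuous fun V : KacSphere N => ev (angular i j p) V / ev p V :=
    (continuous_ev _).div (continuous_ev _) hp'
  have cr : Continuous fun q : ℝ × KacSphere N => rot i j hij (s * q.1) q.2 :=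
    (continuous_rot i j hij).comp ((continuous_const.mul continuous_fst).prodMk continuous_snd)
  have hint : Integrable (fun q : ℝ × KacSphere N => ev p q.2 * (ev (angular i j p) q.2 / ev p q.2 -
      ev (angular i j p) (rot i j hij (s * q.1) q.2) / ev p (rot i j hij (s * q.1) q.2)) ^ 2)
      (angleMeasure N) :=
    integrable_angleMeasure (((continuous_ev p).comp continuous_snd).mul
      (((cu.comp continuous_snd).sub (cu.comp cr)).pow 2))
  rw [integral_integral_swap hint, ← integral_const_mul]
  refine integral_mono (integrable_of_continuous (continuous_const.mul
    (((continuous_ev _).pow 2).div (continuous_ev _) hp'))) hint.integral_prod_right fun V => ?_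
  simp only
  rw [integral_const_mul]
  have h1 := sq_le_setIntegral_sq_sub (a := ev (angular i j p) V / ev p V)
    (g := fun θ => ev (angular i j p) (rot i j hij (s * θ) V) / ev p (rot i j hij (s * θ) V))
    (G := fun θ => s * Real.log (ev p (rot i j hij (s * θ) V)))
    (cu.comp (cr.comp (Continuous.prodMk_left V))) (fun θ => ?_) ?_
  · have h2 := mul_le_mul_of_nonneg_left h1 (hp V).le
    refine le_trans (le_of_eq ?_) h2
    have := hp' V
    field_simp
  · have h3 := ((hasDerivAt_ev_rot i j hij p V (s * θ)).log (hp' _)).comp θ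
      ((hasDerivAt_id θ).const_mul s)
    have h4 := h3.const_mul s
    refine h4.congr_deriv ?_
    have hss : s * s = 1 := by rcases hs with rfl | rfl <;> norm_num
    linear_combination (ev (angular i j p) (rot i j hij (s * θ) V) /
      ev p (rot i j hij (s * θ) V)) * hss
  · have h5 : rot i j hij (s * (2 * Real.pi)) V = V := by
      rcases hs with rfl | rfl
      · rw [one_mul, rot_two_pi]
      · conv_lhs => rw [← rot_two_pi i j hij V]
        rw [rot_add, show -1 * (2 * Real.pi) + 2 * Real.pi = 0 by ring, rot_zero]
    simp only [h5, mul_zero, rot_zero]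

/-- The two summands of the factor are treated separately. Rotating the variable back turns the
second into the first with the opposite angle. -/
theorem le_integral_add_mul_sq_sub {i j : Fin N} (hij : i ≠ j) {p : MvPolynomial (Fin N) ℝ}
    (hp : ∀ V, 0 < ev p V) :
    4 * Real.pi * ∫ V, ev (angular i j p) V ^ 2 / ev p V ∂(kacMeasure N) ≤
      ∫ θ in Icc (0 : ℝ) (2 * Real.pi), ∫ V, (ev p V + ev p (rot i j hij θ V)) *
        (ev (angular i j p) V / ev p V -
        ev (angular i j p) (rot i j hij θ V) / ev p (rot i j hij θ V)) ^ 2 ∂(kacMeasure N) := by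
  have hp' : ∀ V, ev p V ≠ 0 := fun V => (hp V).ne'
  have cu : Continuous fun V : KacSphere N => ev (angular i j p) V / ev p V :=
    (continuous_ev _).div (continuous_ev _) hp'
  have crs : ∀ s : ℝ, Continuous fun q : ℝ × KacSphere N => rot i j hij (s * q.1) q.2 := fun s =>
    (continuous_rot i j hij).comp ((continuous_const.mul continuous_fst).prodMk continuous_snd)
  have hint : ∀ s : ℝ, Integrable (fun q : ℝ × KacSphere N => ev p q.2 *
      (ev (angular i j p) q.2 / ev p q.2 -
      ev (angular i j p) (rot i j hij (s * q.1) q.2) / ev p (rot i j hij (s * q.1) q.2)) ^ 2)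
      (angleMeasure N) := fun s =>
    integrable_angleMeasure (((continuous_ev p).comp continuous_snd).mul
      (((cu.comp continuous_snd).sub (cu.comp (crs s))).pow 2))
  have h1 := integral_sq_div_le hij hp (Or.inl rfl : (1 : ℝ) = 1 ∨ (1 : ℝ) = -1)
  have h2 := integral_sq_div_le hij hp (Or.inr rfl : (-1 : ℝ) = 1 ∨ (-1 : ℝ) = -1)
  have h3 : ∀ θ : ℝ, ∫ V, (ev p V + ev p (rot i j hij θ V)) *
        (ev (angular i j p) V / ev p V -
        ev (angular i j p) (rot i j hij θ V) / ev p (rot i j hij θ V)) ^ 2 ∂(kacMeasure N) =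
      (∫ V, ev p V * (ev (angular i j p) V / ev p V -
        ev (angular i j p) (rot i j hij (1 * θ) V) / ev p (rot i j hij (1 * θ) V)) ^ 2
          ∂(kacMeasure N)) +
      ∫ V, ev p V * (ev (angular i j p) V / ev p V -
        ev (angular i j p) (rot i j hij (-1 * θ) V) / ev p (rot i j hij (-1 * θ) V)) ^ 2
          ∂(kacMeasure N) := by
    intro θ
    have cr := continuous_rot_const i j hij θ
    have e1 := integral_comp_rot i j hij θ fun V => ev p V * (ev (angular i j p) V / ev p V -
        ev (angular i j p) (rot i j hij (-1 * θ) V) / ev p (rot i j hij (-1 * θ) V)) ^ 2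
    have e2 : ∀ V, rot i j hij (-1 * θ) (rot i j hij θ V) = V := fun V => by
      rw [rot_add, show -1 * θ + θ = 0 by ring, rot_zero]
    simp only [e2] at e1
    rw [← e1, one_mul, ← integral_add]
    · refine integral_congr_ae (Eventually.of_forall fun V => ?_)
      simp only
      ring
    · exact integrable_of_continuous ((continuous_ev p).mul ((cu.sub (cu.comp cr)).pow 2))
    · exact integrable_of_continuous (((continuous_ev p).comp cr).mul
        (((cu.comp cr).sub cu).pow 2))
  simp only [h3]
  rw [integral_add (hint 1).integral_prod_left (hint (-1)).integral_prod_left]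
  linarith

theorem continuous_comp_prodMk {g : ℝ × KacSphere N → ℝ} (hg : Continuous g)
    {r : ℝ × KacSphere N → KacSphere N} (hr : Continuous r) :
    Continuous fun q : ℝ × (ℝ × KacSphere N) => g (q.1, r q.2) :=
  hg.comp (continuous_fst.prodMk (hr.comp continuous_snd))

/-- The production may grow at rate 4, but pays with the Fisher information of its own plane. Summed
over pairs, these payments give the whole of `fisher`, with no loss in `N`. -/
theorem IsHeatFlow.exists_hasDerivAt_pairProduction {c : ℝ → MvPolynomial (Fin N) ℝ}
    (hc : IsHeatFlow c) (hN : 0 < N) {i j : Fin N} (hij : i ≠ j) {t : ℝ} (ht : t ∈ posTime c) :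
    ∃ S', HasDerivAt (fun s => pairProduction i j hij (c s)) S' t ∧
      S' ≤ 4 * pairProduction i j hij (c t) -
        4 * Real.pi * ∫ V, ev (angular i j (c t)) V ^ 2 / ev (c t) V ∂(kacMeasure N) := by
  have crot := continuous_rot i j hij (N := N)
  have c1 : ∀ T : MvPolynomial (Fin N) ℝ →ₗ[ℝ] MvPolynomial (Fin N) ℝ,
      Continuous fun q : ℝ × (ℝ × KacSphere N) => ev (T (c q.1)) q.2.2 := fun T =>
    (hc.continuous_ev T).comp (continuous_fst.prodMk (continuous_snd.comp continuous_snd))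
  have c2 : ∀ T : MvPolynomial (Fin N) ℝ →ₗ[ℝ] MvPolynomial (Fin N) ℝ,
      Continuous fun q : ℝ × (ℝ × KacSphere N) => ev (T (c q.1)) (rot i j hij q.2.1 q.2.2) :=
    fun T => by
      have h := continuous_comp_prodMk (hc.continuous_ev T) crot
      exact h
  have c1' : Continuous fun q : ℝ × (ℝ × KacSphere N) => ev (c q.1) q.2.2 := by
    simpa using c1 LinearMap.id
  have c2' : Continuous fun q : ℝ × (ℝ × KacSphere N) => ev (c q.1) (rot i j hij q.2.1 q.2.2) := by
    simpa using c2 LinearMap.id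
  have l1 : ContinuousOn (fun q : ℝ × (ℝ × KacSphere N) => Real.log (ev (c q.1) q.2.2))
      (posTime c ×ˢ univ) := c1'.continuousOn.log fun q hq => (hq.1 _).ne'
  have l2 : ContinuousOn
      (fun q : ℝ × (ℝ × KacSphere N) => Real.log (ev (c q.1) (rot i j hij q.2.1 q.2.2)))
      (posTime c ×ˢ univ) := c2'.continuousOn.log fun q hq => (hq.1 _).ne'
  have cw : Continuous fun q : ℝ × KacSphere N => ev (weight i j) q.2 :=
    (KacModel.continuous_ev _).comp continuous_snd
  have hcontf : ∀ s ∈ posTime c, Continuous fun q : ℝ × KacSphere N =>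
      ev (weight i j) q.2 * psiReal (ev (c s) q.2) (ev (c s) (rot i j hij q.1 q.2)) :=
    fun s hs => by
      have d1 : Continuous fun q : ℝ × KacSphere N => ev (c s) q.2 :=
        (KacModel.continuous_ev _).comp continuous_snd
      have d2 : Continuous fun q : ℝ × KacSphere N => ev (c s) (rot i j hij q.1 q.2) :=
        (KacModel.continuous_ev _).comp crot
      exact cw.mul ((d1.sub d2).mul ((d1.log fun q => (hs _).ne').sub (d2.log fun q => (hs _).ne')))
  have hf' : ContinuousOn (fun q : ℝ × (ℝ × KacSphere N) => ev (weight i j) q.2.2 *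
      ((Real.log (ev (c q.1) q.2.2) - Real.log (ev (c q.1) (rot i j hij q.2.1 q.2.2)) + 1 -
          ev (c q.1) (rot i j hij q.2.1 q.2.2) / ev (c q.1) q.2.2) * ev (lap (c q.1)) q.2.2 +
        (Real.log (ev (c q.1) (rot i j hij q.2.1 q.2.2)) - Real.log (ev (c q.1) q.2.2) + 1 -
          ev (c q.1) q.2.2 / ev (c q.1) (rot i j hij q.2.1 q.2.2)) *
          ev (lap (c q.1)) (rot i j hij q.2.1 q.2.2))) (posTime c ×ˢ univ) :=
    (cw.comp continuous_snd).continuousOn.mul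
      (((((l1.sub l2).add continuousOn_const).sub (c2'.continuousOn.div c1'.continuousOn
        fun q hq => (hq.1 _).ne')).mul (c1 lap).continuousOn).add
      ((((l2.sub l1).add continuousOn_const).sub (c1'.continuousOn.div c2'.continuousOn
        fun q hq => (hq.1 _).ne')).mul (c2 lap).continuousOn))
  have h := hasDerivAt_integral_of_continuousOn (μ := angleMeasure N)
    (isCompact_Icc.prod isCompact_univ) ae_angleMeasure (isOpen_posTime hc)
    (f := fun s q => ev (weight i j) q.2 *
      psiReal (ev (c s) q.2) (ev (c s) (rot i j hij q.1 q.2)))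
    (f' := fun s q => ev (weight i j) q.2 *
      ((Real.log (ev (c s) q.2) - Real.log (ev (c s) (rot i j hij q.1 q.2)) + 1 -
          ev (c s) (rot i j hij q.1 q.2) / ev (c s) q.2) * ev (lap (c s)) q.2 +
        (Real.log (ev (c s) (rot i j hij q.1 q.2)) - Real.log (ev (c s) q.2) + 1 -
          ev (c s) q.2 / ev (c s) (rot i j hij q.1 q.2)) *
          ev (lap (c s)) (rot i j hij q.1 q.2)))
    hcontf hf' (fun s hs q => ?_) ht
  · refine ⟨_, h, ?_⟩
    have i1 := integrable_angleMeasure (continuousOn_univ.1 (hf'.comp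
      (Continuous.prodMk_right t).continuousOn fun q _ => ⟨ht, mem_univ q⟩))
    simp only [Function.comp_def] at i1
    have i2 := integrable_angleMeasure (hcontf t ht)
    have d1 : Continuous fun q : ℝ × KacSphere N => ev (c t) q.2 :=
      (KacModel.continuous_ev _).comp continuous_snd
    have d2 : Continuous fun q : ℝ × KacSphere N => ev (c t) (rot i j hij q.1 q.2) :=
      (KacModel.continuous_ev _).comp crot
    have i3 : Integrable (fun q : ℝ × KacSphere N =>
        (ev (c t) q.2 + ev (c t) (rot i j hij q.1 q.2)) * (ev (angular i j (c t)) q.2 / ev (c t) q.2 -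
        ev (angular i j (c t)) (rot i j hij q.1 q.2) / ev (c t) (rot i j hij q.1 q.2)) ^ 2)
        (angleMeasure N) := integrable_angleMeasure ((d1.add d2).mul
          (((((KacModel.continuous_ev _).comp continuous_snd).div d1 fun q => (ht _).ne').sub
            (((KacModel.continuous_ev _).comp crot).div d2 fun q => (ht _).ne')).pow 2))
    refine le_trans ?_ (sub_le_sub_left (le_integral_add_mul_sq_sub hij ht) _)
    rw [integral_prod _ i1, pairProduction, integral_prod _ i2, ← integral_const_mul,
      ← integral_sub (i2.integral_prod_left.const_mul 4) i3.integral_prod_left]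
    refine integral_mono i1.integral_prod_left
      ((i2.integral_prod_left.const_mul 4).sub i3.integral_prod_left) fun θ => ?_
    -- At each fixed angle the rotated solution is itself a polynomial, and substitution commutes
    -- with `lap` and with the derivative of the same plane.
    have key := integral_weight_mul_psi_le hN hij ht
      (q := subst i j θ (c t)) (fun V => by rw [ev_subst i j hij]; exact ht _)
    simpa only [ev_subst i j hij, lap_subst hij, ev_angular_subst hij] using key
  · have h1 := hc.hasDerivAt_ev_self q.2 s
    have h2 := hc.hasDerivAt_ev_self (rot i j hij q.1 q.2) s
    have n1 := (hs q.2).ne'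
    have n2 := (hs (rot i j hij q.1 q.2)).ne'
    refine (((h1.fun_sub h2).fun_mul ((h1.log n1).fun_sub (h2.log n2))).const_mul _).congr_deriv ?_
    congr 1
    field_simp
    ring

theorem sum_sum_eq_two_mul_sum_lt {g : Fin N → Fin N → ℝ} (hs : ∀ a b, g a b = g b a)
    (h0 : ∀ a, g a a = 0) :
    ∑ a, ∑ b, g a b = 2 * ∑ p : {p : Fin N × Fin N // p.1 < p.2}, g p.1.1 p.1.2 := by
  have h1 : ∀ a b, g a b = (if a < b then g a b else 0) + (if b < a then g b a else 0) := by
    intro a b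
    rcases lt_trichotomy a b with h | rfl | h
    · simp [h, h.not_gt]
    · simp [h0]
    · simp [h, h.not_gt, hs a b]
  have h2 : ∑ a, ∑ b, (if a < b then g a b else 0) =
      ∑ p : {p : Fin N × Fin N // p.1 < p.2}, g p.1.1 p.1.2 := by
    rw [← Fintype.sum_prod_type' (f := fun a b => if a < b then g a b else 0),
      ← Finset.sum_filter]
    exact Finset.sum_subtype _ (by simp) fun p : Fin N × Fin N => g p.1 p.2
  calc ∑ a, ∑ b, g a b
      = ∑ a, ∑ b, (if a < b then g a b else 0) + ∑ a, ∑ b, (if b < a then g b a else 0) := by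
        rw [← Finset.sum_add_distrib]
        refine Finset.sum_congr rfl fun a _ => ?_
        rw [← Finset.sum_add_distrib]
        exact Finset.sum_congr rfl fun b _ => h1 a b
    _ = _ := by
        rw [Finset.sum_comm (f := fun a b => if b < a then g b a else 0), h2, two_mul]

theorem fisher_eq_two_mul_sum {p : MvPolynomial (Fin N) ℝ} (hp : ∀ V, 0 < ev p V) :
    fisher p = 2 * ∑ q : {q : Fin N × Fin N // q.1 < q.2},
      ∫ V, ev (angular q.1.1 q.1.2 p) V ^ 2 / ev p V ∂(kacMeasure N) := by
  have i1 : ∀ a b, Integrable (fun V => ev (angular a b p) V ^ 2 / ev p V) (kacMeasure N) :=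
    fun a b => integrable_of_continuous (((continuous_ev _).pow 2).div (continuous_ev _)
      fun V => (hp V).ne')
  rw [fisher, integral_finsetSum _ fun a _ => integrable_finsetSum _ fun b _ => i1 a b]
  simp only [integral_finsetSum _ fun b _ => i1 _ b]
  exact sum_sum_eq_two_mul_sum_lt
    (g := fun a b => ∫ V, ev (angular a b p) V ^ 2 / ev p V ∂(kacMeasure N))
    (fun a b => by simp only [angular_swap a b, ev_neg, neg_sq])
    fun a => by simp [angular_self]

/-- Entropy production bounds entropy for polynomial densities, three particles or more. -/
theorem polyEntropy_le_sum_pairProduction (hN : 3 ≤ N) {p : MvPolynomial (Fin N) ℝ}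
    (hp : ∀ V, 0 < ev p V) (h1 : ∫ V, ev p V ∂(kacMeasure N) = 1) :
    2 * Real.pi * N * Real.exp (-48) * polyEntropy p ≤
      ∑ q : {q : Fin N × Fin N // q.1 < q.2}, pairProduction q.1.1 q.1.2 q.2.ne p := by
  obtain ⟨c, hc, rfl⟩ := exists_isHeatFlow p
  have hN0 : 0 < N := by omega
  have hN' : (0 : ℝ) < N := by exact_mod_cast hN0
  have hpi := Real.pi_pos
  set S : ℝ → ℝ := fun t =>
    ∑ q : {q : Fin N × Fin N // q.1 < q.2}, pairProduction q.1.1 q.1.2 q.2.ne (c t) with hS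
  have hdS : ∀ t, 0 ≤ t → ∃ S', HasDerivAt S S' t ∧
      S' ≤ 4 * S t - 2 * Real.pi * fisher (c t) := fun t ht => by
    have hpos := hc.mem_posTime hp ht
    choose S' hS' hle using fun q : {q : Fin N × Fin N // q.1 < q.2} =>
      hc.exists_hasDerivAt_pairProduction hN0 q.2.ne hpos
    refine ⟨∑ q, S' q, HasDerivAt.fun_sum fun q _ => hS' q, ?_⟩
    refine (Finset.sum_le_sum fun q _ => hle q).trans (le_of_eq ?_)
    rw [fisher_eq_two_mul_sum hpos, Finset.sum_sub_distrib, ← Finset.mul_sum, ← Finset.mul_sum]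
    ring
  have hexp : ∀ t : ℝ, HasDerivAt (fun s => Real.exp (-4 * s)) (Real.exp (-4 * t) * (-4)) t :=
    fun t => by simpa using ((hasDerivAt_id t).const_mul (-4 : ℝ)).exp
  -- The derivative of `Ψ` is at most `-2π (exp (-4 t) - exp (-48)) fisher`, nonpositive up to time
  -- 12. Comparing both ends, and using that the entropy has at least halved, leaves half of the
  -- factor `4 π N exp (-48)`.
  set Ψ : ℝ → ℝ := fun t => Real.exp (-4 * t) * S t -
    4 * Real.pi * N * Real.exp (-48) * polyEntropy (c t) with hΨ
  have hd : ∀ t ∈ Icc (0 : ℝ) 12, ∃ d, HasDerivAt Ψ d t ∧ d ≤ 0 := fun t ht => by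
    obtain ⟨S', hS', hle⟩ := hdS t ht.1
    have hpos := hc.mem_posTime hp ht.1
    refine ⟨_, ((hexp t).fun_mul hS').fun_sub ((hc.hasDerivAt_entropy hN0 hpos).const_mul _), ?_⟩
    have e1 := mul_le_mul_of_nonneg_left hle (Real.exp_pos (-4 * t)).le
    have e2 : 4 * Real.pi * N * Real.exp (-48) * -(1 / (2 * N : ℝ) * fisher (c t)) =
        -(Real.exp (-48) * (2 * Real.pi * fisher (c t))) := by
      field_simp
      ring
    have e3 : Real.exp (-48) * (2 * Real.pi * fisher (c t)) ≤
        Real.exp (-4 * t) * (2 * Real.pi * fisher (c t)) :=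
      mul_le_mul_of_nonneg_right (Real.exp_le_exp.2 (by linarith [ht.2]))
        (mul_nonneg (by positivity) (fisher_nonneg hpos))
    rw [e2]
    linarith
  have hanti : AntitoneOn Ψ (Icc 0 12) := by
    refine antitoneOn_of_deriv_nonpos (convex_Icc 0 12) (fun s hs => ?_) (fun s hs => ?_)
      fun s hs => ?_
    · obtain ⟨d, hd, -⟩ := hd s hs
      exact hd.continuousAt.continuousWithinAt
    · obtain ⟨d, hd, -⟩ := hd s (interior_subset hs)
      exact hd.differentiableAt.differentiableWithinAt
    · obtain ⟨d, hd, h⟩ := hd s (interior_subset hs)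
      rwa [hd.deriv]
  have h2 : Ψ 12 ≤ Ψ 0 := hanti (left_mem_Icc.2 (by norm_num)) (right_mem_Icc.2 (by norm_num))
    (by norm_num)
  simp only [hΨ, mul_zero, Real.exp_zero, one_mul] at h2
  have h3 : 0 ≤ Real.exp (-4 * 12) * S 12 := mul_nonneg (Real.exp_pos _).le
    (Finset.sum_nonneg fun q _ => pairProduction_nonneg (hc.mem_posTime hp (by norm_num)))
  have h4 := hc.polyEntropy_le hN hp h1
  have h5 := polyEntropy_nonneg (by omega) hp h1
  have h6 : Real.exp (-1) ≤ 1 / 2 := by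
    rw [Real.exp_neg, ← one_div]
    exact one_div_le_one_div_of_le (by norm_num) (by linarith [Real.add_one_le_exp (1 : ℝ)])
  have h7 : polyEntropy (c 12) ≤ 1 / 2 * polyEntropy (c 0) :=
    h4.trans (mul_le_mul_of_nonneg_right h6 h5)
  have h8 := mul_le_mul_of_nonneg_left h7
    (show 0 ≤ 4 * Real.pi * N * Real.exp (-48) by positivity)
  have h9 : S 0 = ∑ q : {q : Fin N × Fin N // q.1 < q.2},
    pairProduction q.1.1 q.1.2 q.2.ne (c 0) := rfl
  rw [← h9]
  linarith

/-! ### The circle: two particles -/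

/-- On the circle, the average over all rotations is the average over the circle. -/
theorem setIntegral_rot_circle {g : KacSphere 2 → ℝ} (hg : Continuous g) (h01 : (0 : Fin 2) ≠ 1)
    (V : KacSphere 2) :
    ∫ θ in Icc (0 : ℝ) (2 * Real.pi), g (rot 0 1 h01 θ V) =
      2 * Real.pi * ∫ W, g W ∂(kacMeasure 2) := by
  have := isProbabilityMeasure_kacMeasure (N := 2) two_ne_zero
  have h2pi : (0 : ℝ) ≤ 2 * Real.pi := by positivity
  set I : KacSphere 2 → ℝ := fun V => ∫ θ in Icc (0 : ℝ) (2 * Real.pi), g (rot 0 1 h01 θ V)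
    with hI
  have hrot : ∀ φ V, I (rot 0 1 h01 φ V) = I V := by
    intro φ V
    have hper : Function.Periodic (fun θ => g (rot 0 1 h01 θ V)) (2 * Real.pi) := fun θ => by
      simp only
      rw [← rot_add, rot_two_pi]
    simp only [hI, rot_add, integral_Icc_eq_integral_Ioc, ← intervalIntegral.integral_of_le h2pi]
    rw [intervalIntegral.integral_comp_add_right (fun θ => g (rot 0 1 h01 θ V)) φ, zero_add,
      add_comm, hper.intervalIntegral_add_eq φ 0, zero_add]
  -- `abs_sub_le_of_rot` with `ε = 0`: a rotation-invariant function on the circle is constant.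
  have hconst : ∀ V W, I V = I W := fun V W => by
    have := abs_sub_le_of_rot (f := I) (ε := 0) le_rfl (0 : Fin 2) (fun k hk θ V _ => by
      have hk1 : k = 1 := by omega
      subst hk1
      rw [hrot, sub_self, abs_zero]) V W
    rw [mul_zero] at this
    exact sub_eq_zero.1 (abs_nonpos_iff.1 this)
  have hint : Integrable (fun q : ℝ × KacSphere 2 => g (rot 0 1 h01 q.1 q.2)) (angleMeasure 2) :=
    integrable_angleMeasure (hg.comp (continuous_rot _ _ _))
  calc I V = ∫ _, I V ∂(kacMeasure 2) := by simp
    _ = ∫ W, I W ∂(kacMeasure 2) := integral_congr_ae (Eventually.of_forall fun W => hconst V W)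
    _ = ∫ θ in Icc (0 : ℝ) (2 * Real.pi), ∫ W, g (rot 0 1 h01 θ W) ∂(kacMeasure 2) :=
        (integral_integral_swap hint).symm
    _ = _ := by
        simp only [integral_comp_rot]
        simp [h2pi]

/-- The curvature bound is void for `N = 2`, but here a rotated point is independent of the original
one on average. Expanding ψ, the diagonal terms give entropy, and the cross terms give the mean of
`log p`, which is nonpositive. -/
theorem polyEntropy_le_pairProduction_circle {p : MvPolynomial (Fin 2) ℝ} (hp : ∀ V, 0 < ev p V)
    (h1 : ∫ V, ev p V ∂(kacMeasure 2) = 1) (h01 : (0 : Fin 2) ≠ 1) :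
    4 * Real.pi * polyEntropy p ≤ pairProduction 0 1 h01 p := by
  have := isProbabilityMeasure_kacMeasure (N := 2) two_ne_zero
  have h2pi : (0 : ℝ) ≤ 2 * Real.pi := by positivity
  have hp' : ∀ V, ev p V ≠ 0 := fun V => (hp V).ne'
  have cp := continuous_ev p
  have cl : Continuous fun V => Real.log (ev p V) := cp.log hp'
  have cr := continuous_rot (N := 2) 0 1 h01
  have i1 : Integrable (fun q : ℝ × KacSphere 2 => ev p q.2 * Real.log (ev p q.2))
      (angleMeasure 2) := integrable_angleMeasure ((cp.mul cl).comp continuous_snd)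
  have i2 : Integrable (fun q : ℝ × KacSphere 2 => ev p (rot 0 1 h01 q.1 q.2) *
      Real.log (ev p (rot 0 1 h01 q.1 q.2))) (angleMeasure 2) :=
    integrable_angleMeasure ((cp.mul cl).comp cr)
  have i3 : Integrable (fun q : ℝ × KacSphere 2 => ev p q.2 *
      Real.log (ev p (rot 0 1 h01 q.1 q.2))) (angleMeasure 2) :=
    integrable_angleMeasure ((cp.comp continuous_snd).mul (cl.comp cr))
  have i4 : Integrable (fun q : ℝ × KacSphere 2 => ev p (rot 0 1 h01 q.1 q.2) *
      Real.log (ev p q.2)) (angleMeasure 2) :=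
    integrable_angleMeasure ((cp.comp cr).mul (cl.comp continuous_snd))
  have e1 : ∫ q : ℝ × KacSphere 2, ev p q.2 * Real.log (ev p q.2) ∂(angleMeasure 2) =
      2 * Real.pi * polyEntropy p := by
    rw [integral_prod _ i1]
    simp [polyEntropy, h2pi]
  have e2 : ∫ q : ℝ × KacSphere 2, ev p (rot 0 1 h01 q.1 q.2) *
      Real.log (ev p (rot 0 1 h01 q.1 q.2)) ∂(angleMeasure 2) = 2 * Real.pi * polyEntropy p := by
    rw [integral_prod _ i2]
    simp only [integral_comp_rot 0 1 h01 _ fun V => ev p V * Real.log (ev p V)]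
    simp [polyEntropy, h2pi]
  have e3 : ∫ q : ℝ × KacSphere 2, ev p q.2 * Real.log (ev p (rot 0 1 h01 q.1 q.2))
      ∂(angleMeasure 2) = 2 * Real.pi * ∫ W, Real.log (ev p W) ∂(kacMeasure 2) := by
    rw [integral_prod_symm _ i3]
    simp only [integral_const_mul, setIntegral_rot_circle cl h01]
    rw [integral_mul_const, h1, one_mul]
  have e4 : ∫ q : ℝ × KacSphere 2, ev p (rot 0 1 h01 q.1 q.2) * Real.log (ev p q.2)
      ∂(angleMeasure 2) = 2 * Real.pi * ∫ W, Real.log (ev p W) ∂(kacMeasure 2) := by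
    rw [integral_prod_symm _ i4]
    simp only [integral_mul_const, setIntegral_rot_circle cp h01, h1]
    rw [integral_const_mul, mul_one]
  have hlog : ∫ W, Real.log (ev p W) ∂(kacMeasure 2) ≤ 0 := by
    have h2 : ∫ V, (ev p V - 1) ∂(kacMeasure 2) = 0 := by
      rw [integral_sub (integrable_ev p) (integrable_const _), h1]
      simp
    rw [← h2]
    exact integral_mono (integrable_of_continuous cl) ((integrable_ev p).sub (integrable_const _))
      fun V => Real.log_le_sub_one_of_pos (hp V)
  have e5 : ∫ q : ℝ × KacSphere 2, psiReal (ev p q.2) (ev p (rot 0 1 h01 q.1 q.2))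
      ∂(angleMeasure 2) = 4 * Real.pi * polyEntropy p -
        4 * Real.pi * ∫ W, Real.log (ev p W) ∂(kacMeasure 2) := by
    have e6 : ∀ q : ℝ × KacSphere 2, psiReal (ev p q.2) (ev p (rot 0 1 h01 q.1 q.2)) =
        (ev p q.2 * Real.log (ev p q.2) + ev p (rot 0 1 h01 q.1 q.2) *
          Real.log (ev p (rot 0 1 h01 q.1 q.2))) -
        (ev p q.2 * Real.log (ev p (rot 0 1 h01 q.1 q.2)) +
          ev p (rot 0 1 h01 q.1 q.2) * Real.log (ev p q.2)) := fun q => by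
      rw [psiReal]
      ring
    simp only [e6]
    refine (integral_sub (i1.add i2) (i3.add i4)).trans ?_
    rw [integral_add' i1 i2, integral_add' i3 i4, e1, e2, e3, e4]
    ring
  have cpsi : Continuous fun q : ℝ × KacSphere 2 =>
      psiReal (ev p q.2) (ev p (rot 0 1 h01 q.1 q.2)) :=
    ((cp.comp continuous_snd).sub (cp.comp cr)).mul ((cl.comp continuous_snd).sub (cl.comp cr))
  have hle : ∫ q : ℝ × KacSphere 2, psiReal (ev p q.2) (ev p (rot 0 1 h01 q.1 q.2))
      ∂(angleMeasure 2) ≤ pairProduction 0 1 h01 p := by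
    refine integral_mono (integrable_angleMeasure cpsi) (integrable_angleMeasure
      (((continuous_ev _).comp continuous_snd).mul cpsi)) fun q => ?_
    refine le_mul_of_one_le_left (psiReal_nonneg (hp _) (hp _)) ?_
    rw [ev_weight]
    nlinarith [sq_nonneg (q.2.1 0), sq_nonneg (q.2.1 1)]
  rw [e5] at hle
  nlinarith [Real.pi_pos]

theorem polyEntropy_le_sum_pairProduction_of_two_le (hN : 2 ≤ N) {p : MvPolynomial (Fin N) ℝ}
    (hp : ∀ V, 0 < ev p V) (h1 : ∫ V, ev p V ∂(kacMeasure N) = 1) :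
    2 * Real.pi * N * Real.exp (-48) * polyEntropy p ≤
      ∑ q : {q : Fin N × Fin N // q.1 < q.2}, pairProduction q.1.1 q.1.2 q.2.ne p := by
  rcases hN.eq_or_lt with rfl | hN
  · have h01 : (0 : Fin 2) < 1 := by decide
    have h2 := polyEntropy_le_pairProduction_circle hp h1 h01.ne
    have h3 := Finset.single_le_sum (f := fun q : {q : Fin 2 × Fin 2 // q.1 < q.2} =>
        pairProduction q.1.1 q.1.2 q.2.ne p) (fun q _ => pairProduction_nonneg hp)
        (Finset.mem_univ (⟨(0, 1), h01⟩ : {q : Fin 2 × Fin 2 // q.1 < q.2}))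
    have h3' := h2.trans h3
    have h4 := polyEntropy_nonneg two_ne_zero hp h1
    have h5 : Real.exp (-48) ≤ 1 := Real.exp_le_one_iff.2 (by norm_num)
    have h6 := mul_le_mul_of_nonneg_right h5
      (show 0 ≤ 4 * Real.pi * polyEntropy p by positivity)
    refine le_trans ?_ h3'
    push_cast
    linarith
  · exact polyEntropy_le_sum_pairProduction hN hp h1

/-! ### The linear bound for polynomial densities -/

theorem psi_eq_ofReal_psiReal {x y : ℝ} (hx : 0 < x) (hy : 0 < y) :
    psi x y = ENNReal.ofReal (psiReal x y) := by
  rw [psi, psiReal, Real.log_div hx.ne' hy.ne']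
  split_ifs with h1 h2
  · simp [h1]
  · exact absurd h2 (by simp [hx.ne', hy.ne'])
  · rfl

theorem lintegral_weight_mul_psi_ev {i j : Fin N} (hij : i ≠ j) {p : MvPolynomial (Fin N) ℝ}
    (hp : ∀ V, 0 < ev p V) :
    ∫⁻ V, ∫⁻ θ in Icc (0 : ℝ) (2 * Real.pi), ENNReal.ofReal ((1 + (V.1 i ^ 2 + V.1 j ^ 2)) ^ (1 : ℝ)) *
      psi (ev p V) (ev p (rot i j hij θ V)) ∂volume ∂(kacMeasure N) =
    ENNReal.ofReal (pairProduction i j hij p) := by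
  have cp := continuous_ev p
  have cl : Continuous fun V => Real.log (ev p V) := cp.log fun V => (hp V).ne'
  have cr := continuous_rot (N := N) i j hij
  have hcont : Continuous fun q : ℝ × KacSphere N =>
      ev (weight i j) q.2 * psiReal (ev p q.2) (ev p (rot i j hij q.1 q.2)) :=
    ((continuous_ev _).comp continuous_snd).mul
      (((cp.comp continuous_snd).sub (cp.comp cr)).mul ((cl.comp continuous_snd).sub (cl.comp cr)))
  have hm : AEMeasurable (fun q : ℝ × KacSphere N => ENNReal.ofReal
      (ev (weight i j) q.2 * psiReal (ev p q.2) (ev p (rot i j hij q.1 q.2)))) (angleMeasure N) :=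
    hcont.measurable.ennreal_ofReal.aemeasurable
  rw [pairProduction, ofReal_integral_eq_lintegral_ofReal (integrable_angleMeasure hcont)
    (Eventually.of_forall fun q => mul_nonneg (by rw [ev_weight]; positivity)
      (psiReal_nonneg (hp _) (hp _))),
    lintegral_prod_symm _ hm]
  refine lintegral_congr fun V => lintegral_congr fun θ => ?_
  rw [Real.rpow_one, psi_eq_ofReal_psiReal (hp _) (hp _), ← ENNReal.ofReal_mul (by positivity),
    ev_weight]

/-- Cercignani's conjecture with quadratic weight, for polynomial densities. -/
theorem ofReal_polyEntropy_le_entropyProduction (hN : 2 ≤ N) {p : MvPolynomial (Fin N) ℝ}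
    (hp : ∀ V, 0 < ev p V) (h1 : ∫ V, ev p V ∂(kacMeasure N) = 1) :
    ENNReal.ofReal (Real.exp (-48) * polyEntropy p) ≤ entropyProduction 1 (ev p) := by
  have h2 := polyEntropy_le_sum_pairProduction_of_two_le hN hp h1
  have h3 := polyEntropy_nonneg (by omega) hp h1
  have hN' : (2 : ℝ) ≤ N := by exact_mod_cast hN
  rw [entropyProduction]
  simp only [lintegral_weight_mul_psi_ev _ hp]
  rw [← ENNReal.ofReal_sum_of_nonneg fun q _ => pairProduction_nonneg hp,
    ← ENNReal.ofReal_mul (by positivity)]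
  refine ENNReal.ofReal_le_ofReal ?_
  have hpi := Real.pi_pos
  -- Against the factor `2 π N` of the bound on the sum this leaves `N / (N - 1) ≥ 1`.
  have h4 : (1 : ℝ) / (4 * Real.pi) * (N / (N.choose 2 : ℝ)) = 1 / (2 * Real.pi * (N - 1)) := by
    rw [Nat.cast_choose_two]
    have : (N : ℝ) - 1 ≠ 0 := by linarith
    field_simp
    ring
  rw [h4]
  have h5 := mul_le_mul_of_nonneg_left h2
    (show (0 : ℝ) ≤ 1 / (2 * Real.pi * (N - 1)) by
      have : (0 : ℝ) < N - 1 := by linarith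
      positivity)
  refine le_trans ?_ h5
  have h6 : 1 / (2 * Real.pi * (N - 1)) * (2 * Real.pi * N * Real.exp (-48) * polyEntropy p) =
      (N / (N - 1) : ℝ) * (Real.exp (-48) * polyEntropy p) := by
    have : (N : ℝ) - 1 ≠ 0 := by linarith
    field_simp
  rw [h6]
  refine le_mul_of_one_le_left (by positivity) ?_
  rw [le_div_iff₀ (by linarith)]
  linarith

/-! ### Smoothing by polynomial kernels -/

/-- The base of the smoothing kernel on Kac's sphere. -/
def corr (V W : KacSphere N) : ℝ := 2 + inner ℝ V.1 W.1 / N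

theorem corr_comm (V W : KacSphere N) : corr V W = corr W V := by
  rw [corr, corr, real_inner_comm]

theorem norm_sq_kacSphere (V : KacSphere N) : ‖V.1‖ ^ 2 = N := by
  rw [mem_sphere_zero_iff_norm.1 V.2, Real.sq_sqrt (Nat.cast_nonneg N)]

theorem norm_sub_sq_kacSphere (V W : KacSphere N) :
    ‖V.1 - W.1‖ ^ 2 = 2 * N - 2 * inner ℝ V.1 W.1 := by
  rw [norm_sub_sq_real, norm_sq_kacSphere, norm_sq_kacSphere]
  ring

/-- The constant 2 in `corr` is there for this bound: every power is at least 1, so a smoothed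
density is strictly positive. -/
theorem one_le_corr (V W : KacSphere N) : 1 ≤ corr V W := by
  have h1 : -(N : ℝ) ≤ inner ℝ V.1 W.1 := by
    have := sq_nonneg ‖V.1 + W.1‖
    rw [norm_add_sq_real, norm_sq_kacSphere, norm_sq_kacSphere] at this
    linarith
  have h2 : -1 ≤ inner ℝ V.1 W.1 / (N : ℝ) := by
    rcases Nat.eq_zero_or_pos N with rfl | hN
    · simp
    · rw [le_div_iff₀ (by exact_mod_cast hN)]
      linarith
  rw [corr]
  linarith

theorem corr_pos (V W : KacSphere N) : 0 < corr V W := zero_lt_one.trans_le (one_le_corr V W)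

theorem corr_isoMap (e : EuclideanSpace ℝ (Fin N) ≃ₗᵢ[ℝ] EuclideanSpace ℝ (Fin N))
    (V W : KacSphere N) : corr (isoMap e V) (isoMap e W) = corr V W := by
  simp only [corr, isoMap, e.inner_map_map]

theorem corr_rot {i j : Fin N} (hij : i ≠ j) (θ : ℝ) (V W : KacSphere N) :
    corr (rot i j hij θ V) (rot i j hij θ W) = corr V W :=
  corr_isoMap (rotIso i j hij θ) V W

theorem corr_lt_corr_self (hN : 0 < N) {V W : KacSphere N} (h : W ≠ V) :
    corr V W < corr V V := by
  have h1 : 0 < ‖V.1 - W.1‖ ^ 2 := by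
    have : V.1 - W.1 ≠ 0 := sub_ne_zero.2 fun e => h (Subtype.ext e.symm)
    positivity
  rw [norm_sub_sq_kacSphere] at h1
  have hN' : (0 : ℝ) < N := by exact_mod_cast hN
  rw [corr, corr, real_inner_self_eq_norm_sq, norm_sq_kacSphere]
  gcongr
  linarith

theorem continuous_corr : Continuous fun q : KacSphere N × KacSphere N => corr q.1 q.2 :=
  continuous_const.add (((continuous_subtype_val.comp continuous_fst).inner
    (continuous_subtype_val.comp continuous_snd)).div_const _)

theorem continuous_corr_right (V : KacSphere N) : Continuous (corr V) :=
  continuous_corr.comp (Continuous.prodMk_right V)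

theorem exists_bound_corr_pow (m : ℕ) : ∃ C, ∀ V W : KacSphere N, ‖corr V W ^ m‖ ≤ C := by
  obtain ⟨C, hC⟩ := isCompact_univ.exists_bound_of_continuousOn
    ((continuous_corr (N := N)).pow m).continuousOn
  exact ⟨C, fun V W => hC (V, W) (mem_univ _)⟩

theorem integrable_corr_pow_mul (m : ℕ) (V : KacSphere N) {g : KacSphere N → ℝ}
    (hg : Integrable g (kacMeasure N)) :
    Integrable (fun W => corr V W ^ m * g W) (kacMeasure N) := by
  obtain ⟨C, hC⟩ := exists_bound_corr_pow (N := N) m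
  exact hg.bdd_mul ((continuous_corr_right V).pow m).aestronglyMeasurable
    (Eventually.of_forall fun W => hC V W)

theorem integrable_prod_corr_pow_mul (m : ℕ) {g : KacSphere N → ℝ}
    (hg : Integrable g (kacMeasure N)) :
    Integrable (fun q : KacSphere N × KacSphere N => corr q.1 q.2 ^ m * g q.2)
      ((kacMeasure N).prod (kacMeasure N)) := by
  obtain ⟨C, hC⟩ := exists_bound_corr_pow (N := N) m
  exact (hg.comp_snd _).bdd_mul (continuous_corr.pow m).aestronglyMeasurable
    (Eventually.of_forall fun q => hC q.1 q.2)

/-- The normalisation of the smoothing kernel. -/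
def corrMass (N m : ℕ) (V : KacSphere N) : ℝ := ∫ W, corr V W ^ m ∂(kacMeasure N)

/-- By transitivity of the isometries. The normalised kernel is therefore symmetric, and smoothing
preserves integrals. -/
theorem corrMass_eq (m : ℕ) (V V' : KacSphere N) : corrMass N m V = corrMass N m V' := by
  obtain ⟨e, rfl⟩ := exists_isoMap_eq V V'
  rw [corrMass, corrMass, ← integral_comp_isoMap e fun W => corr (isoMap e V) W ^ m]
  simp only [corr_isoMap]

theorem corrMass_pos (hN : N ≠ 0) (m : ℕ) (V : KacSphere N) : 0 < corrMass N m V := by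
  have := isProbabilityMeasure_kacMeasure hN
  have h : ∫ _, (1 : ℝ) ∂(kacMeasure N) ≤ corrMass N m V :=
    integral_mono (integrable_const _)
      (integrable_of_continuous ((continuous_corr_right V).pow m)) fun W => one_le_pow₀ (one_le_corr V W)
  simp only [integral_const, probReal_univ, one_smul] at h
  linarith

/-- Averaging against the smoothing kernel. -/
def smooth (m : ℕ) (g : KacSphere N → ℝ) (V : KacSphere N) : ℝ :=
  (corrMass N m V)⁻¹ * ∫ W, corr V W ^ m * g W ∂(kacMeasure N)

/-- One factor of the kernel is affine in `V`, with the coordinates of `W` as coefficients; these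
are absorbed into `g`, which is why the induction runs over all integrable `g`. -/
theorem exists_ev_eq_integral_corr (m : ℕ) {g : KacSphere N → ℝ}
    (hg : Integrable g (kacMeasure N)) :
    ∃ p : MvPolynomial (Fin N) ℝ, ∀ V, ev p V = ∫ W, corr V W ^ m * g W ∂(kacMeasure N) := by
  induction m generalizing g with
  | zero => exact ⟨C (∫ W, g W ∂(kacMeasure N)), fun V => by simp⟩
  | succ m ih =>
    have hl : ∀ l, Integrable (fun W : KacSphere N => W.1 l * g W) (kacMeasure N) := fun l => by
      obtain ⟨B, hB⟩ := isCompact_univ.exists_bound_of_continuousOn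
        (continuous_coord (N := N) l).continuousOn
      exact hg.bdd_mul (continuous_coord l).aestronglyMeasurable
        (Eventually.of_forall fun W => hB W (mem_univ W))
    obtain ⟨p, hp⟩ := ih hg
    choose q hq using fun l => ih (hl l)
    refine ⟨(2 : ℝ) • p + ∑ l, (1 / (N : ℝ)) • (X l * q l), fun V => ?_⟩
    have h1 : ∀ W, corr V W ^ (m + 1) * g W = 2 * (corr V W ^ m * g W) +
        ∑ l, 1 / (N : ℝ) * V.1 l * (corr V W ^ m * (W.1 l * g W)) := by
      intro W
      have h2 : inner ℝ V.1 W.1 = ∑ l, V.1 l * W.1 l := by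
        simp [PiLp.inner_apply, mul_comm]
      have h3 : ∑ l, 1 / (N : ℝ) * V.1 l * (corr V W ^ m * (W.1 l * g W)) =
          corr V W ^ m * g W * (inner ℝ V.1 W.1 / N) := by
        rw [h2, Finset.sum_div, Finset.mul_sum]
        exact Finset.sum_congr rfl fun l _ => by ring
      rw [h3, pow_succ]
      nth_rewrite 2 [corr]
      ring
    simp only [h1]
    rw [integral_add ((integrable_corr_pow_mul m V hg).const_mul 2)
      (integrable_finsetSum _ fun l _ => (integrable_corr_pow_mul m V (hl l)).const_mul _),
      integral_finsetSum _ fun l _ => (integrable_corr_pow_mul m V (hl l)).const_mul _]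
    simp only [integral_const_mul, ev_add, ev_smul, ev_sum, ev_mul, ev_X, hp, hq]
    congr 1
    exact Finset.sum_congr rfl fun l _ => by ring

theorem exists_ev_eq_smooth (m : ℕ) {g : KacSphere N → ℝ} (hg : Integrable g (kacMeasure N)) :
    ∃ p : MvPolynomial (Fin N) ℝ, ∀ V, ev p V = smooth m g V := by
  obtain ⟨p, hp⟩ := exists_ev_eq_integral_corr m hg
  rcases isEmpty_or_nonempty (KacSphere N) with h | ⟨⟨V₀⟩⟩
  · exact ⟨0, fun V => (h.false V).elim⟩
  · exact ⟨(corrMass N m V₀)⁻¹ • p, fun V => by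
      rw [ev_smul, hp, smooth, corrMass_eq m V V₀]⟩

theorem continuous_smooth (m : ℕ) {g : KacSphere N → ℝ} (hg : Integrable g (kacMeasure N)) :
    Continuous (smooth m g) := by
  obtain ⟨p, hp⟩ := exists_ev_eq_smooth m hg
  rw [← funext hp]
  exact continuous_ev p

theorem smooth_pos (hN : N ≠ 0) (m : ℕ) {g : KacSphere N → ℝ} (hg : Integrable g (kacMeasure N))
    (h0 : ∀ V, 0 ≤ g V) (h1 : ∫ V, g V ∂(kacMeasure N) = 1) (V : KacSphere N) :
    0 < smooth m g V := by
  refine mul_pos (inv_pos.2 (corrMass_pos hN m V)) ?_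
  have h2 : ∫ W, g W ∂(kacMeasure N) ≤ ∫ W, corr V W ^ m * g W ∂(kacMeasure N) :=
    integral_mono hg (integrable_corr_pow_mul m V hg) fun W =>
      le_mul_of_one_le_left (h0 W) (one_le_pow₀ (one_le_corr V W))
  linarith

theorem integral_smooth (hN : N ≠ 0) (m : ℕ) {g : KacSphere N → ℝ}
    (hg : Integrable g (kacMeasure N)) :
    ∫ V, smooth m g V ∂(kacMeasure N) = ∫ V, g V ∂(kacMeasure N) := by
  rcases isEmpty_or_nonempty (KacSphere N) with h | ⟨⟨V₀⟩⟩
  · simp [Measure.eq_zero_of_isEmpty (kacMeasure N)]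
  simp only [smooth, corrMass_eq m _ V₀]
  rw [integral_const_mul, integral_integral_swap (integrable_prod_corr_pow_mul m hg)]
  simp only [integral_mul_const]
  have h : ∀ W : KacSphere N, ∫ V, corr V W ^ m ∂(kacMeasure N) = corrMass N m V₀ := fun W => by
    rw [corrMass_eq m V₀ W, corrMass]
    simp only [corr_comm W]
  simp only [h]
  rw [integral_const_mul, ← mul_assoc, inv_mul_cancel₀ (corrMass_pos hN m V₀).ne', one_mul]

/-- High powers of a function with a strict maximum at `V` concentrate there. -/
theorem tendsto_smooth (hN : N ≠ 0) {φ : KacSphere N → ℝ} (hφ : Continuous φ) (V : KacSphere N) :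
    Tendsto (fun m => smooth m φ V) atTop (𝓝 (φ V)) := by
  have h := tendsto_setIntegral_pow_smul_of_unique_maximum_of_isCompact_of_measure_nhdsWithin_pos
    (μ := kacMeasure N) (s := univ) (x₀ := V) isCompact_univ
    (fun U hU hV => by simpa using kacMeasure_pos_of_isOpen hU ⟨V, hV⟩ hN)
    (continuous_corr_right V).continuousOn
    (fun W _ hW => corr_lt_corr_self (Nat.pos_of_ne_zero hN) hW) (fun W _ => (corr_pos V W).le)
    (corr_pos V V) (mem_univ V) (integrable_of_continuous hφ).integrableOn
    hφ.continuousAt.continuousWithinAt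
  simpa [smooth, corrMass] using h

theorem abs_smooth_le (hN : N ≠ 0) (m : ℕ) {g : KacSphere N → ℝ}
    (hg : Integrable g (kacMeasure N)) (V : KacSphere N) :
    |smooth m g V| ≤ smooth m (fun W => |g W|) V := by
  rw [smooth, abs_mul, abs_of_pos (inv_pos.2 (corrMass_pos hN m V))]
  refine mul_le_mul_of_nonneg_left ?_ (inv_pos.2 (corrMass_pos hN m V)).le
  refine (abs_integral_le_integral_abs).trans (le_of_eq ?_)
  refine integral_congr_ae (Eventually.of_forall fun W => ?_)
  simp only [abs_mul, abs_of_pos (pow_pos (corr_pos V W) m)]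

theorem smooth_sub (m : ℕ) {f g : KacSphere N → ℝ} (hf : Integrable f (kacMeasure N))
    (hg : Integrable g (kacMeasure N)) (V : KacSphere N) :
    smooth m (fun W => f W - g W) V = smooth m f V - smooth m g V := by
  simp only [smooth, mul_sub]
  rw [integral_sub (integrable_corr_pow_mul m V hf) (integrable_corr_pow_mul m V hg), mul_sub]

theorem smooth_const (hN : N ≠ 0) (m : ℕ) (r : ℝ) (V : KacSphere N) :
    smooth m (fun _ => r) V = r := by
  have h := (corrMass_pos hN m V).ne'
  simp only [smooth]
  rw [integral_mul_const, ← mul_assoc, ← corrMass, inv_mul_cancel₀ h, one_mul]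

theorem smooth_mono (hN : N ≠ 0) (m : ℕ) {f g : KacSphere N → ℝ}
    (hf : Integrable f (kacMeasure N)) (hg : Integrable g (kacMeasure N)) (h : ∀ V, f V ≤ g V)
    (V : KacSphere N) : smooth m f V ≤ smooth m g V :=
  mul_le_mul_of_nonneg_left (integral_mono (integrable_corr_pow_mul m V hf)
    (integrable_corr_pow_mul m V hg) fun W =>
      mul_le_mul_of_nonneg_left (h W) (pow_pos (corr_pos V W) m).le)
    (inv_pos.2 (corrMass_pos hN m V)).le

theorem tendsto_integral_abs_smooth_sub_of_continuous (hN : N ≠ 0) {φ : KacSphere N → ℝ}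
    (hφ : Continuous φ) :
    Tendsto (fun m => ∫ V, |smooth m φ V - φ V| ∂(kacMeasure N)) atTop (𝓝 0) := by
  obtain ⟨B, hB⟩ := isCompact_univ.exists_bound_of_continuousOn hφ.continuousOn
  have hφi := integrable_of_continuous hφ
  have h := tendsto_integral_of_dominated_convergence (μ := kacMeasure N)
    (F := fun m V => |smooth m φ V - φ V|) (f := fun _ => 0) (fun _ => B + B)
    (fun m => ((continuous_smooth m hφi).sub hφ).abs.aestronglyMeasurable) (integrable_const _)
    (fun m => Eventually.of_forall fun V => ?_) (Eventually.of_forall fun V => ?_)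
  · simpa using h
  · rw [Real.norm_eq_abs, abs_abs]
    refine (abs_sub _ _).trans (add_le_add ?_ (hB V (mem_univ V)))
    refine (abs_smooth_le hN m hφi V).trans ?_
    exact (smooth_mono hN m hφi.abs (integrable_const B) (fun W => hB W (mem_univ W)) V).trans
      (smooth_const hN m B V).le
  · have h1 := ((tendsto_smooth hN hφ V).sub_const (φ V)).abs
    simpa using h1

/-- Approximation by continuous functions, since smoothing contracts the L¹ norm. -/
theorem tendsto_integral_abs_smooth_sub (hN : N ≠ 0) {g : KacSphere N → ℝ}
    (hg : Integrable g (kacMeasure N)) :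
    Tendsto (fun m => ∫ V, |smooth m g V - g V| ∂(kacMeasure N)) atTop (𝓝 0) := by
  rw [Metric.tendsto_atTop]
  intro ε hε
  obtain ⟨φ, hφ, hφi⟩ := hg.exists_boundedContinuous_integral_sub_le (show 0 < ε / 4 by linarith)
  obtain ⟨m₀, hm₀⟩ := Metric.tendsto_atTop.1
    (tendsto_integral_abs_smooth_sub_of_continuous hN φ.continuous) (ε / 4) (by linarith)
  refine ⟨m₀, fun m hm => ?_⟩
  have h1 := hm₀ m hm
  rw [Real.dist_eq, sub_zero, abs_of_nonneg (integral_nonneg fun V => abs_nonneg _)] at h1 ⊢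
  have hsub : Integrable (fun V => g V - φ V) (kacMeasure N) := hg.sub hφi
  have i1 : Integrable (fun V => smooth m (fun W => |g W - φ W|) V) (kacMeasure N) :=
    integrable_of_continuous (continuous_smooth m hsub.abs)
  have i2 : Integrable (fun V => |smooth m φ V - φ V|) (kacMeasure N) :=
    integrable_of_continuous ((continuous_smooth m hφi).sub φ.continuous).abs
  have i3 : Integrable (fun V => |g V - φ V|) (kacMeasure N) := hsub.abs
  have h2 : ∫ V, |smooth m g V - g V| ∂(kacMeasure N) ≤
      ∫ V, (smooth m (fun W => |g W - φ W|) V + |smooth m φ V - φ V| + |g V - φ V|)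
        ∂(kacMeasure N) := by
    refine integral_mono ((integrable_of_continuous (continuous_smooth m hg)).sub hg).abs
      ((i1.add i2).add i3) fun V => ?_
    have e1 := abs_smooth_le hN m hsub V
    rw [smooth_sub m hg hφi] at e1
    have e2 := abs_sub_le (smooth m g V) (smooth m φ V) (g V)
    have e3 := abs_sub_le (smooth m φ V) (φ V) (g V)
    rw [abs_sub_comm (φ V) (g V)] at e3
    linarith
  have h3 : ∫ V, (smooth m (fun W => |g W - φ W|) V + |smooth m φ V - φ V| + |g V - φ V|)
        ∂(kacMeasure N) = ∫ V, |g V - φ V| ∂(kacMeasure N) +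
      ∫ V, |smooth m φ V - φ V| ∂(kacMeasure N) + ∫ V, |g V - φ V| ∂(kacMeasure N) := by
    refine (integral_add (i1.add i2) i3).trans ?_
    rw [integral_add' i1 i2, integral_smooth hN m hsub.abs]
  simp only [Real.norm_eq_abs] at hφ
  linarith

theorem ev_weight_le {i j : Fin N} (hij : i ≠ j) (V W : KacSphere N) :
    ev (weight i j) W ≤ 1 + 2 * (V.1 i ^ 2 + V.1 j ^ 2) + 2 * ‖V.1 - W.1‖ ^ 2 := by
  have h : (V.1 i - W.1 i) ^ 2 + (V.1 j - W.1 j) ^ 2 ≤ ‖V.1 - W.1‖ ^ 2 := by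
    rw [EuclideanSpace.norm_sq_eq]
    simp only [PiLp.sub_apply, Real.norm_eq_abs, sq_abs]
    exact Finset.add_le_sum (f := fun l => (V.1 l - W.1 l) ^ 2) (fun l _ => sq_nonneg _)
      (Finset.mem_univ i) (Finset.mem_univ j) hij
  rw [ev_weight]
  nlinarith [sq_nonneg (2 * V.1 i - W.1 i), sq_nonneg (2 * V.1 j - W.1 j)]

/-- The smoothed squared distance to `V`, taken at `V`, is the same for all `V` by invariance and
tends to zero. Once below 1/2, the bound `ev_weight_le` becomes `1 + 2 (v_i² + v_j²) + 1`, twice the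
weight, uniformly in `V`. -/
theorem eventually_smooth_weight_le (hN : N ≠ 0) :
    ∀ᶠ m in atTop, ∀ (i j : Fin N) (_ : i ≠ j) (V : KacSphere N),
      smooth m (ev (weight i j)) V ≤ 2 * ev (weight i j) V := by
  rcases isEmpty_or_nonempty (KacSphere N) with h | ⟨⟨V₀⟩⟩
  · exact Eventually.of_forall fun m i j _ V => (h.false V).elim
  have cd : ∀ V : KacSphere N, Continuous fun W : KacSphere N => ‖V.1 - W.1‖ ^ 2 := fun V =>
    (continuous_const.sub continuous_subtype_val).norm.pow 2
  have hlim := tendsto_smooth hN (cd V₀) V₀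
  simp only [sub_self, norm_zero, ne_eq, OfNat.ofNat_ne_zero, not_false_eq_true, zero_pow] at hlim
  filter_upwards [(tendsto_order.1 hlim).2 (1 / 2) (by norm_num)] with m hm i j hij V
  have hinv : smooth m (fun W => ‖V.1 - W.1‖ ^ 2) V = smooth m (fun W => ‖V₀.1 - W.1‖ ^ 2) V₀ := by
    obtain ⟨e, rfl⟩ := exists_isoMap_eq V₀ V
    rw [smooth, smooth, corrMass_eq m _ V₀, ← integral_comp_isoMap e]
    congr 1
    refine integral_congr_ae (Eventually.of_forall fun W => ?_)
    simp only [corr_isoMap]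
    congr 2
    have h1 : (isoMap e V₀).1 - (isoMap e W).1 = e (V₀.1 - W.1) := by simp [isoMap]
    rw [h1, e.norm_map]
  have i1 : Integrable (fun W => ev (weight i j) W) (kacMeasure N) := integrable_ev _
  have i2 : Integrable (fun W : KacSphere N => ‖V.1 - W.1‖ ^ 2) (kacMeasure N) :=
    integrable_of_continuous (cd V)
  have i3 : Integrable (fun W : KacSphere N => ‖V.1 - W.1‖ ^ 2 + ‖V.1 - W.1‖ ^ 2) (kacMeasure N) :=
    i2.add i2
  have h1 := smooth_mono hN m (i1.sub i3)
    (integrable_const (1 + 2 * (V.1 i ^ 2 + V.1 j ^ 2)))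
    (fun W => by have := ev_weight_le hij V W; simp only [Pi.sub_apply]; linarith) V
  have h2 := smooth_sub m i1 i3 V
  have h3 : smooth m (fun W : KacSphere N => ‖V.1 - W.1‖ ^ 2 + ‖V.1 - W.1‖ ^ 2) V =
      2 * smooth m (fun W => ‖V.1 - W.1‖ ^ 2) V := by
    simp only [smooth, ← two_mul, mul_left_comm _ (2 : ℝ), integral_const_mul]
  have h4 : smooth m ((fun W => ev (weight i j) W) - fun W : KacSphere N =>
      ‖V.1 - W.1‖ ^ 2 + ‖V.1 - W.1‖ ^ 2) V = smooth m (fun W => ev (weight i j) W -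
        (‖V.1 - W.1‖ ^ 2 + ‖V.1 - W.1‖ ^ 2)) V := rfl
  rw [smooth_const hN, h4, h2, h3, hinv] at h1
  have h5 : smooth m (ev (weight i j)) V = smooth m (fun W => ev (weight i j) W) V := rfl
  rw [h5, ev_weight i j V]
  linarith

/-! ### Jensen's inequality for the entropy production -/

theorem measurable_psi : Measurable fun q : ℝ × ℝ => psi q.1 q.2 := by
  refine Measurable.ite (measurableSet_eq_fun measurable_fst measurable_snd) measurable_const
    (Measurable.ite ?_ measurable_const ?_)
  · exact (measurableSet_eq_fun measurable_fst measurable_const).union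
      (measurableSet_eq_fun measurable_snd measurable_const)
  · exact ((measurable_fst.sub measurable_snd).mul
      (measurable_fst.div measurable_snd).log).ennreal_ofReal

theorem measurable_comp_rot {i j : Fin N} (hij : i ≠ j) {F : KacSphere N → ℝ}
    (hF : Measurable F) : Measurable fun q : ℝ × KacSphere N => F (rot i j hij q.1 q.2) :=
  hF.comp (continuous_rot i j hij).measurable

theorem measurable_psi_rot {i j : Fin N} (hij : i ≠ j) {F : KacSphere N → ℝ} (hF : Measurable F) :
    Measurable fun q : ℝ × KacSphere N => psi (F q.2) (F (rot i j hij q.1 q.2)) :=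
  measurable_psi.comp ((hF.comp measurable_snd).prodMk (measurable_comp_rot hij hF))

/-- ψ is convex and homogeneous of degree one, so its tangent plane at a point passes through the
origin and lies below it: the lower bound is linear, without a constant term. -/
theorem tangent_le_psiReal {x₀ y₀ x y : ℝ} (hx₀ : 0 < x₀) (hy₀ : 0 < y₀) (hx : 0 < x)
    (hy : 0 < y) :
    (Real.log x₀ - Real.log y₀ + 1 - y₀ / x₀) * x + (Real.log y₀ - Real.log x₀ + 1 - x₀ / y₀) * y ≤
      psiReal x y := by
  have key : ∀ {a b s t : ℝ}, 0 < a → 0 < b → 0 < s → 0 < t →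
      s * (Real.log a - Real.log b) + s - t * (a / b) ≤ s * (Real.log s - Real.log t) := by
    intro a b s t ha hb hs ht
    have h1 := Real.one_sub_inv_le_log_of_pos (show 0 < s / t / (a / b) by positivity)
    rw [Real.log_div (by positivity) (by positivity), Real.log_div hs.ne' ht.ne',
      Real.log_div ha.ne' hb.ne'] at h1
    have h2 := mul_le_mul_of_nonneg_left h1 hs.le
    have h3 : s * (1 - (s / t / (a / b))⁻¹) = s - t * (a / b) := by field_simp
    rw [h3] at h2
    linarith
  have h1 := key hx₀ hy₀ hx hy
  have h2 := key hy₀ hx₀ hy hx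
  rw [psiReal]
  linarith

theorem ofReal_tangent_le_psi {x₀ y₀ x y : ℝ} (hx₀ : 0 < x₀) (hy₀ : 0 < y₀) (hx : 0 ≤ x)
    (hy : 0 ≤ y) :
    ENNReal.ofReal ((Real.log x₀ - Real.log y₀ + 1 - y₀ / x₀) * x +
      (Real.log y₀ - Real.log x₀ + 1 - x₀ / y₀) * y) ≤ psi x y := by
  rcases hx.eq_or_lt with rfl | hx
  · rcases hy.eq_or_lt with rfl | hy
    · simp
    · simp [psi, hy.ne]
  · rcases hy.eq_or_lt with rfl | hy
    · simp [psi, hx.ne']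
    · rw [psi_eq_ofReal_psiReal hx hy]
      exact ENNReal.ofReal_le_ofReal (tangent_le_psiReal hx₀ hy₀ hx hy)

theorem psiReal_eq_tangent {x y : ℝ} (hx : 0 < x) (hy : 0 < y) :
    psiReal x y = (Real.log x - Real.log y + 1 - y / x) * x +
      (Real.log y - Real.log x + 1 - x / y) * y := by
  rw [psiReal]
  field_simp
  ring

theorem smooth_rot (m : ℕ) {i j : Fin N} (hij : i ≠ j) (θ : ℝ) (F : KacSphere N → ℝ)
    (V : KacSphere N) : smooth m F (rot i j hij θ V) = smooth m (fun W => F (rot i j hij θ W)) V := by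
  rw [smooth, smooth, corrMass_eq m _ V, ← integral_comp_rot i j hij θ]
  simp only [corr_rot]

theorem ofReal_integral_le_lintegral {α : Type*} [MeasurableSpace α] {μ : Measure α} {f : α → ℝ}
    (hf : Integrable f μ) : ENNReal.ofReal (∫ x, f x ∂μ) ≤ ∫⁻ x, ENNReal.ofReal (f x) ∂μ := by
  rw [integral_eq_lintegral_pos_part_sub_lintegral_neg_part hf]
  refine (ENNReal.ofReal_le_ofReal (sub_le_self _ ENNReal.toReal_nonneg)).trans ?_
  exact ENNReal.ofReal_toReal_le

/-- Jensen's inequality for the entropy production integrand under smoothing. -/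
theorem psi_smooth_le (hN : N ≠ 0) (m : ℕ) {i j : Fin N} (hij : i ≠ j) (θ : ℝ)
    {F : KacSphere N → ℝ} (hF : Integrable F (kacMeasure N)) (h0 : ∀ V, 0 ≤ F V)
    (h1 : ∫ V, F V ∂(kacMeasure N) = 1) (V : KacSphere N) :
    psi (smooth m F V) (smooth m F (rot i j hij θ V)) ≤
      ∫⁻ W, ENNReal.ofReal ((corrMass N m V)⁻¹ * corr V W ^ m) *
        psi (F W) (F (rot i j hij θ W)) ∂(kacMeasure N) := by
  have hx := smooth_pos hN m hF h0 h1 V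
  have hy := smooth_pos hN m hF h0 h1 (rot i j hij θ V)
  have hZ := corrMass_pos hN m V
  -- At the smoothed values the tangent plane is exact. Being linear it commutes with the smoothing
  -- integral, inside which it lies below ψ.
  rw [psi_eq_ofReal_psiReal hx hy, psiReal_eq_tangent hx hy]
  set a := Real.log (smooth m F V) - Real.log (smooth m F (rot i j hij θ V)) + 1 -
    smooth m F (rot i j hij θ V) / smooth m F V with ha
  set b := Real.log (smooth m F (rot i j hij θ V)) - Real.log (smooth m F V) + 1 -
    smooth m F V / smooth m F (rot i j hij θ V) with hb
  have hF' : Integrable (fun W => F (rot i j hij θ W)) (kacMeasure N) :=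
    (measurePreserving_rot i j hij θ).integrable_comp_of_integrable hF
  have i1 := (integrable_corr_pow_mul m V hF).const_mul a
  have i2 := (integrable_corr_pow_mul m V hF').const_mul b
  have h2 : a * smooth m F V + b * smooth m F (rot i j hij θ V) =
      ∫ W, (corrMass N m V)⁻¹ * (a * (corr V W ^ m * F W) +
        b * (corr V W ^ m * F (rot i j hij θ W))) ∂(kacMeasure N) := by
    rw [integral_const_mul, integral_add i1 i2, integral_const_mul, integral_const_mul, smooth_rot,
      smooth, smooth]
    ring
  rw [h2]
  refine (ofReal_integral_le_lintegral ((i1.add i2).const_mul _)).trans (lintegral_mono fun W => ?_)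
  have h3 : (corrMass N m V)⁻¹ * (a * (corr V W ^ m * F W) +
        b * (corr V W ^ m * F (rot i j hij θ W))) =
      (corrMass N m V)⁻¹ * corr V W ^ m * (a * F W + b * F (rot i j hij θ W)) := by ring
  have h4 := corr_pos V W
  rw [Pi.add_apply, h3, ENNReal.ofReal_mul (by positivity)]
  gcongr
  exact ofReal_tangent_le_psi hx hy (h0 _) (h0 _)

theorem lintegral_weight_mul_corr (hN : N ≠ 0) (m : ℕ) {i j : Fin N} (W : KacSphere N) :
    ∫⁻ V, ENNReal.ofReal (ev (weight i j) V) * ENNReal.ofReal ((corrMass N m V)⁻¹ * corr V W ^ m)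
      ∂(kacMeasure N) = ENNReal.ofReal (smooth m (ev (weight i j)) W) := by
  have h : smooth m (ev (weight i j)) W =
      ∫ V, ev (weight i j) V * ((corrMass N m V)⁻¹ * corr V W ^ m) ∂(kacMeasure N) := by
    rw [smooth, ← integral_const_mul]
    refine integral_congr_ae (Eventually.of_forall fun V => ?_)
    dsimp only
    rw [corrMass_eq m V W, corr_comm V W]
    ring
  have hw : ∀ V, 0 ≤ ev (weight i j) V := fun V => by rw [ev_weight]; positivity
  have hk : ∀ V, 0 ≤ (corrMass N m V)⁻¹ * corr V W ^ m := fun V =>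
    mul_nonneg (inv_pos.2 (corrMass_pos hN m V)).le (pow_pos (corr_pos V W) m).le
  rw [h, ofReal_integral_eq_lintegral_ofReal _ (Eventually.of_forall fun V => mul_nonneg (hw V) (hk V))]
  · simp only [ENNReal.ofReal_mul (hw _)]
  · simp only [corrMass_eq m _ W, corr_comm _ W]
    have c := ((continuous_ev (weight i j)).mul
      (((continuous_corr_right W).pow m).const_mul (corrMass N m W)⁻¹))
    exact integrable_of_continuous c

theorem lintegral_lintegral_lintegral_swap {X Θ : Type*} [MeasurableSpace X] [MeasurableSpace Θ]
    {μ : Measure X} {ν : Measure Θ} [SFinite μ] [SFinite ν] {w : X → ℝ≥0∞} (hw : Measurable w)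
    {k : X × X → ℝ≥0∞} (hk : Measurable k) {P : Θ × X → ℝ≥0∞} (hP : Measurable P) :
    ∫⁻ V, ∫⁻ θ, ∫⁻ W, w V * (k (V, W) * P (θ, W)) ∂μ ∂ν ∂μ =
      ∫⁻ W, (∫⁻ V, w V * k (V, W) ∂μ) * ∫⁻ θ, P (θ, W) ∂ν ∂μ := by
  have hP1 : ∀ W, Measurable fun θ => P (θ, W) := fun W => hP.comp measurable_prodMk_right
  have hG : Measurable fun W => ∫⁻ θ, P (θ, W) ∂ν := hP.lintegral_prod_left'
  calc _ = ∫⁻ V, ∫⁻ W, w V * k (V, W) * ∫⁻ θ, P (θ, W) ∂ν ∂μ ∂μ := by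
        refine lintegral_congr fun V => ?_
        rw [lintegral_lintegral_swap]
        · refine lintegral_congr fun W => ?_
          rw [← lintegral_const_mul _ (hP1 W)]
          simp only [mul_assoc]
        · exact (measurable_const.mul (((hk.comp measurable_prodMk_left).comp
            measurable_snd).mul hP)).aemeasurable
    _ = _ := by
        rw [lintegral_lintegral_swap
          (((hw.comp measurable_fst).mul hk).mul (hG.comp measurable_snd)).aemeasurable]
        refine lintegral_congr fun W => ?_
        exact lintegral_mul_const _ (hw.mul (hk.comp measurable_prodMk_right))

/-- After Jensen's inequality, Tonelli's theorem and the symmetry of the kernel move the smoothing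
from ψ to the weight, where it costs a factor 2. -/
theorem lintegral_weight_mul_psi_smooth_le (hN : N ≠ 0) {m : ℕ} {i j : Fin N} (hij : i ≠ j)
    (hm : ∀ V : KacSphere N, smooth m (ev (weight i j)) V ≤ 2 * ev (weight i j) V)
    {F : KacSphere N → ℝ} (hFm : Measurable F) (hF : Integrable F (kacMeasure N))
    (h0 : ∀ V, 0 ≤ F V) (h1 : ∫ V, F V ∂(kacMeasure N) = 1) :
    ∫⁻ V, ∫⁻ θ in Icc (0 : ℝ) (2 * Real.pi), ENNReal.ofReal ((1 + (V.1 i ^ 2 + V.1 j ^ 2)) ^ (1 : ℝ)) *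
      psi (smooth m F V) (smooth m F (rot i j hij θ V)) ∂volume ∂(kacMeasure N) ≤
    2 * ∫⁻ V, ∫⁻ θ in Icc (0 : ℝ) (2 * Real.pi),
      ENNReal.ofReal ((1 + (V.1 i ^ 2 + V.1 j ^ 2)) ^ (1 : ℝ)) *
        psi (F V) (F (rot i j hij θ V)) ∂volume ∂(kacMeasure N) := by
  simp only [Real.rpow_one, ← ev_weight i j]
  have hpsi := measurable_psi_rot hij hFm
  have hk : Measurable fun q : KacSphere N × KacSphere N =>
      ENNReal.ofReal ((corrMass N m q.1)⁻¹ * corr q.1 q.2 ^ m) := by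
    rcases isEmpty_or_nonempty (KacSphere N) with h | ⟨⟨V₀⟩⟩
    · exact measurable_of_empty _
    simp only [corrMass_eq m _ V₀]
    exact ((continuous_corr.pow m).const_mul _).measurable.ennreal_ofReal
  have hw : Measurable fun V : KacSphere N => ENNReal.ofReal (ev (weight i j) V) :=
    (continuous_ev _).measurable.ennreal_ofReal
  have hswap := lintegral_lintegral_lintegral_swap (μ := kacMeasure N)
    (ν := volume.restrict (Icc (0 : ℝ) (2 * Real.pi))) hw hk hpsi
  simp only [lintegral_weight_mul_corr hN] at hswap
  have hle : ∀ (V : KacSphere N) (θ : ℝ), ENNReal.ofReal (ev (weight i j) V) *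
      psi (smooth m F V) (smooth m F (rot i j hij θ V)) ≤
      ∫⁻ W, ENNReal.ofReal (ev (weight i j) V) *
        (ENNReal.ofReal ((corrMass N m V)⁻¹ * corr V W ^ m) * psi (F W) (F (rot i j hij θ W)))
          ∂(kacMeasure N) := fun V θ => by
    rw [lintegral_const_mul' _ _ ENNReal.ofReal_ne_top]
    exact mul_le_mul_right (psi_smooth_le hN m hij θ hF h0 h1 V) _
  refine (lintegral_mono fun V => lintegral_mono fun θ => hle V θ).trans (hswap.trans_le ?_)
  rw [← lintegral_const_mul' _ _ (by simp)]
  refine lintegral_mono fun W => ?_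
  dsimp only
  rw [lintegral_const_mul' _ _ ENNReal.ofReal_ne_top, ← mul_assoc]
  refine mul_le_mul_left ((ENNReal.ofReal_le_ofReal (hm W)).trans (le_of_eq ?_)) _
  rw [ENNReal.ofReal_mul zero_le_two, ENNReal.ofReal_ofNat]

theorem eventually_entropyProduction_smooth_le (hN : N ≠ 0) {F : KacSphere N → ℝ}
    (hFm : Measurable F) (hF : Integrable F (kacMeasure N))
    (h0 : ∀ V, 0 ≤ F V) (h1 : ∫ V, F V ∂(kacMeasure N) = 1) :
    ∀ᶠ m in atTop, entropyProduction 1 (smooth m F) ≤ 2 * entropyProduction 1 F := by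
  filter_upwards [eventually_smooth_weight_le hN] with m hm
  rw [entropyProduction, entropyProduction, mul_left_comm, Finset.mul_sum (a := (2 : ℝ≥0∞))]
  gcongr with q
  exact lintegral_weight_mul_psi_smooth_le hN q.2.ne (hm _ _ q.2.ne) hFm hF h0 h1

/-! ### The linear bound for general densities -/

namespace IsSymmDensity

variable {F : KacSphere N → ℝ}

theorem integrable (hF : IsSymmDensity F) : Integrable F (kacMeasure N) := by
  refine ⟨hF.measurable.aestronglyMeasurable, ?_⟩
  rw [hasFiniteIntegral_iff_ofReal (Eventually.of_forall hF.nonneg), hF.lintegral_eq_one]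
  exact ENNReal.one_lt_top

theorem integral_eq_one (hF : IsSymmDensity F) : ∫ V, F V ∂(kacMeasure N) = 1 := by
  rw [integral_eq_lintegral_of_nonneg_ae (Eventually.of_forall hF.nonneg)
    hF.measurable.aestronglyMeasurable, hF.lintegral_eq_one, ENNReal.toReal_one]

end IsSymmDensity

/-- Consequently `x log x + 1` is nonnegative, so entropies can be handled as lower Lebesgue
integrals before integrability is known. -/
theorem sub_one_le_mul_log {x : ℝ} (hx : 0 ≤ x) : x - 1 ≤ x * Real.log x := by
  rcases hx.eq_or_lt with rfl | hx
  · simp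
  · have h := mul_le_mul_of_nonneg_left (Real.one_sub_inv_le_log_of_pos hx) hx.le
    rwa [mul_sub, mul_one, mul_inv_cancel₀ hx.ne'] at h

theorem entropy_nonneg (hN : N ≠ 0) {F : KacSphere N → ℝ} (hF : IsSymmDensity F)
    (hi : Integrable (fun V => F V * Real.log (F V)) (kacMeasure N)) : 0 ≤ entropy F := by
  have := isProbabilityMeasure_kacMeasure hN
  have h := integral_mono (hF.integrable.sub (integrable_const 1)) hi
    fun V => sub_one_le_mul_log (hF.nonneg V)
  rw [integral_sub' hF.integrable (integrable_const 1), hF.integral_eq_one] at h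
  rw [entropy]
  simpa using h

theorem exists_seq_smooth_tendsto_ae (hN : N ≠ 0) {g : KacSphere N → ℝ}
    (hg : Integrable g (kacMeasure N)) :
    ∃ ns : ℕ → ℕ, StrictMono ns ∧
      ∀ᵐ V ∂(kacMeasure N), Tendsto (fun n => smooth (ns n) g V) atTop (𝓝 (g V)) := by
  refine (tendstoInMeasure_of_tendsto_eLpNorm (p := 1) one_ne_zero
    (fun m => (continuous_smooth m hg).aestronglyMeasurable) hg.1 ?_).exists_seq_tendsto_ae
  have h := (ENNReal.continuous_ofReal.tendsto 0).comp (tendsto_integral_abs_smooth_sub hN hg)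
  rw [ENNReal.ofReal_zero] at h
  refine h.congr fun m => ?_
  have hi : Integrable (fun V => smooth m g V - g V) (kacMeasure N) :=
    (integrable_of_continuous (continuous_smooth m hg)).sub hg
  rw [eLpNorm_one_eq_lintegral_enorm]
  exact ofReal_integral_norm_eq_lintegral_enorm hi

/-- The smoothed density has an entropy controlled by the production of the original one. -/
theorem eventually_integral_smooth_mul_log_le (hN : 2 ≤ N) {F : KacSphere N → ℝ}
    (hF : IsSymmDensity F) (hD : entropyProduction 1 F ≠ ∞) :
    ∀ᶠ m in atTop, ∫⁻ V, ENNReal.ofReal (smooth m F V * Real.log (smooth m F V) + 1)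
      ∂(kacMeasure N) ≤
        ENNReal.ofReal (Real.exp 48 * (2 * (entropyProduction 1 F).toReal) + 1) := by
  have hN' : N ≠ 0 := by omega
  have := isProbabilityMeasure_kacMeasure hN'
  filter_upwards [eventually_entropyProduction_smooth_le hN' hF.measurable hF.integrable hF.nonneg
    hF.integral_eq_one] with m hm
  obtain ⟨p, hp⟩ := exists_ev_eq_smooth m hF.integrable
  have hpos : ∀ V, 0 < ev p V := fun V => by
    rw [hp]; exact smooth_pos hN' m hF.integrable hF.nonneg hF.integral_eq_one V
  have h1 : ∫ V, ev p V ∂(kacMeasure N) = 1 := by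
    simp only [hp]
    rw [integral_smooth hN' m hF.integrable, hF.integral_eq_one]
  have h2 := ofReal_polyEntropy_le_entropyProduction hN hpos h1
  have hev : ev p = smooth m F := funext hp
  rw [hev] at h2
  have h3 := h2.trans hm
  rw [← ENNReal.ofReal_toReal hD, ← ENNReal.ofReal_ofNat 2, ← ENNReal.ofReal_mul zero_le_two,
    ENNReal.ofReal_le_ofReal_iff (by positivity)] at h3
  simp only [← hp]
  have hi := integrable_ev_mul_log hpos
  have hi1 : Integrable (fun V => ev p V * Real.log (ev p V) + 1) (kacMeasure N) :=
    hi.add (integrable_const 1)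
  rw [← ofReal_integral_eq_lintegral_ofReal hi1 (Eventually.of_forall fun V => by
    have := sub_one_le_mul_log (hpos V).le
    have := (hpos V).le
    simp only [Pi.zero_apply]
    linarith)]
  refine ENNReal.ofReal_le_ofReal ?_
  rw [integral_add hi (integrable_const 1)]
  simp only [integral_const, probReal_univ, one_smul]
  have h4 := mul_le_mul_of_nonneg_left h3 (Real.exp_pos 48).le
  rw [← mul_assoc, ← Real.exp_add, add_neg_cancel, Real.exp_zero, one_mul] at h4
  exact add_le_add_left h4 1

/-- Fatou's lemma along a subsequence of smoothings converging almost everywhere. -/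
theorem lintegral_mul_log_add_one_le (hN : 2 ≤ N) {F : KacSphere N → ℝ}
    (hF : IsSymmDensity F) (hD : entropyProduction 1 F ≠ ∞) :
    ∫⁻ V, ENNReal.ofReal (F V * Real.log (F V) + 1) ∂(kacMeasure N) ≤
      ENNReal.ofReal (Real.exp 48 * (2 * (entropyProduction 1 F).toReal) + 1) := by
  have hN' : N ≠ 0 := by omega
  obtain ⟨ns, hns, hlim⟩ := exists_seq_smooth_tendsto_ae hN' hF.integrable
  have hc : Continuous fun x : ℝ => ENNReal.ofReal (x * Real.log x + 1) :=
    ENNReal.continuous_ofReal.comp (Real.continuous_mul_log.add continuous_const)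
  calc _ = ∫⁻ V, liminf (fun n => ENNReal.ofReal (smooth (ns n) F V *
        Real.log (smooth (ns n) F V) + 1)) atTop ∂(kacMeasure N) := by
        refine lintegral_congr_ae ?_
        filter_upwards [hlim] with V hV
        exact ((hc.tendsto _).comp hV).liminf_eq.symm
    _ ≤ liminf (fun n => ∫⁻ V, ENNReal.ofReal (smooth (ns n) F V *
        Real.log (smooth (ns n) F V) + 1) ∂(kacMeasure N)) atTop :=
      lintegral_liminf_le fun n =>
        hc.measurable.comp (continuous_smooth (ns n) hF.integrable).measurable
    _ ≤ _ := by
        refine liminf_le_of_le (by isBoundedDefault) fun b hb => ?_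
        obtain ⟨n, h1, h2⟩ := (hb.and (hns.tendsto_atTop.eventually
          (eventually_integral_smooth_mul_log_le hN hF hD))).exists
        exact h1.trans h2

/-- Finite entropy production with quadratic weight forces finite entropy. -/
theorem integrable_mul_log (hN : 2 ≤ N) {F : KacSphere N → ℝ}
    (hF : IsSymmDensity F) (hD : entropyProduction 1 F ≠ ∞) :
    Integrable (fun V => F V * Real.log (F V)) (kacMeasure N) := by
  have h : Integrable (fun V => F V * Real.log (F V) + 1) (kacMeasure N) := by
    refine ⟨((Real.continuous_mul_log.measurable.comp hF.measurable).add_const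
      1).aestronglyMeasurable, ?_⟩
    rw [hasFiniteIntegral_iff_ofReal (Eventually.of_forall fun V => by
      have := sub_one_le_mul_log (hF.nonneg V)
      have := hF.nonneg V
      simp only [Pi.zero_apply]
      linarith)]
    exact (lintegral_mul_log_add_one_le hN hF hD).trans_lt ENNReal.ofReal_lt_top
  have h2 := h.sub (integrable_const 1)
  refine h2.congr (Eventually.of_forall fun V => ?_)
  simp

/-- Cercignani's conjecture with quadratic weight, up to a factor `2`. -/
theorem entropy_le_entropyProduction (hN : 2 ≤ N) {F : KacSphere N → ℝ}
    (hF : IsSymmDensity F) (hD : entropyProduction 1 F ≠ ∞) :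
    Real.exp (-48) / 2 * entropy F ≤ (entropyProduction 1 F).toReal := by
  have hN' : N ≠ 0 := by omega
  have := isProbabilityMeasure_kacMeasure hN'
  have hi := integrable_mul_log hN hF hD
  have h1 := lintegral_mul_log_add_one_le hN hF hD
  have hi1 : Integrable (fun V => F V * Real.log (F V) + 1) (kacMeasure N) :=
    hi.add (integrable_const 1)
  rw [← ofReal_integral_eq_lintegral_ofReal hi1 (Eventually.of_forall fun V => by
    have := sub_one_le_mul_log (hF.nonneg V)
    have := hF.nonneg V
    simp only [Pi.zero_apply]
    linarith), ENNReal.ofReal_le_ofReal_iff (by positivity), integral_add hi (integrable_const 1)] at h1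
  simp only [integral_const, probReal_univ, one_smul, add_le_add_iff_right] at h1
  have h2 := mul_le_mul_of_nonneg_left h1 (Real.exp_pos (-48)).le
  rw [← mul_assoc, ← Real.exp_add, neg_add_cancel, Real.exp_zero, one_mul] at h2
  rw [entropy]
  linarith

/-! ### Reduction to one pair by symmetry -/

theorem exists_perm_apply_eq {α : Type*} [DecidableEq α] {a b i j : α} (hab : a ≠ b)
    (hij : i ≠ j) : ∃ π : Equiv.Perm α, π a = i ∧ π b = j := by
  have h : Equiv.swap a i b ≠ i := fun h => hab <| by
    have := (Equiv.swap_apply_left a i).trans h.symm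
    exact (Equiv.swap a i).injective this
  exact ⟨(Equiv.swap a i).trans (Equiv.swap (Equiv.swap a i b) j),
    by simp [Equiv.swap_apply_of_ne_of_ne h.symm hij], by simp⟩

theorem rot_permute (π : Equiv.Perm (Fin N)) {a b i j : Fin N} (hab : a ≠ b) (hij : i ≠ j)
    (ha : π a = i) (hb : π b = j) (θ : ℝ) (V : KacSphere N) :
    rot a b hab θ (permute π V) = permute π (rot i j hij θ V) := by
  subst ha hb
  refine Subtype.ext ?_
  ext l
  simp [rot, permute, collide]

/-- The entropy production of a single pair of particles. -/
def pairRate (γ : ℝ) {i j : Fin N} (hij : i ≠ j) (F : KacSphere N → ℝ) : ℝ≥0∞ :=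
  ∫⁻ V, ∫⁻ θ in Icc (0 : ℝ) (2 * Real.pi),
    ENNReal.ofReal ((1 + (V.1 i ^ 2 + V.1 j ^ 2)) ^ γ) *
      psi (F V) (F (rot i j hij θ V)) ∂volume ∂(kacMeasure N)

theorem measurable_weight_rpow (γ : ℝ) (i j : Fin N) :
    Measurable fun V : KacSphere N => ENNReal.ofReal ((1 + (V.1 i ^ 2 + V.1 j ^ 2)) ^ γ) :=
  ((((((continuous_coord i).pow 2).add ((continuous_coord j).pow 2)).const_add
    1).measurable).pow_const γ).ennreal_ofReal

/-- A permutation carrying one pair to the other preserves the measure and the density and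
intertwines the two collisions. -/
theorem pairRate_eq (γ : ℝ) {a b i j : Fin N} (hab : a ≠ b) (hij : i ≠ j) {F : KacSphere N → ℝ}
    (hF : IsSymmDensity F) : pairRate γ hij F = pairRate γ hab F := by
  obtain ⟨π, ha, hb⟩ := exists_perm_apply_eq hab hij
  have hm : Measurable fun V : KacSphere N => ∫⁻ θ in Icc (0 : ℝ) (2 * Real.pi),
      ENNReal.ofReal ((1 + (V.1 a ^ 2 + V.1 b ^ 2)) ^ γ) * psi (F V) (F (rot a b hab θ V)) :=
    (((measurable_weight_rpow γ a b).comp measurable_snd).mul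
      (measurable_psi_rot hab hF.measurable)).lintegral_prod_left'
  rw [pairRate, pairRate, ← (measurePreserving_permute π).lintegral_comp hm]
  refine lintegral_congr fun V => lintegral_congr fun θ => ?_
  rw [rot_permute π hab hij ha hb, hF.symm, hF.symm]
  simp only [permute, ha, hb]

theorem card_pairs (N : ℕ) : Fintype.card {p : Fin N × Fin N // p.1 < p.2} = N.choose 2 := by
  have h : 2 * Fintype.card {p : Fin N × Fin N // p.1 < p.2} = N * N - N := by
    have h1 := Finset.offDiag_card (Finset.univ : Finset (Fin N))
    rw [Finset.card_univ, Fintype.card_fin] at h1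
    have h2 : (Finset.univ : Finset (Fin N)).offDiag =
        (Finset.univ.filter fun p : Fin N × Fin N => p.1 < p.2) ∪
          (Finset.univ.filter fun p : Fin N × Fin N => p.2 < p.1) := by
      ext p
      simp [lt_or_lt_iff_ne]
    have h3 : (Finset.univ.filter fun p : Fin N × Fin N => p.2 < p.1).card =
        (Finset.univ.filter fun p : Fin N × Fin N => p.1 < p.2).card :=
      Finset.card_bij (fun p _ => p.swap) (by simp) (by simp) fun p hp => ⟨p.swap, by simpa using hp⟩
    rw [← h1, h2, Finset.card_union_of_disjoint, h3, Fintype.card_subtype]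
    · ring
    · rw [Finset.disjoint_filter]
      exact fun p _ h h' => lt_asymm h h'
  rw [Nat.choose_two_right, Nat.mul_sub_one, ← h, Nat.mul_div_cancel_left _ two_pos]

theorem entropyProduction_div_eq (hN : 2 ≤ N) (γ : ℝ) {i j : Fin N} (hij : i ≠ j)
    {F : KacSphere N → ℝ} (hF : IsSymmDensity F) :
    entropyProduction γ F / N = ENNReal.ofReal (1 / (4 * Real.pi)) * pairRate γ hij F := by
  have h : ∑ p : {p : Fin N × Fin N // p.1 < p.2}, pairRate γ p.2.ne F =
      (N.choose 2 : ℝ≥0∞) * pairRate γ hij F := by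
    rw [Finset.sum_congr rfl fun p _ => pairRate_eq γ hij p.2.ne hF, Finset.sum_const,
      Finset.card_univ, card_pairs, nsmul_eq_mul]
  have hc : (0 : ℝ) < N.choose 2 := by exact_mod_cast Nat.choose_pos hN
  have hN' : (0 : ℝ) < N := by positivity
  have h2 : entropyProduction γ F = ENNReal.ofReal (1 / (4 * Real.pi) * (N / (N.choose 2 : ℝ))) *
      ∑ p : {p : Fin N × Fin N // p.1 < p.2}, pairRate γ p.2.ne F := rfl
  have hpi := Real.pi_pos
  rw [h2, h, ← mul_assoc, ← ENNReal.ofReal_natCast, ← ENNReal.ofReal_mul (by positivity),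
    ENNReal.mul_div_right_comm, ← ENNReal.ofReal_natCast, ← ENNReal.ofReal_div_of_pos hN']
  congr 2
  field_simp

/-! ### Large velocities -/

theorem measurable_psiPow (β : ℝ) : Measurable fun q : ℝ × ℝ => psiPow β q.1 q.2 := by
  refine Measurable.ite (measurableSet_eq_fun measurable_fst measurable_snd) measurable_const
    (Measurable.ite ?_ measurable_const ?_)
  · exact (measurableSet_eq_fun measurable_fst measurable_const).union
      (measurableSet_eq_fun measurable_snd measurable_const)
  · exact ((measurable_fst.sub measurable_snd).abs.mul
      ((measurable_fst.div measurable_snd).log.abs.pow_const _)).ennreal_ofReal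

/-- The factorisation to which Hölder's inequality is applied. It persists at the boundary: if
exactly one argument vanishes, both sides are infinite because `|x - y|` is positive. -/
theorem psi_eq_psiPow_rpow_mul {β x y : ℝ} (hβ : 0 < β) (hx : 0 ≤ x) (hy : 0 ≤ y) :
    psi x y = psiPow β x y ^ (1 / (1 + β)) * ENNReal.ofReal |x - y| ^ (β / (1 + β)) := by
  have hb : 0 < 1 / (1 + β) := by positivity
  have hb2 : 0 < β / (1 + β) := by positivity
  rw [psi, psiPow]
  split_ifs with h1 h2
  · rw [ENNReal.zero_rpow_of_pos hb, zero_mul]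
  · rw [ENNReal.top_rpow_of_pos hb, ENNReal.top_mul]
    rw [ENNReal.ofReal_rpow_of_pos (abs_pos.2 (sub_ne_zero.2 h1))]
    have := Real.rpow_pos_of_pos (abs_pos.2 (sub_ne_zero.2 h1)) (β / (1 + β))
    simpa using this
  · push Not at h2
    have hx' := lt_of_le_of_ne hx h2.1.symm
    have hy' := lt_of_le_of_ne hy h2.2.symm
    rw [ENNReal.ofReal_rpow_of_nonneg (by positivity) hb.le,
      ENNReal.ofReal_rpow_of_nonneg (by positivity) hb2.le, ← ENNReal.ofReal_mul (by positivity),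
      Real.mul_rpow (by positivity) (by positivity), ← Real.rpow_mul (abs_nonneg _),
      mul_one_div_cancel (by positivity), Real.rpow_one, mul_right_comm,
      ← Real.rpow_add (abs_pos.2 (sub_ne_zero.2 h1)), ← add_div, div_self (by positivity),
      Real.rpow_one, ← abs_mul, abs_of_nonneg]
    have := psiReal_nonneg hx' hy'
    rwa [psiReal, ← Real.log_div hx'.ne' hy'.ne'] at this

/-- The collision weight `1 + v_i² + v_j²`. -/
def pairWeight (i j : Fin N) (V : KacSphere N) : ℝ := 1 + (V.1 i ^ 2 + V.1 j ^ 2)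

theorem one_le_pairWeight (i j : Fin N) (V : KacSphere N) : 1 ≤ pairWeight i j V := by
  have : 0 ≤ V.1 i ^ 2 + V.1 j ^ 2 := by positivity
  rw [pairWeight]
  linarith

theorem measurable_pairWeight (i j : Fin N) : Measurable (pairWeight i j) :=
  ((((continuous_coord i).pow 2).add ((continuous_coord j).pow 2)).const_add 1).measurable

theorem pairWeight_rot {i j : Fin N} (hij : i ≠ j) (θ : ℝ) (V : KacSphere N) :
    pairWeight i j (rot i j hij θ V) = pairWeight i j V := by
  simp only [pairWeight, rot, collide, if_true, if_neg hij.symm]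
  linear_combination (V.1 i ^ 2 + V.1 j ^ 2) * Real.sin_sq_add_cos_sq θ

theorem one_add_add_rpow_le {a b k : ℝ} (ha : 0 ≤ a) (hb : 0 ≤ b) (hk : 0 ≤ k) :
    (1 + (a + b)) ^ k ≤ 3 ^ k * (1 + a ^ k + b ^ k) := by
  have h : ∀ {m : ℝ}, 0 ≤ m → 1 + (a + b) ≤ 3 * m → m ^ k ≤ 1 + a ^ k + b ^ k →
      (1 + (a + b)) ^ k ≤ 3 ^ k * (1 + a ^ k + b ^ k) := fun {m} hm h1 h2 => by
    refine (Real.rpow_le_rpow (by positivity) h1 hk).trans ?_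
    rw [Real.mul_rpow zero_le_three hm]
    gcongr
  have h1 := Real.rpow_nonneg ha k
  have h2 := Real.rpow_nonneg hb k
  rcases le_total a b with hab | hab
  · rcases le_total b 1 with h3 | h3
    · exact h zero_le_one (by linarith) (by rw [Real.one_rpow]; linarith)
    · exact h hb (by linarith) (by linarith)
  · rcases le_total a 1 with h3 | h3
    · exact h zero_le_one (by linarith) (by rw [Real.one_rpow]; linarith)
    · exact h ha (by linarith) (by linarith)

theorem lintegral_abs_rpow_mul_eq (r : ℝ) {i j : Fin N} {F : KacSphere N → ℝ}
    (hF : IsSymmDensity F) :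
    ∫⁻ V, ENNReal.ofReal (|V.1 j| ^ r * F V) ∂(kacMeasure N) =
      ∫⁻ V, ENNReal.ofReal (|V.1 i| ^ r * F V) ∂(kacMeasure N) := by
  have hm : Measurable fun V : KacSphere N => ENNReal.ofReal (|V.1 i| ^ r * F V) :=
    (((continuous_coord i).abs.measurable.pow_const r).mul hF.measurable).ennreal_ofReal
  rw [← (measurePreserving_permute (Equiv.swap i j)).lintegral_comp hm]
  refine lintegral_congr fun V => ?_
  rw [hF.symm]
  simp [permute]

theorem lintegral_pairWeight_rpow_le (hN : 2 ≤ N) {k M : ℝ} (hk : 0 ≤ k) (hM : 0 ≤ M)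
    {F : KacSphere N → ℝ} (hF : IsSymmDensity F) (hm : moment hN k F ≤ ENNReal.ofReal M) :
    ∫⁻ V, ENNReal.ofReal (pairWeight (first hN) (second hN) V ^ k) * ENNReal.ofReal (F V)
      ∂(kacMeasure N) ≤ ENNReal.ofReal (3 ^ k * (1 + 2 * M)) := by
  have hms : ∀ i : Fin N, Measurable fun V : KacSphere N =>
      ENNReal.ofReal (|V.1 i| ^ (2 * k) * F V) := fun i =>
    (((continuous_coord i).abs.measurable.pow_const _).mul hF.measurable).ennreal_ofReal
  have hle : ∀ V : KacSphere N, ENNReal.ofReal (pairWeight (first hN) (second hN) V ^ k) *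
      ENNReal.ofReal (F V) ≤ ENNReal.ofReal (3 ^ k) * (ENNReal.ofReal (F V) +
        ENNReal.ofReal (|V.1 (first hN)| ^ (2 * k) * F V) +
        ENNReal.ofReal (|V.1 (second hN)| ^ (2 * k) * F V)) := fun V => by
    have hF0 := hF.nonneg V
    have hsq : ∀ l, (V.1 l ^ 2) ^ k = |V.1 l| ^ (2 * k) := fun l => by
      rw [← sq_abs, ← Real.rpow_natCast, ← Real.rpow_mul (abs_nonneg _), Nat.cast_ofNat]
    have h := one_add_add_rpow_le (sq_nonneg (V.1 (first hN))) (sq_nonneg (V.1 (second hN))) hk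
    rw [hsq, hsq] at h
    have hw := one_le_pairWeight (first hN) (second hN) V
    rw [← ENNReal.ofReal_add (by positivity) (by positivity),
      ← ENNReal.ofReal_add (by positivity) (by positivity), ← ENNReal.ofReal_mul (by positivity),
      ← ENNReal.ofReal_mul (by positivity)]
    refine ENNReal.ofReal_le_ofReal ?_
    refine (mul_le_mul_of_nonneg_right h hF0).trans (le_of_eq ?_)
    ring
  refine (lintegral_mono hle).trans ?_
  rw [lintegral_const_mul' _ _ ENNReal.ofReal_ne_top, lintegral_add_right _ (hms _),
    lintegral_add_right _ (hms _), hF.lintegral_eq_one,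
    lintegral_abs_rpow_mul_eq (2 * k) (i := first hN) (j := second hN) hF,
    ENNReal.ofReal_mul (by positivity)]
  refine mul_le_mul_right ?_ _
  rw [moment] at hm
  rw [show 1 + 2 * M = 1 + M + M by ring, ENNReal.ofReal_add (by positivity) hM, ENNReal.ofReal_add zero_le_one hM,
    ENNReal.ofReal_one]
  gcongr

/-- The weight is invariant under the collision, so the two terms of `|F - F'| ≤ F + F'` have the
same weighted integral. -/
theorem lintegral_pairWeight_mul_abs_sub_le {i j : Fin N} (hij : i ≠ j) (k : ℝ)
    {F : KacSphere N → ℝ} (hF : IsSymmDensity F) :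
    ∫⁻ q, ENNReal.ofReal (pairWeight i j q.2 ^ k) *
      ENNReal.ofReal |F q.2 - F (rot i j hij q.1 q.2)| ∂(angleMeasure N) ≤
    ENNReal.ofReal (2 * Real.pi) * (2 * ∫⁻ V, ENNReal.ofReal (pairWeight i j V ^ k) *
      ENNReal.ofReal (F V) ∂(kacMeasure N)) := by
  have hw : Measurable fun V : KacSphere N => ENNReal.ofReal (pairWeight i j V ^ k) :=
    ((measurable_pairWeight i j).pow_const k).ennreal_ofReal
  have hFm : Measurable fun V : KacSphere N => ENNReal.ofReal (pairWeight i j V ^ k) *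
      ENNReal.ofReal (F V) := hw.mul hF.measurable.ennreal_ofReal
  have hm : Measurable fun q : ℝ × KacSphere N => ENNReal.ofReal (pairWeight i j q.2 ^ k) *
      ENNReal.ofReal |F q.2 - F (rot i j hij q.1 q.2)| :=
    (hw.comp measurable_snd).mul ((hF.measurable.comp measurable_snd).sub
      (measurable_comp_rot hij hF.measurable)).abs.ennreal_ofReal
  rw [lintegral_prod _ hm.aemeasurable]
  have hθ : ∀ θ : ℝ, ∫⁻ V, ENNReal.ofReal (pairWeight i j V ^ k) *
      ENNReal.ofReal |F V - F (rot i j hij θ V)| ∂(kacMeasure N) ≤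
      2 * ∫⁻ V, ENNReal.ofReal (pairWeight i j V ^ k) * ENNReal.ofReal (F V) ∂(kacMeasure N) := by
    intro θ
    calc _ ≤ ∫⁻ V, (ENNReal.ofReal (pairWeight i j V ^ k) * ENNReal.ofReal (F V) +
          ENNReal.ofReal (pairWeight i j (rot i j hij θ V) ^ k) *
            ENNReal.ofReal (F (rot i j hij θ V))) ∂(kacMeasure N) := by
          refine lintegral_mono fun V => ?_
          dsimp only
          rw [pairWeight_rot, ← mul_add, ← ENNReal.ofReal_add (hF.nonneg _) (hF.nonneg _)]
          gcongr
          have h1 := hF.nonneg V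
          have h2 := hF.nonneg (rot i j hij θ V)
          rw [abs_le]
          constructor <;> linarith
      _ = _ := by
          rw [lintegral_add_left hFm, (measurePreserving_rot i j hij θ).lintegral_comp hFm, two_mul]
  refine (lintegral_mono hθ).trans (le_of_eq ?_)
  rw [lintegral_const, Measure.restrict_apply_univ, Real.volume_Icc, sub_zero, mul_comm]

/-- Hölder with exponents `1 + β` and `(1 + β) / β`, the weight going with the difference of
densities. Its power `(1 + β) / β` is smaller than `k`, and the excess becomes a negative power of
`R`. -/
theorem lintegral_tail_le {β k R : ℝ} (hβ : 0 < β) (hk : 1 + 1 / β < k) (hR : 0 < R) {i j : Fin N}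
    (hij : i ≠ j) {F : KacSphere N → ℝ} (hF : IsSymmDensity F) :
    ∫⁻ q in {q : ℝ × KacSphere N | R < pairWeight i j q.2}, ENNReal.ofReal (pairWeight i j q.2) *
      psi (F q.2) (F (rot i j hij q.1 q.2)) ∂(angleMeasure N) ≤
    (∫⁻ q, psiPow β (F q.2) (F (rot i j hij q.1 q.2)) ∂(angleMeasure N)) ^ (1 / (1 + β)) *
      (ENNReal.ofReal (R ^ ((1 + β) / β - k)) * ∫⁻ q, ENNReal.ofReal (pairWeight i j q.2 ^ k) *
        ENNReal.ofReal |F q.2 - F (rot i j hij q.1 q.2)| ∂(angleMeasure N)) ^ (β / (1 + β)) := by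
  have hconj : (1 + β).HolderConjugate ((1 + β) / β) := by
    rw [Real.holderConjugate_iff]
    refine ⟨by linarith, ?_⟩
    field_simp
  have hexp : (1 + β) / β - k ≤ 0 := by
    have : (1 + β) / β = 1 + 1 / β := by field_simp; ring
    linarith
  have hS : MeasurableSet {q : ℝ × KacSphere N | R < pairWeight i j q.2} :=
    measurableSet_lt measurable_const ((measurable_pairWeight i j).comp measurable_snd)
  have hpair : Measurable fun q : ℝ × KacSphere N => (F q.2, F (rot i j hij q.1 q.2)) :=
    (hF.measurable.comp measurable_snd).prodMk (measurable_comp_rot hij hF.measurable)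
  have hf : Measurable fun q : ℝ × KacSphere N =>
      psiPow β (F q.2) (F (rot i j hij q.1 q.2)) ^ (1 / (1 + β)) :=
    ((measurable_psiPow β).comp hpair).pow_const _
  have hg : Measurable fun q : ℝ × KacSphere N => ENNReal.ofReal (pairWeight i j q.2) *
      ENNReal.ofReal |F q.2 - F (rot i j hij q.1 q.2)| ^ (β / (1 + β)) :=
    ((measurable_pairWeight i j).comp measurable_snd).ennreal_ofReal.mul
      ((((hF.measurable.comp measurable_snd).sub
        (measurable_comp_rot hij hF.measurable)).abs.ennreal_ofReal).pow_const _)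
  have hH := ENNReal.lintegral_mul_le_Lp_mul_Lq
    ((angleMeasure N).restrict {q : ℝ × KacSphere N | R < pairWeight i j q.2}) hconj
    hf.aemeasurable hg.aemeasurable
  have hq : 1 / ((1 + β) / β) = β / (1 + β) := one_div_div _ _
  simp only [Pi.mul_apply, hq] at hH
  refine le_trans (le_of_eq (lintegral_congr fun q => ?_)) (hH.trans ?_)
  · rw [psi_eq_psiPow_rpow_mul hβ (hF.nonneg _) (hF.nonneg _)]
    ring
  · refine mul_le_mul' (ENNReal.rpow_le_rpow ?_ (by positivity))
      (ENNReal.rpow_le_rpow ?_ (by positivity))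
    · refine (lintegral_mono' Measure.restrict_le_self le_rfl).trans (le_of_eq ?_)
      refine lintegral_congr fun q => ?_
      rw [← ENNReal.rpow_mul, one_div_mul_cancel (by positivity), ENNReal.rpow_one]
    · rw [← lintegral_const_mul' _ _ ENNReal.ofReal_ne_top]
      refine (setLIntegral_mono' hS fun q hq => ?_).trans
        (lintegral_mono' Measure.restrict_le_self le_rfl)
      have hw : 0 < pairWeight i j q.2 := zero_lt_one.trans_le (one_le_pairWeight i j q.2)
      rw [ENNReal.mul_rpow_of_nonneg _ _ (by positivity), ← ENNReal.rpow_mul,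
        div_mul_div_cancel₀ (by positivity), div_self hβ.ne', ENNReal.rpow_one,
        ENNReal.ofReal_rpow_of_pos hw, ← mul_assoc,
        ← ENNReal.ofReal_mul (Real.rpow_nonneg hR.le ((1 + β) / β - k))]
      refine mul_le_mul_left (ENNReal.ofReal_le_ofReal ?_) _
      have h1 : pairWeight i j q.2 ^ ((1 + β) / β) =
          pairWeight i j q.2 ^ ((1 + β) / β - k) * pairWeight i j q.2 ^ k := by
        rw [← Real.rpow_add hw, sub_add_cancel]
      rw [h1]
      exact mul_le_mul_of_nonneg_right (Real.rpow_le_rpow_of_nonpos hR (le_of_lt hq) hexp)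
        (by positivity)

/-- The constant `B` of the rate. -/
def tailConstant (β k Cβ M : ℝ) : ℝ := Cβ / 2 * (2 * 3 ^ k * (1 + 2 * M)) ^ (β / (1 + β))

theorem tailConstant_pos {β k Cβ M : ℝ} (hC : 0 < Cβ) (hM : 0 ≤ M) :
    0 < tailConstant β k Cβ M := by
  have : 0 < 2 * 3 ^ k * (1 + 2 * M) := by positivity
  exact mul_pos (by positivity) (Real.rpow_pos_of_pos this _)

/-- The decay exponent of the contribution of large velocities. -/
def tailExponent (β k : ℝ) : ℝ := (k * β - (1 + β)) / (1 + β)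

theorem tailExponent_pos {β k : ℝ} (hβ : 0 < β) (hk : 1 + 1 / β < k) : 0 < tailExponent β k := by
  have h := mul_lt_mul_of_pos_right hk hβ
  have h2 : (1 + 1 / β) * β = 1 + β := by field_simp; ring
  rw [h2] at h
  exact div_pos (by linarith) (by linarith)

/-- The Hölder exponents add to one, so the two powers of `2π` combine into `2π`, and with `1 /
(4π)` they give the 1/2 in `tailConstant`. -/
theorem lintegral_tail_le_ofReal (hN : 2 ≤ N) {β k Cβ M R : ℝ} (hβ : 0 < β) (hk : 1 + 1 / β < k)
    (hC : 0 < Cβ) (hM : 0 ≤ M) (hR : 0 < R) {F : KacSphere N → ℝ} (hF : IsSymmDensity F)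
    (hP : ENNReal.ofReal (1 / (2 * Real.pi)) * ∫⁻ θ in Icc (0 : ℝ) (2 * Real.pi), ∫⁻ V,
      psiPow β (F V) (F (rot (first hN) (second hN) (first_ne_second hN) θ V)) ∂(kacMeasure N)
        ∂volume ≤ ENNReal.ofReal (Cβ ^ (1 + β)))
    (hm : moment hN k F ≤ ENNReal.ofReal M) :
    ENNReal.ofReal (1 / (4 * Real.pi)) *
      ∫⁻ q in {q : ℝ × KacSphere N | R < pairWeight (first hN) (second hN) q.2},
        ENNReal.ofReal (pairWeight (first hN) (second hN) q.2) *
          psi (F q.2) (F (rot (first hN) (second hN) (first_ne_second hN) q.1 q.2))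
            ∂(angleMeasure N) ≤
      ENNReal.ofReal (tailConstant β k Cβ M * R ^ (-tailExponent β k)) := by
  have hpi := Real.pi_pos
  have hb : 0 < 1 / (1 + β) := by positivity
  have hb2 : 0 < β / (1 + β) := by positivity
  have hk0 : 0 < k := lt_trans (by positivity) hk
  set K : ℝ := 2 * 3 ^ k * (1 + 2 * M) with hK
  have hK0 : 0 < K := by positivity
  have h1 : ∫⁻ q, psiPow β (F q.2) (F (rot (first hN) (second hN) (first_ne_second hN) q.1 q.2))
      ∂(angleMeasure N) ≤ ENNReal.ofReal (2 * Real.pi * Cβ ^ (1 + β)) := by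
    rw [lintegral_prod]
    · have h2 := mul_le_mul_right hP (ENNReal.ofReal (2 * Real.pi))
      rw [← mul_assoc, ← ENNReal.ofReal_mul (by positivity), ← ENNReal.ofReal_mul (by positivity),
        mul_one_div_cancel (by positivity), ENNReal.ofReal_one, one_mul] at h2
      exact h2
    · exact ((measurable_psiPow β).comp ((hF.measurable.comp measurable_snd).prodMk
        (measurable_comp_rot _ hF.measurable))).aemeasurable
  have h2 := (lintegral_pairWeight_mul_abs_sub_le (first_ne_second hN) k hF).trans
    (mul_le_mul_right (mul_le_mul_right (lintegral_pairWeight_rpow_le hN hk0.le hM hF hm) 2) _)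
  have h0 : (2 : ℝ≥0∞) * ENNReal.ofReal (3 ^ k * (1 + 2 * M)) = ENNReal.ofReal K := by
    rw [← ENNReal.ofReal_ofNat, ← ENNReal.ofReal_mul zero_le_two, ← mul_assoc]
  rw [h0, ← ENNReal.ofReal_mul (by positivity)] at h2
  have h3 := (lintegral_tail_le hβ hk hR (first_ne_second hN) hF).trans
    (mul_le_mul' (ENNReal.rpow_le_rpow h1 hb.le)
      (ENNReal.rpow_le_rpow (mul_le_mul_right h2 _) hb2.le))
  refine (mul_le_mul_right h3 _).trans (le_of_eq ?_)
  rw [← ENNReal.ofReal_mul (by positivity), ENNReal.ofReal_rpow_of_nonneg (by positivity) hb.le,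
    ENNReal.ofReal_rpow_of_nonneg (by positivity) hb2.le, ← ENNReal.ofReal_mul (by positivity),
    ← ENNReal.ofReal_mul (by positivity)]
  congr 1
  rw [Real.mul_rpow (x := 2 * Real.pi) (y := Cβ ^ (1 + β)) (by positivity) (by positivity),
    Real.mul_rpow (x := R ^ ((1 + β) / β - k)) (by positivity) (by positivity),
    Real.mul_rpow (x := 2 * Real.pi) (y := K) (by positivity) hK0.le, ← Real.rpow_mul hC.le, ← Real.rpow_mul hR.le,
    mul_one_div_cancel (by positivity), Real.rpow_one]
  have h4 : ((1 + β) / β - k) * (β / (1 + β)) = -tailExponent β k := by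
    rw [tailExponent]
    field_simp
    ring
  have h5 : (2 * Real.pi) ^ (1 / (1 + β)) * (2 * Real.pi) ^ (β / (1 + β)) = 2 * Real.pi := by
    rw [← Real.rpow_add (by positivity), ← add_div, div_self (by positivity), Real.rpow_one]
  rw [h4, tailConstant, ← hK]
  calc _ = 1 / (4 * Real.pi) * ((2 * Real.pi) ^ (1 / (1 + β)) * (2 * Real.pi) ^ (β / (1 + β))) *
        Cβ * K ^ (β / (1 + β)) * R ^ (-tailExponent β k) := by ring
    _ = _ := by
        rw [h5]
        field_simp
        ring

theorem pairRate_eq_lintegral (γ : ℝ) {i j : Fin N} (hij : i ≠ j) {F : KacSphere N → ℝ}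
    (hF : IsSymmDensity F) :
    pairRate γ hij F = ∫⁻ q, ENNReal.ofReal (pairWeight i j q.2 ^ γ) *
      psi (F q.2) (F (rot i j hij q.1 q.2)) ∂(angleMeasure N) := by
  have hm : Measurable fun q : ℝ × KacSphere N => ENNReal.ofReal (pairWeight i j q.2 ^ γ) *
      psi (F q.2) (F (rot i j hij q.1 q.2)) :=
    (((measurable_pairWeight i j).pow_const γ).ennreal_ofReal.comp measurable_snd).mul
      (measurable_psi_rot hij hF.measurable)
  rw [lintegral_prod_symm _ hm.aemeasurable]
  rfl

theorem pairRate_one_le {γ R : ℝ} (hγ : γ ≤ 1) (hR : 0 < R) {i j : Fin N} (hij : i ≠ j)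
    {F : KacSphere N → ℝ} (hF : IsSymmDensity F) :
    pairRate 1 hij F ≤ ENNReal.ofReal (R ^ (1 - γ)) * pairRate γ hij F +
      ∫⁻ q in {q : ℝ × KacSphere N | R < pairWeight i j q.2},
        ENNReal.ofReal (pairWeight i j q.2) * psi (F q.2) (F (rot i j hij q.1 q.2))
          ∂(angleMeasure N) := by
  have hS : MeasurableSet {q : ℝ × KacSphere N | R < pairWeight i j q.2} :=
    measurableSet_lt measurable_const ((measurable_pairWeight i j).comp measurable_snd)
  rw [pairRate_eq_lintegral _ _ hF, pairRate_eq_lintegral _ _ hF]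
  simp only [Real.rpow_one]
  rw [← lintegral_add_compl _ hS, add_comm, ← lintegral_const_mul' _ _ ENNReal.ofReal_ne_top]
  refine add_le_add_left ((setLIntegral_mono' hS.compl fun q hq => ?_).trans
    (lintegral_mono' Measure.restrict_le_self le_rfl)) _
  have hw : 0 < pairWeight i j q.2 := zero_lt_one.trans_le (one_le_pairWeight i j q.2)
  rw [← mul_assoc, ← ENNReal.ofReal_mul (by positivity)]
  refine mul_le_mul_left (ENNReal.ofReal_le_ofReal ?_) _
  calc pairWeight i j q.2 = pairWeight i j q.2 ^ (1 - γ) * pairWeight i j q.2 ^ γ := by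
        rw [← Real.rpow_add hw, sub_add_cancel, Real.rpow_one]
    _ ≤ _ := by
        have hq' : pairWeight i j q.2 ≤ R := by simpa using hq
        exact mul_le_mul_of_nonneg_right (Real.rpow_le_rpow hw.le hq' (by linarith))
          (by positivity)

/-- The weight is at least 1, so below that level nothing is truncated. The tail estimate then shows
that the production for γ = 1 is finite. -/
theorem pairRate_one_eq_tail {R : ℝ} (hR : R < 1) {i j : Fin N} (hij : i ≠ j)
    {F : KacSphere N → ℝ} (hF : IsSymmDensity F) :
    pairRate 1 hij F = ∫⁻ q in {q : ℝ × KacSphere N | R < pairWeight i j q.2},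
        ENNReal.ofReal (pairWeight i j q.2) * psi (F q.2) (F (rot i j hij q.1 q.2))
          ∂(angleMeasure N) := by
  have h : {q : ℝ × KacSphere N | R < pairWeight i j q.2} = univ :=
    eq_univ_of_forall fun q => hR.trans_le (one_le_pairWeight i j q.2)
  rw [pairRate_eq_lintegral _ _ hF, h, Measure.restrict_univ]
  simp only [Real.rpow_one]

/-! ### Interpolation and choice of the truncation -/

/-- The optimisation over the truncation parameter. -/
theorem rate_le_of_forall_le {c p B h E : ℝ} (hc : 0 < c) (hp : 0 < p) (hB : 0 < B) (hh : 0 < h)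
    (hx : ∀ x : ℝ, 0 < x → c * h ≤ x ^ p * E + B / x) :
    (c / (1 + p)) ^ (1 + p) * (p / B) ^ p * h ^ (1 + p) ≤ E := by
  -- This value maximises `(c h - B / x) / x ^ p`: it makes `B / x` the fraction `p / (1 + p)` of `c
  -- h`.
  have h1 := hx (B * (1 + p) / (c * h * p)) (by positivity)
  set x := B * (1 + p) / (c * h * p) with hxdef
  have hx0 : 0 < x := by positivity
  have h2 : B / x = c * h - c * h / (1 + p) := by
    rw [hxdef]
    field_simp
    ring
  have h3 : c * h / (1 + p) ≤ x ^ p * E := by linarith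
  have h4 : (c / (1 + p)) ^ (1 + p) * (p / B) ^ p * h ^ (1 + p) = (c * h / (1 + p)) / x ^ p := by
    have e1 : x = (c * h / (1 + p))⁻¹ * (p / B)⁻¹ := by
      rw [hxdef]
      field_simp
    rw [e1, Real.mul_rpow (by positivity) (by positivity), Real.inv_rpow (by positivity),
      Real.inv_rpow (by positivity), ← mul_inv, div_inv_eq_mul, mul_right_comm,
      ← Real.mul_rpow (by positivity) hh.le, div_mul_eq_mul_div,
      Real.rpow_add (by positivity), Real.rpow_one]
    ring
  rw [h4, div_le_iff₀ (by positivity)]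
  linarith

theorem gain_eq {β k γ : ℝ} (hβ : 0 < β) : gain β k γ = (1 - γ) / tailExponent β k := by
  have : (1 + β) ≠ 0 := by positivity
  rw [gain, tailExponent, div_div_eq_mul_div]

theorem gain_nonneg {β k γ : ℝ} (hβ : 0 < β) (hk : 1 + 1 / β < k) (hγ : γ ≤ 1) :
    0 ≤ gain β k γ := by
  rw [gain_eq hβ]
  exact div_nonneg (by linarith) (tailExponent_pos hβ hk).le

theorem rateConstant_eq (c β k γ Cβ M : ℝ) : rateConstant c β k γ Cβ M =
    (c / (1 + gain β k γ)) ^ (1 + gain β k γ) *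
      (gain β k γ / tailConstant β k Cβ M) ^ gain β k γ := rfl

theorem rateConstant_pos {c β k γ Cβ M : ℝ} (hc : 0 < c) (hβ : 0 < β) (hk : 1 + 1 / β < k)
    (hγ : γ ≤ 1) (hC : 0 < Cβ) (hM : 0 ≤ M) : 0 < rateConstant c β k γ Cβ M := by
  have hB := tailConstant_pos (β := β) (k := k) hC hM
  rw [rateConstant_eq]
  rcases (gain_nonneg hβ hk hγ).eq_or_lt with h | h
  · rw [← h]
    simpa using hc
  · positivity

theorem integrable_and_rate_le (hN : 2 ≤ N) {β k γ Cβ M : ℝ} (hβ : 0 < β) (hk : 1 + 1 / β < k)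
    (hγ : γ ≤ 1) (hC : 0 < Cβ) (hM : 0 ≤ M) {F : KacSphere N → ℝ} (hF : IsSymmDensity F)
    (hP : ENNReal.ofReal (1 / (2 * Real.pi)) * ∫⁻ θ in Icc (0 : ℝ) (2 * Real.pi), ∫⁻ V,
      psiPow β (F V) (F (rot (first hN) (second hN) (first_ne_second hN) θ V)) ∂(kacMeasure N)
        ∂volume ≤ ENNReal.ofReal (Cβ ^ (1 + β)))
    (hm : moment hN k F ≤ ENNReal.ofReal M) :
    Integrable (fun V => F V * Real.log (F V)) (kacMeasure N) ∧
      ENNReal.ofReal (rateConstant (Real.exp (-48) / 2) β k γ Cβ M *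
        (entropy F / N) ^ (1 + gain β k γ)) ≤ entropyProduction γ F / N := by
  have hN0 : (0 : ℝ) < N := by positivity
  have hNn : (N : ℝ≥0∞) ≠ 0 := by simp; omega
  have hs := tailExponent_pos hβ hk
  have hB := tailConstant_pos (β := β) (k := k) hC hM
  have hp0 := gain_nonneg hβ hk hγ
  have hc : 0 < Real.exp (-48) / 2 := by positivity
  set c := Real.exp (-48) / 2 with hcdef
  have htail := fun {R : ℝ} (hR : 0 < R) => lintegral_tail_le_ofReal hN hβ hk hC hM hR hF hP hm
  have hdiv := fun δ : ℝ => entropyProduction_div_eq hN δ (first_ne_second hN) hF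
  -- Any `R < 1` makes the tail the whole integral. Finiteness here gives the integrability of `F
  -- log F` even when the production for γ is infinite.
  have hD1 : entropyProduction 1 F / N ≠ ∞ := by
    rw [hdiv, pairRate_one_eq_tail (R := 1 / 2) (by norm_num) _ hF]
    exact ne_top_of_le_ne_top ENNReal.ofReal_ne_top (htail (by norm_num))
  have hD : entropyProduction 1 F ≠ ∞ := fun h => hD1 (by
    rw [h, ENNReal.top_div_of_ne_top (ENNReal.natCast_ne_top N)])
  have hi := integrable_mul_log hN hF hD
  refine ⟨hi, ?_⟩
  have hent := entropy_nonneg (by omega) hF hi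
  have h1 : c * (entropy F / N) ≤ (entropyProduction 1 F / N).toReal := by
    rw [ENNReal.toReal_div, ENNReal.toReal_natCast, ← mul_div_assoc]
    have := entropy_le_entropyProduction hN hF hD
    gcongr
  set h := entropy F / N with hdef
  have hh : 0 ≤ h := by positivity
  by_cases hE : entropyProduction γ F / N = ∞
  · rw [hE]
    exact le_top
  refine (ENNReal.ofReal_le_iff_le_toReal hE).2 ?_
  rcases hh.eq_or_lt with h0 | h0
  · rw [← h0, Real.zero_rpow (by positivity), mul_zero]
    exact ENNReal.toReal_nonneg
  have hsplit : ∀ R : ℝ, 0 < R → c * h ≤ R ^ (1 - γ) * (entropyProduction γ F / N).toReal +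
      tailConstant β k Cβ M * R ^ (-tailExponent β k) := fun R hR => by
    have h2 : entropyProduction 1 F / N ≤ ENNReal.ofReal (R ^ (1 - γ)) *
        (entropyProduction γ F / N) +
          ENNReal.ofReal (tailConstant β k Cβ M * R ^ (-tailExponent β k)) := by
      refine le_trans ?_ (add_le_add_right (htail hR) _)
      rw [hdiv, hdiv, mul_left_comm, ← mul_add]
      exact mul_le_mul_right (pairRate_one_le hγ hR (first_ne_second hN) hF) _
    have h3 := ENNReal.toReal_mono (ENNReal.add_ne_top.2
      ⟨ENNReal.mul_ne_top ENNReal.ofReal_ne_top hE, ENNReal.ofReal_ne_top⟩) h2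
    rw [ENNReal.toReal_add (ENNReal.mul_ne_top ENNReal.ofReal_ne_top hE) ENNReal.ofReal_ne_top,
      ENNReal.toReal_mul, ENNReal.toReal_ofReal (by positivity),
      ENNReal.toReal_ofReal (by positivity)] at h3
    exact h1.trans h3
  -- A zero gain means γ = 1: the linear bound is then the claim, with `0 ^ 0 = 1` in the constant.
  rcases hp0.eq_or_lt with hp | hp
  · have hγ1 : γ = 1 := by
      have h2 := hp.symm
      rw [gain_eq hβ, div_eq_zero_iff] at h2
      rcases h2 with h2 | h2
      · linarith
      · exact absurd h2 hs.ne'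
    rw [rateConstant_eq, ← hp]
    subst hγ1
    simpa using h1
  · rw [rateConstant_eq]
    refine rate_le_of_forall_le hc hp hB h0 fun x hx => ?_
    -- With `R = x ^ (1 / s)`, where `s` is the tail exponent, the tail decays like `1 / x` and `R ^
    -- (1 - γ)` becomes `x ^ p`.
    have h2 := hsplit (x ^ (tailExponent β k)⁻¹) (Real.rpow_pos_of_pos hx _)
    rwa [← Real.rpow_mul hx.le, ← Real.rpow_mul hx.le, mul_neg, inv_mul_cancel₀ hs.ne',
      Real.rpow_neg_one, inv_mul_eq_div, ← gain_eq hβ, ← div_eq_mul_inv] at h2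

end KacModel

end

theorem mainTheorem1 :
    ∃ c : ℝ, 0 < c ∧
      ∀ (β k γ Cβ M : ℝ), 0 < β → 1 + 1 / β < k → 0 ≤ γ → γ ≤ 1 → 0 < Cβ → 0 ≤ M →
        0 < KacModel.rateConstant c β k γ Cβ M ∧
        ∀ F : ∀ N : ℕ, KacModel.KacSphere N → ℝ,
          (∀ N : ℕ, 2 ≤ N → KacModel.IsSymmDensity (F N)) →
          KacModel.IsLogPowerWith β Cβ F →
          (∀ (N : ℕ) (hN : 2 ≤ N), KacModel.moment hN k (F N) ≤ ENNReal.ofReal M) →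
          ∀ N : ℕ, 2 ≤ N →
            MeasureTheory.Integrable (fun V => F N V * Real.log (F N V))
              (KacModel.kacMeasure N) ∧
            ENNReal.ofReal (KacModel.rateConstant c β k γ Cβ M *
                (KacModel.entropy (F N) / N) ^
                  (1 + (1 - γ) * (1 + β) / (k * β - (1 + β)))) ≤
              KacModel.entropyProduction γ (F N) / (N : ENNReal) := by
  -- The factor `exp (-48)` comes from running the heat flow up to time 12, the 1/2 from smoothing.
  refine ⟨Real.exp (-48) / 2, by positivity, fun β k γ Cβ M hβ hk _ hγ hC hM =>
    ⟨KacModel.rateConstant_pos (by positivity) hβ hk hγ hC hM, fun F hF hP hm N hN => ?_⟩⟩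
  exact KacModel.integrable_and_rate_le hN hβ hk hγ hC hM (hF N hN) (hP N hN) (hm N hN)
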